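/- Let $p\neq l$ be prime numbers, let $K$ be a finite extension of $\mathbb{Q}_p$ with valuation ring $R$ and residue field $k$, and let $H$ be a finite $l$-elementary group, i.e. the direct product of a cyclic group of order prime to $l$ and an $l$-group. Write $H=C\times L$ (internal direct product of subgroups), where $C$ is a cyclic $p$-group and $L$ has order prime to $p$. Assume that $K$ is "assez gros" for $H$: it contains a primitive $e$-th root of unity, where $e$ is the exponent of $H$. Let $\Lambda=\Lambda_H$ be a Hopf $R$-order in $K[H]$, i.e. an $R$-subalgebra of $K[H]$ that is finitely generated as an $R$-module, spans $K[H]$ over $K$ and satisfies $\Delta(\Lambda)\subseteq\Lambda\otimes_R\Lambda$, $\varepsilon(\Lambda)\subseteq R$, $S(\Lambda)\subseteq\Lambda$ for the Hopf algebra structure $\Delta(h)=h\otimes h$, $\varepsilon(h)=1$, $S(h)=h^{-1}$ ($h\in H$) of $K[H]$. Put $\Lambda_C=\Lambda\cap K[C]$, $\Lambda_L=\Lambda\cap K[L]$ and $\widetilde{\Lambda}_\bullet=k\otimes_R\Lambda_\bullet$. For a ring $A$ let $G_0(A)$ be the Grothendieck group, for short exact sequences, of the finitely generated left $A$-modules;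 let $G_0^R(\Lambda)$ and $G_0^t(\Lambda)$ be the Grothendieck groups of the finitely generated $\Lambda$-modules that are free over $R$, respectively $R$-torsion. Let $$\varphi_\Lambda:G_0^R(\Lambda)\to G_0(K[H]),\ [M]\mapsto[K\otimes_RM],\qquad \delta_\Lambda:G_0^R(\Lambda)\to G_0(\widetilde\Lambda),\ [M]\mapsto[k\otimes_RM].$$ Then: 1. $\Lambda_H=\Lambda_C[L]$, i.e. $\Lambda_H$ is the set of finite sums of products $a\,g$ with $a\in\Lambda_C$, $g\in L$. 2. There is an isomorphism of abelian groups $G_0(\widetilde\Lambda_C)\otimes_{\mathbb Z}G_0(\widetilde\Lambda_L)\cong G_0(\widetilde\Lambda_H)$; it may be chosen such that $[M]\otimes[N]\mapsto[M\otimes_kN]$, where $\widetilde\Lambda_C$ acts on the first and $\widetilde\Lambda_L$ on the second factor. 3. There is a unique homomorphism $d_\Lambda:G_0(K[H])\to G_0(\widetilde\Lambda)$ with $d_\Lambda\circ\varphi_\Lambda=\delta_\Lambda$ (the decomposition map), and it is surjective. 4. There is a unique homomorphism $\psi_\Lambda:G_0^t(\Lambda)\to G_0^R(\Lambda)$ whose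 composite with the natural map $G_0^R(\Lambda)\to G_0(\Lambda)$ is the natural map $G_0^t(\Lambda)\to G_0(\Lambda)$, and $\mathrm{Im}\,\psi_\Lambda=0$. 5. $\Lambda$ has the Swan property: $\varphi_\Lambda$ is an isomorphism. -/

import Mathlib

universe u v

open scoped TensorProduct nonZeroDivisors

noncomputable section

namespace HopfOrders

/-! ### Grothendieck groups of modules -/

/-- A (left) module over the `R`-algebra `A`. The field `modR` only records the `R`-module
structure obtained by restriction along `R → A`: it is determined by `modA` and `tower`. -/
structure AlgModule (R : Type u) [CommRing R] (A : Type v) [Ring A] [Algebra R A] where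
  carrier : Type v
  [grp : AddCommGroup carrier]
  [modR : Module R carrier]
  [modA : Module A carrier]
  [tower : IsScalarTower R A carrier]

namespace AlgModule

attribute [instance] grp modR modA tower

instance {R : Type u} [CommRing R] {A : Type v} [Ring A] [Algebra R A] :
    CoeSort (AlgModule R A) (Type v) := ⟨carrier⟩

end AlgModule

section Groth

variable {R : Type u} [CommRing R] {A : Type v} [Ring A] [Algebra R A]

/-- `0 → M₁ → M₂ → M₃ → 0` is a short exact sequence of `A`-modules. -/
def IsShortExact {M₁ M₂ M₃ : AlgModule R A} (f : M₁ →ₗ[A] M₂) (g : M₂ →ₗ[A] M₃) : Prop :=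
  Function.Injective f ∧ Function.Exact f g ∧ Function.Surjective g

/-- The subgroup generated by the elements `[M₂] - [M₁] - [M₃]`, for all short exact sequences
`0 → M₁ → M₂ → M₃ → 0` of modules with the property `P`. -/
def relations (P : AlgModule R A → Prop) : AddSubgroup (FreeAbelianGroup {M // P M}) :=
  AddSubgroup.closure {x | ∃ (M₁ M₂ M₃ : {M // P M}) (f : M₁.1 →ₗ[A] M₂.1) (g : M₂.1 →ₗ[A] M₃.1),
    IsShortExact f g ∧
      x = FreeAbelianGroup.of M₂ - FreeAbelianGroup.of M₁ - FreeAbelianGroup.of M₃}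

/-- The Grothendieck group, for short exact sequences, of the `A`-modules with the property `P`. -/
abbrev Groth (P : AlgModule R A → Prop) : Type _ :=
  FreeAbelianGroup {M // P M} ⧸ relations P

/-- The class `[M]`. -/
def Groth.cls {P : AlgModule R A → Prop} (M : AlgModule R A) (hM : P M) : Groth P :=
  QuotientAddGroup.mk' (relations P) (FreeAbelianGroup.of ⟨M, hM⟩)

theorem Groth.cls_eq {P : AlgModule R A → Prop} {M₁ M₂ M₃ : AlgModule R A}
    (h₁ : P M₁) (h₂ : P M₂) (h₃ : P M₃) (f : M₁ →ₗ[A] M₂) (g : M₂ →ₗ[A] M₃)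
    (h : IsShortExact f g) :
    (Groth.cls M₂ h₂ : Groth P) - Groth.cls M₁ h₁ - Groth.cls M₃ h₃ = 0 := by
  unfold Groth.cls
  rw [← map_sub, ← map_sub]
  exact (QuotientAddGroup.eq_zero_iff _).2
    (AddSubgroup.subset_closure ⟨⟨M₁, h₁⟩, ⟨M₂, h₂⟩, ⟨M₃, h₃⟩, f, g, h, rfl⟩)

/-- The homomorphism induced by an operation on modules that preserves short exact sequences. -/
def Groth.map {R' : Type*} [CommRing R'] {A' : Type*} [Ring A'] [Algebra R' A']
    {P : AlgModule R A → Prop} {Q : AlgModule R' A' → Prop}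
    (F : AlgModule R A → AlgModule R' A') (hF : ∀ M, P M → Q (F M))
    (hex : ∀ (M₁ M₂ M₃ : AlgModule R A), P M₁ → P M₂ → P M₃ →
      ∀ (f : M₁ →ₗ[A] M₂) (g : M₂ →ₗ[A] M₃), IsShortExact f g →
        ∃ (f' : F M₁ →ₗ[A'] F M₂) (g' : F M₂ →ₗ[A'] F M₃), IsShortExact f' g') :
    Groth P →+ Groth Q :=
  QuotientAddGroup.lift (relations P)
    (FreeAbelianGroup.lift fun M : {M // P M} => (Groth.cls (F M.1) (hF M.1 M.2) : Groth Q)) (by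
      refine (AddSubgroup.closure_le _).2 ?_
      rintro x ⟨M₁, M₂, M₃, f, g, h, rfl⟩
      obtain ⟨f', g', h'⟩ := hex M₁ M₂ M₃ M₁.2 M₂.2 M₃.2 f g h
      simp only [SetLike.mem_coe, AddMonoidHom.mem_ker, map_sub, FreeAbelianGroup.lift_apply_of]
      exact Groth.cls_eq _ _ _ f' g' h')

theorem Groth.map_cls {R' : Type*} [CommRing R'] {A' : Type*} [Ring A'] [Algebra R' A']
    {P : AlgModule R A → Prop} {Q : AlgModule R' A' → Prop}
    (F : AlgModule R A → AlgModule R' A') (hF : ∀ M, P M → Q (F M)) (hex) (M : AlgModule R A)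
    (hM : P M) : Groth.map F hF hex (Groth.cls M hM : Groth P) = Groth.cls (F M) (hF M hM) := by
  simp [Groth.map, Groth.cls]

variable (R A)

/-- `G₀(A)`: all finitely generated `A`-modules. -/
abbrev G0 : Type _ := Groth fun M : AlgModule R A => Module.Finite A M

/-- `G₀ᴿ(A)`: the finitely generated `A`-modules that are free over `R` (the `A`-lattices). -/
abbrev G0Lat : Type _ := Groth fun M : AlgModule R A => Module.Finite A M ∧ Module.Free R M

/-- `G₀ᵗ(A)`: the finitely generated `A`-modules that are `R`-torsion modules. -/
abbrev G0Tors : Type _ := Groth fun M : AlgModule R A => Module.Finite A M ∧ Module.IsTorsion R M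

/-- The natural map `G₀ᴿ(A) → G₀(A)`, `[M] ↦ [M]`. -/
def latToG0 : G0Lat R A →+ G0 R A :=
  Groth.map id (fun _ h => h.1) fun _ _ _ _ _ _ f g h => ⟨f, g, h⟩

/-- The natural map `G₀ᵗ(A) → G₀(A)`, `[M] ↦ [M]`. -/
def torsToG0 : G0Tors R A →+ G0 R A :=
  Groth.map id (fun _ h => h.1) fun _ _ _ _ _ _ f g h => ⟨f, g, h⟩

end Groth

/-! ### Change of the ground ring -/

section BaseChange

variable {R : Type u} [CommRing R] (S : Type u) [CommRing S] [Algebra R S]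
  {A : Type (max u v)} [Ring A] [Algebra R A]

/-- The action of `S ⊗[R] A` on `S ⊗[R] M`: `(s ⊗ a) • (t ⊗ m) = (s * t) ⊗ (a • m)`. -/
def baseChangeAction (M : Type*) [AddCommGroup M] [Module R M] [Module A M]
    [IsScalarTower R A M] : S ⊗[R] A →ₐ[S] Module.End S (S ⊗[R] M) :=
  Algebra.TensorProduct.lift (Algebra.ofId S _)
    ((Module.End.baseChangeHom R S M).comp (Algebra.lsmul R R M)) fun s _ => by
      rw [Algebra.ofId_apply]; exact Algebra.commute_algebraMap_left s _

theorem baseChangeAction_tmul (M : Type*) [AddCommGroup M] [Module R M] [Module A M]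
    [IsScalarTower R A M] (s : S) (a : A) (t : S) (m : M) :
    baseChangeAction S M (s ⊗ₜ[R] a) (t ⊗ₜ[R] m) = (s * t) ⊗ₜ[R] (a • m) := rfl

/-- `S ⊗[R] M` as a module over `S ⊗[R] A`. -/
def baseChangeModule (M : AlgModule R A) : AlgModule S (S ⊗[R] A) :=
  letI : Module (S ⊗[R] A) (S ⊗[R] M) := Module.compHom _ (baseChangeAction S M).toRingHom
  { carrier := S ⊗[R] M
    tower := ⟨fun s x y => by
      change baseChangeAction S M (s • x) y = s • baseChangeAction S M x y
      rw [map_smul]; rfl⟩ }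

theorem baseChangeModule_smul (M : AlgModule R A) (s : S) (a : A) (t : S) (m : M) :
    (show baseChangeModule S M from
      (s ⊗ₜ[R] a) • (show baseChangeModule S M from (t ⊗ₜ[R] m : S ⊗[R] M))) =
      ((s * t) ⊗ₜ[R] (a • m) : S ⊗[R] M) := by
  exact baseChangeAction_tmul S M s a t m

theorem baseChangeModule_finite (M : AlgModule R A) (hM : Module.Finite A M) :
    Module.Finite (S ⊗[R] A) (baseChangeModule S M) := by
  obtain ⟨s, hs⟩ := hM
  classical
  refine ⟨s.image fun m : M => (show baseChangeModule S M from (1 ⊗ₜ[R] m : S ⊗[R] M)), ?_⟩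
  rw [eq_top_iff]
  rintro x -
  set N := Submodule.span (S ⊗[R] A) (((s.image fun m : M =>
    (show baseChangeModule S M from (1 ⊗ₜ[R] m : S ⊗[R] M))) : Finset _) :
      Set (baseChangeModule S M)) with hN
  have key : ∀ m ∈ Submodule.span A (s : Set M), ∀ t : S,
      (show baseChangeModule S M from (t ⊗ₜ[R] m : S ⊗[R] M)) ∈ N := by
    intro m hm
    induction hm using Submodule.span_induction with
    | mem m hm =>
      intro t
      have h := N.smul_mem (t ⊗ₜ[R] (1 : A)) (Submodule.subset_span (s := ((s.image fun m : M =>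
        (show baseChangeModule S M from (1 ⊗ₜ[R] m : S ⊗[R] M))) : Set (baseChangeModule S M)))
          (Finset.mem_coe.2 (Finset.mem_image_of_mem _ hm)))
      have e := baseChangeModule_smul S M t (1 : A) 1 m
      rw [mul_one, one_smul] at e
      exact e ▸ h
    | zero => intro t; rw [TensorProduct.tmul_zero]; exact N.zero_mem
    | add x y _ _ hx hy => intro t; rw [TensorProduct.tmul_add]; exact N.add_mem (hx t) (hy t)
    | smul a x _ hx =>
      intro t
      have h := N.smul_mem ((1 : S) ⊗ₜ[R] a) (hx t)
      have e := baseChangeModule_smul S M 1 a t x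
      rw [one_mul] at e
      exact e ▸ h
  have : ∀ y : S ⊗[R] M, (show baseChangeModule S M from y) ∈ N := by
    intro y
    induction y using TensorProduct.induction_on with
    | zero => exact N.zero_mem
    | tmul t m => exact key m (hs ▸ Submodule.mem_top) t
    | add x y hx hy => exact N.add_mem hx hy
  exact this x

/-- `id ⊗ f` as a map of `S ⊗[R] A`-modules. -/
def baseChangeMap {M N : AlgModule R A} (f : M →ₗ[A] N) :
    baseChangeModule S M →ₗ[S ⊗[R] A] baseChangeModule S N where
  toFun := LinearMap.lTensor S (f.restrictScalars R)
  map_add' := map_add _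
  map_smul' x y := by
    change LinearMap.lTensor S (f.restrictScalars R) (baseChangeAction S M x y) =
      baseChangeAction S N x (LinearMap.lTensor S (f.restrictScalars R) y)
    induction x using TensorProduct.induction_on with
    | zero =>
      rw [map_zero, map_zero]
      exact map_zero _
    | add x x' hx hx' =>
      rw [map_add, map_add, LinearMap.add_apply, ← hx, ← hx']
      exact map_add _ _ _
    | tmul s a =>
      induction y using TensorProduct.induction_on with
      | zero => simp only [map_zero]
      | add y y' hy hy' => simp only [map_add, hy, hy']
      | tmul t m =>
        rw [baseChangeAction_tmul, LinearMap.lTensor_tmul, LinearMap.lTensor_tmul,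
          baseChangeAction_tmul]
        exact congrArg _ (map_smul f a m)

theorem baseChangeMap_exact {M₁ M₂ M₃ : AlgModule R A} [Module.Free R M₃]
    (f : M₁ →ₗ[A] M₂) (g : M₂ →ₗ[A] M₃) (h : IsShortExact f g) :
    IsShortExact (baseChangeMap S f) (baseChangeMap S g) := by
  obtain ⟨hf, hfg, hg⟩ := h
  have hfg' : Function.Exact (f.restrictScalars R) (g.restrictScalars R) := hfg
  refine ⟨?_, lTensor_exact S hfg' hg, LinearMap.lTensor_surjective S hg⟩
  obtain ⟨s, hs⟩ := Module.projective_lifting_property (g.restrictScalars R) LinearMap.id hg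
  have hr : (∃ r, r ∘ₗ f.restrictScalars R = LinearMap.id) :=
    (((hfg'.split_tfae').out 0 1 :
      (Function.Injective (f.restrictScalars R) ∧ ∃ l, (g.restrictScalars R) ∘ₗ l = LinearMap.id) ↔
        (Function.Surjective (g.restrictScalars R) ∧
          ∃ l, l ∘ₗ (f.restrictScalars R) = LinearMap.id)).1 ⟨hf, s, hs⟩).2
  obtain ⟨r, hr⟩ := hr
  refine Function.LeftInverse.injective (g := LinearMap.lTensor S r) fun x => ?_
  change (LinearMap.lTensor S r ∘ₗ LinearMap.lTensor S (f.restrictScalars R)) x = x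
  rw [← LinearMap.lTensor_comp, hr, LinearMap.lTensor_id, LinearMap.id_apply]

variable (R A)

/-- The map `G₀ᴿ(A) → G₀(S ⊗[R] A)`, `[M] ↦ [S ⊗[R] M]`. -/
def baseChange : G0Lat R A →+ G0 S (S ⊗[R] A) :=
  Groth.map (baseChangeModule S) (fun M hM => baseChangeModule_finite S M hM.1)
    fun _ _ _ _ _ h₃ f g h =>
      haveI := h₃.2
      ⟨baseChangeMap S f, baseChangeMap S g, baseChangeMap_exact S f g h⟩

end BaseChange

/-- The isomorphism `G₀(B) → G₀(A)` given by restriction along an isomorphism `A ≃ B`. -/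
def G0.res {S : Type u} [CommRing S] {A B : Type v} [Ring A] [Algebra S A] [Ring B] [Algebra S B]
    (e : A ≃ₐ[S] B) : G0 S B →+ G0 S A :=
  Groth.map
    (fun M =>
      letI : Module A M := Module.compHom M e.toRingEquiv.toRingHom
      { carrier := M
        tower := ⟨fun s a m => by
          change e (s • a) • m = s • (e a • m)
          rw [map_smul, smul_assoc]⟩ })
    (fun M hM => by
      obtain ⟨s, hs⟩ := hM
      let : Module A M := Module.compHom M e.toRingEquiv.toRingHom
      refine ⟨s, ?_⟩
      change Submodule.span A (s : Set M) = ⊤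
      rw [eq_top_iff]
      rintro x -
      have hx : x ∈ Submodule.span B (s : Set M) := hs ▸ Submodule.mem_top
      induction hx using Submodule.span_induction with
      | mem x h => exact Submodule.subset_span h
      | zero => exact Submodule.zero_mem _
      | add x y _ _ hx hy => exact Submodule.add_mem _ hx hy
      | smul b x _ hx =>
        have : b • x = (e.symm b) • x := by
          change b • x = e (e.symm b) • x
          rw [AlgEquiv.apply_symm_apply]
        rw [this]
        exact Submodule.smul_mem _ _ hx)
    (fun M₁ M₂ M₃ _ _ _ f g h =>
      ⟨{ toFun := f, map_add' := map_add f, map_smul' := fun a x => map_smul f (e a) x },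
       { toFun := g, map_add' := map_add g, map_smul' := fun a x => map_smul g (e a) x }, h⟩)

/-! ### Orders in group algebras -/

section Orders

variable {R : Type u} [CommRing R] {K : Type u} [Field K] [Algebra R K]
  {G : Type v} [Group G]

/-- An `R`-order in `K[G]`: an `R`-subalgebra that is finitely generated as an `R`-module and spans
`K[G]` over `K`. -/
structure IsOrder (Λ : Subalgebra R (MonoidAlgebra K G)) : Prop where
  fg : Λ.toSubmodule.FG
  span_eq_top : Submodule.span K (Λ : Set (MonoidAlgebra K G)) = ⊤

/-- A Hopf `R`-order in `K[G]`: an `R`-order `Λ` to which the Hopf algebra structure of `K[G]`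
(`Δ g = g ⊗ g`, `ε g = 1`, `S g = g⁻¹`) restricts: `Δ(Λ)` is contained in `Λ ⊗[R] Λ` (the `R`-span
of the elements `a ⊗ b` of `K[G] ⊗[K] K[G]` with `a, b ∈ Λ`), `ε(Λ) ⊆ R` and `S(Λ) ⊆ Λ`. -/
structure IsHopfOrder (Λ : Subalgebra R (MonoidAlgebra K G)) : Prop extends IsOrder Λ where
  comul_mem : ∀ x ∈ Λ, Coalgebra.comul (R := K) x ∈
    Submodule.span R {t : MonoidAlgebra K G ⊗[K] MonoidAlgebra K G |
      ∃ a ∈ Λ, ∃ b ∈ Λ, t = a ⊗ₜ[K] b}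
  counit_mem : ∀ x ∈ Λ, Coalgebra.counit (R := K) x ∈ Set.range (algebraMap R K)
  antipode_mem : ∀ x ∈ Λ, HopfAlgebra.antipode K x ∈ Λ

/-- The canonical map `K ⊗[R] Λ → K[G]`, `c ⊗ x ↦ c • x`. -/
def tensorToGroupAlgebra (Λ : Subalgebra R (MonoidAlgebra K G)) :
    K ⊗[R] Λ →ₐ[K] MonoidAlgebra K G :=
  Algebra.TensorProduct.lift (Algebra.ofId K _) Λ.val fun c _ => by
    rw [Algebra.ofId_apply]; exact Algebra.commute_algebraMap_left c _

theorem tensorToGroupAlgebra_tmul (Λ : Subalgebra R (MonoidAlgebra K G)) (c : K) (x : Λ) :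
    tensorToGroupAlgebra Λ (c ⊗ₜ[R] x) = c • (x : MonoidAlgebra K G) := by
  unfold tensorToGroupAlgebra
  rw [Algebra.TensorProduct.lift_tmul, Algebra.ofId_apply, Algebra.smul_def]
  rfl

theorem IsOrder.bijective_tensorToGroupAlgebra [IsDomain R] [IsFractionRing R K]
    {Λ : Subalgebra R (MonoidAlgebra K G)} (hΛ : IsOrder Λ) :
    Function.Bijective (tensorToGroupAlgebra Λ) := by
  constructor
  · rw [injective_iff_map_eq_zero]
    intro x hx
    obtain ⟨⟨y, s⟩, hy⟩ := IsLocalizedModule.surj R⁰ (TensorProduct.mk R K Λ 1) x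
    have hs : algebraMap R K s ≠ 0 := IsFractionRing.to_map_ne_zero_of_mem_nonZeroDivisors s.2
    have hy' : algebraMap R K s • x = 1 ⊗ₜ[R] y := by
      rw [algebraMap_smul]; exact hy
    have h0 : tensorToGroupAlgebra Λ (algebraMap R K s • x) = 0 := by
      rw [map_smul, hx, smul_zero]
    rw [hy'] at h0
    have : y = 0 := by
      apply Subtype.ext
      rwa [tensorToGroupAlgebra_tmul, one_smul] at h0
    rw [this, TensorProduct.tmul_zero] at hy'
    rw [← inv_smul_smul₀ hs x, hy', smul_zero]
  · intro x
    have hx : x ∈ Submodule.span K (Λ : Set (MonoidAlgebra K G)) :=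
      hΛ.span_eq_top ▸ Submodule.mem_top
    have hle : Submodule.span K (Λ : Set (MonoidAlgebra K G)) ≤
        LinearMap.range (tensorToGroupAlgebra Λ).toLinearMap := by
      refine Submodule.span_le.2 fun y hy => ⟨1 ⊗ₜ ⟨y, hy⟩, ?_⟩
      exact (tensorToGroupAlgebra_tmul Λ 1 ⟨y, hy⟩).trans (one_smul _ _)
    exact hle hx

/-- The canonical isomorphism `K ⊗[R] Λ ≃ K[G]`. -/
def IsOrder.tensorEquiv [IsDomain R] [IsFractionRing R K]
    {Λ : Subalgebra R (MonoidAlgebra K G)} (hΛ : IsOrder Λ) :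
    K ⊗[R] Λ ≃ₐ[K] MonoidAlgebra K G :=
  AlgEquiv.ofBijective (tensorToGroupAlgebra Λ) hΛ.bijective_tensorToGroupAlgebra

/-- `φ_Λ : G₀ᴿ(Λ) → G₀(K[G])`, `[M] ↦ [K ⊗[R] M]`. -/
def IsOrder.phi [IsDomain R] [IsFractionRing R K]
    {Λ : Subalgebra R (MonoidAlgebra K G)} (hΛ : IsOrder Λ) :
    G0Lat R Λ →+ G0 K (MonoidAlgebra K G) :=
  (G0.res hΛ.tensorEquiv.symm).comp (baseChange.{u, v} R K Λ)

/-- The order `Λ` has the Swan property: `φ_Λ` is an isomorphism. -/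
def IsOrder.HasSwanProperty [IsDomain R] [IsFractionRing R K]
    {Λ : Subalgebra R (MonoidAlgebra K G)} (hΛ : IsOrder Λ) : Prop :=
  Function.Bijective hΛ.phi

section Local

variable [IsLocalRing R]

/-- `Λ̃ = k ⊗[R] Λ`, where `k` is the residue field of `R`. -/
abbrev Reduction (Λ : Subalgebra R (MonoidAlgebra K G)) : Type _ :=
  IsLocalRing.ResidueField R ⊗[R] Λ

/-- `δ_Λ : G₀ᴿ(Λ) → G₀(Λ̃)`, `[M] ↦ [k ⊗[R] M]`. -/
def delta (Λ : Subalgebra R (MonoidAlgebra K G)) :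
    G0Lat R Λ →+ G0 (IsLocalRing.ResidueField R) (Reduction Λ) :=
  baseChange.{u, v} R (IsLocalRing.ResidueField R) Λ

/-- `d : G₀(K[G]) → G₀(Λ̃)` is the decomposition map `d_Λ`, i.e. `d_Λ ∘ φ_Λ = δ_Λ`. -/
def IsOrder.IsDecompositionMap [IsDomain R] [IsFractionRing R K]
    {Λ : Subalgebra R (MonoidAlgebra K G)} (hΛ : IsOrder Λ)
    (d : G0 K (MonoidAlgebra K G) →+ G0 (IsLocalRing.ResidueField R) (Reduction Λ)) : Prop :=
  d.comp hΛ.phi = delta Λ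

end Local

/-- `ψ : G₀ᵗ(Λ) → G₀ᴿ(Λ)` is the map `ψ_Λ` of the localization sequence, i.e. the natural map
`G₀ᵗ(Λ) → G₀(Λ)` followed by the inverse of `G₀ᴿ(Λ) → G₀(Λ)`. -/
def IsLocalizationMap (Λ : Subalgebra R (MonoidAlgebra K G)) (ψ : G0Tors R Λ →+ G0Lat R Λ) : Prop :=
  (latToG0 R Λ).comp ψ = torsToG0 R Λ

/-- `Λ_T = Λ ∩ K[T]` for a subgroup `T` of `G`, as a subalgebra of `K[T]`. -/
def inter (Λ : Subalgebra R (MonoidAlgebra K G)) (T : Subgroup G) :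
    Subalgebra R (MonoidAlgebra K T) :=
  Λ.comap (MonoidAlgebra.mapDomainAlgHom R K T.subtype)

/-- The inclusion `Λ_T → Λ`. -/
def interInclusion (Λ : Subalgebra R (MonoidAlgebra K G)) (T : Subgroup G) : inter Λ T →ₐ[R] Λ :=
  ((MonoidAlgebra.mapDomainAlgHom R K T.subtype).comp (inter Λ T).val).codRestrict Λ fun x => x.2

/-- The map `Λ̃_T → Λ̃` induced by the inclusion `Λ_T → Λ`. -/
def reductionInclusion [IsLocalRing R] (Λ : Subalgebra R (MonoidAlgebra K G)) (T : Subgroup G) :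
    Reduction (inter Λ T) →ₐ[IsLocalRing.ResidueField R] Reduction Λ :=
  Algebra.TensorProduct.map (AlgHom.id _ _) (interInclusion Λ T)

/-- `Λ_C[L]` inside `K[G]`: the finite sums of products `a * g` with `a ∈ Λ_C` and `g ∈ L`. -/
def interGroupRing (Λ : Subalgebra R (MonoidAlgebra K G)) (C L : Subgroup G) :
    Submodule R (MonoidAlgebra K G) :=
  Submodule.span R {x | ∃ a ∈ inter Λ C, ∃ g ∈ L,
    x = MonoidAlgebra.mapDomainAlgHom R K C.subtype a * MonoidAlgebra.of K G g}

end Orders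

/-! ### Groups and fields -/

/-- `G` is the internal direct product of its subgroups `S` and `T`. -/
def IsInternalDirectProduct {G : Type v} [Group G] (S T : Subgroup G) : Prop :=
  Subgroup.IsComplement' S T ∧ ∀ s ∈ S, ∀ t ∈ T, s * t = t * s

/-- A finite group is `l`-elementary if it is the direct product of a cyclic group of order prime
to `l` and an `l`-group. -/
def IsElementary (l : ℕ) (G : Type v) [Group G] : Prop :=
  ∃ Z P : Subgroup G, IsInternalDirectProduct Z P ∧
    IsCyclic Z ∧ (Nat.card Z).Coprime l ∧ IsPGroup l P

/-- The valuation ring of a finite extension `K` of `ℚ_p`: the elements of absolute value at most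
`1`, for the unique extension (`spectralNorm`) to `K` of the `p`-adic absolute value. -/
def padicIntegers (p : ℕ) [Fact p.Prime] (K : Type u) [Field K] [Algebra ℚ_[p] K]
    [FiniteDimensional ℚ_[p] K] : ValuationSubring K where
  carrier := {x | spectralNorm ℚ_[p] K x ≤ 1}
  mul_mem' {a b} ha hb := by
    change spectralMulAlgNorm ℚ_[p] K (a * b) ≤ 1
    rw [map_mul]
    exact mul_le_one₀ ha (spectralNorm_nonneg b) hb
  one_mem' := (spectralNorm_one (K := ℚ_[p]) (L := K)).le
  add_mem' {a b} ha hb :=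
    (isNonarchimedean_spectralNorm (K := ℚ_[p]) (L := K) a b).trans (max_le ha hb)
  zero_mem' := by
    change spectralNorm ℚ_[p] K 0 ≤ 1
    rw [spectralNorm_zero]; exact zero_le_one
  neg_mem' {a} ha := by
    change spectralNorm ℚ_[p] K (-a) ≤ 1
    rw [spectralNorm_neg (Algebra.IsAlgebraic.isAlgebraic a)]; exact ha
  mem_or_inv_mem' x := by
    change spectralMulAlgNorm ℚ_[p] K x ≤ 1 ∨ spectralMulAlgNorm ℚ_[p] K x⁻¹ ≤ 1
    rw [map_inv₀]
    rcases le_total (spectralMulAlgNorm ℚ_[p] K x) 1 with h | h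
    · exact Or.inl h
    · exact Or.inr (inv_le_one_of_one_le₀ h)

/-- `K` is *assez gros* for `G`: it contains the `e`-th roots of unity, `e` the exponent of `G`. -/
def IsLargeEnough (K : Type u) [Field K] (G : Type v) [Group G] : Prop :=
  ∃ ζ : K, IsPrimitiveRoot ζ (Monoid.exponent G)

end HopfOrders

end

universe w

noncomputable section

namespace HopfOrders

/-! ### Additivity, generation and dévissage in Grothendieck groups. -/

section GrothBasics

variable {R : Type u} [CommRing R] {A : Type v} [Ring A] [Algebra R A]

/-! The first assertion comes from integrality. A Hopf order contains the group: the coordinates `u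
i` of a group-like element in an `R`-basis of `Λ` satisfy `u i * u j ∈ ∑ R u l`, so they are
integral (`IsHopfOrder.of_mem`). The image of `Λ` in `K[L]` is therefore an order containing `L`,
and as `|L|` is a unit, a trace computation shows that its elements have coefficients in `R`
(`IsOrder.coeff_mem`). Contracting the second factor of `Δ` with the coefficient at `1` of the image
in `K[L]` gives the projection `K[H] → K[C]`, which consequently preserves `Λ`; applying it to the
`x * g⁻¹` yields `Λ = Λ_C[L]`.

The characters of `C` have values in `K`, restrict to `R`-valued characters of `Λ_C`, and have no
common kernel. Multiplying elements of the various kernels shows that every nonzero module over the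
reduction of `Λ_C` contains an eigenvector for some reduced character (`exists_eigenvector`). The
reduction of `Λ` is the tensor product of those of `Λ_C` and `Λ_L`, by surjectivity and a rank
count, so its `G₀` is generated by modules inflated from the reduction of `Λ_L` along these
characters. This gives surjectivity in the tensor formula. Injectivity follows by cutting with
idempotents that separate the distinct reduced characters; they exist because the common kernel of
those characters is nil.

Each projection given by a character lifts to `Λ → Λ_L`, and inflation commutes with reduction, so
surjectivity of `δ_Λ` need only be proved for `Λ_L`. There the reduction is semisimple by Maschke, a
simple module is a left ideal generated by an idempotent, and idempotents lift because the residue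
class of a representative is a compact semigroup.

The other assertions follow formally from surjectivity of `δ_Λ`. For a lattice `M` the sequence `0 →
M → M → M/πM → 0` makes the class of `M/πM` vanish in `G₀(Λ)`. A torsion module is filtered by
modules killed by `π`, whose classes are now combinations of such `M/πM`, so `G₀ᵗ(Λ) → G₀(Λ)` is
zero (`torsToG0_eq_zero`). As `G₀ᴿ(Λ) → G₀(Λ)` is injective by lattice resolutions, `ψ_Λ` can only
be zero. Vanishing of torsion classes also makes the class of a full lattice in a `K[H]`-module
independent of the lattice. This gives a map `G₀(K[H]) → G₀(Λ)` whose composite with `φ_Λ` is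
injective. Since full lattices exist, `φ_Λ` is bijective, and `d_Λ` is `δ_Λ` composed with its
inverse. -/

theorem Groth.cls_add {P : AlgModule R A → Prop} {M₁ M₂ M₃ : AlgModule R A}
    (h₁ : P M₁) (h₂ : P M₂) (h₃ : P M₃) (f : M₁ →ₗ[A] M₂) (g : M₂ →ₗ[A] M₃)
    (h : IsShortExact f g) :
    (Groth.cls M₂ h₂ : Groth P) = Groth.cls M₁ h₁ + Groth.cls M₃ h₃ := by
  have := Groth.cls_eq h₁ h₂ h₃ f g h
  rw [sub_sub, sub_eq_zero] at this
  exact this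

theorem Groth.cls_of_subsingleton {P : AlgModule R A → Prop} {M : AlgModule R A} (h : P M)
    [Subsingleton M] : (Groth.cls M h : Groth P) = 0 := by
  have := Groth.cls_add h h h (LinearMap.id) (LinearMap.id)
    ⟨Function.injective_id, fun x => ⟨fun _ => ⟨x, rfl⟩, fun _ => Subsingleton.elim _ _⟩,
      Function.surjective_id⟩
  simpa using this

/-- The zero module. -/
def AlgModule.zero (R : Type u) [CommRing R] (A : Type v) [Ring A] [Algebra R A] :
    AlgModule R A where
  carrier := PUnit.{v + 1}

instance : Subsingleton (AlgModule.zero R A) := inferInstanceAs (Subsingleton PUnit)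

/-- An isomorphism is a short exact sequence with third term zero, which is why the zero module must
have the property `P`. -/
theorem Groth.cls_congr {P : AlgModule R A → Prop} (h0 : P (AlgModule.zero R A))
    {M₁ M₂ : AlgModule R A} (h₁ : P M₁) (h₂ : P M₂) (e : M₁ ≃ₗ[A] M₂) :
    (Groth.cls M₁ h₁ : Groth P) = Groth.cls M₂ h₂ := by
  have := Groth.cls_add h₁ h₂ h0 e.toLinearMap (0 : M₂ →ₗ[A] AlgModule.zero R A)
    ⟨e.injective, fun x => ⟨fun _ => e.surjective x, fun _ => rfl⟩,
      fun x => ⟨0, Subsingleton.elim _ _⟩⟩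
  rw [this, Groth.cls_of_subsingleton h0, add_zero]

theorem Groth.induction {P : AlgModule R A → Prop} (S : AddSubgroup (Groth P))
    (h : ∀ M (hM : P M), Groth.cls M hM ∈ S) (x : Groth P) : x ∈ S := by
  obtain ⟨y, rfl⟩ := QuotientAddGroup.mk'_surjective _ x
  induction y using FreeAbelianGroup.induction_on with
  | zero => rw [map_zero]; exact S.zero_mem
  | of M => exact h M.1 M.2
  | neg M hM => rw [map_neg]; exact S.neg_mem hM
  | add x y hx hy => rw [map_add]; exact S.add_mem hx hy

theorem Groth.hom_ext {P : AlgModule R A → Prop} {G : Type*} [AddCommGroup G]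
    {f g : Groth P →+ G} (h : ∀ M (hM : P M), f (Groth.cls M hM) = g (Groth.cls M hM)) : f = g := by
  exact DFunLike.ext _ _ fun x => Groth.induction (AddMonoidHom.eqLocus f g) h x

/-- The homomorphism out of a Grothendieck group given by an additive function. -/
def Groth.lift {P : AlgModule R A → Prop} {G : Type*} [AddCommGroup G]
    (F : ∀ M, P M → G)
    (hF : ∀ (M₁ M₂ M₃ : AlgModule R A) (h₁ : P M₁) (h₂ : P M₂) (h₃ : P M₃) (f : M₁ →ₗ[A] M₂)
      (g : M₂ →ₗ[A] M₃), IsShortExact f g → F M₂ h₂ = F M₁ h₁ + F M₃ h₃) : Groth P →+ G :=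
  QuotientAddGroup.lift (relations P)
    (FreeAbelianGroup.lift fun M : {M // P M} => F M.1 M.2) (by
      refine (AddSubgroup.closure_le _).2 ?_
      rintro x ⟨M₁, M₂, M₃, f, g, h, rfl⟩
      simp only [SetLike.mem_coe, AddMonoidHom.mem_ker, map_sub, FreeAbelianGroup.lift_apply_of]
      rw [hF _ _ _ M₁.2 M₂.2 M₃.2 f g h]
      abel)

theorem Groth.lift_cls {P : AlgModule R A → Prop} {G : Type*} [AddCommGroup G]
    (F : ∀ M, P M → G) (hF) (M : AlgModule R A) (hM : P M) :
    Groth.lift F hF (Groth.cls M hM) = F M hM := by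
  exact FreeAbelianGroup.lift_apply_of (fun M : {M // P M} => F M.1 M.2) ⟨M, hM⟩

namespace AlgModule

/-- A submodule as a module in its own right. -/
def sub (M : AlgModule R A) (N : Submodule A M) : AlgModule R A where
  carrier := N

/-- The quotient by a submodule. -/
def quot (M : AlgModule R A) (N : Submodule A M) : AlgModule R A where
  carrier := M ⧸ N

/-- The restriction of scalars along a ring homomorphism. -/
def restrict {S : Type*} [CommRing S] {B : Type w} [Ring B] [Algebra S B]
    (R : Type u) [CommRing R] {A : Type w} [Ring A] [Algebra R A]
    (f : A →+* B) (M : AlgModule S B) : AlgModule R A :=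
  letI : Module A M := Module.compHom M f
  letI : Module R M := Module.compHom M (f.comp (algebraMap R A))
  { carrier := M
    tower := ⟨fun r a m => by
      change f (r • a) • m = f (algebraMap R A r) • (f a • m)
      rw [Algebra.smul_def, map_mul, mul_smul]⟩ }

section restrict

variable {S : Type*} [CommRing S] {B : Type v} [Ring B] [Algebra S B] (f : A →+* B)

/-- The identity map from a module to its restriction of scalars. -/
def toRestrict (R : Type*) [CommRing R] [Algebra R A] (M : AlgModule S B) : M ≃+ restrict R f M :=
  AddEquiv.refl _

theorem smul_toRestrict (M : AlgModule S B) (a : A) (m : M) :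
    a • toRestrict f R M m = toRestrict f R M (f a • m) := rfl

theorem base_smul_toRestrict (M : AlgModule S B) (r : R) (m : M) :
    r • toRestrict f R M m = toRestrict f R M (f (algebraMap R A r) • m) := rfl

/-- Restriction of scalars on morphisms. -/
def restrictMap {M N : AlgModule S B} (g : M →ₗ[B] N) : restrict R f M →ₗ[A] restrict R f N where
  toFun := g
  map_add' := map_add g
  map_smul' a m := g.map_smul (f a) m

theorem restrict_finite (hf : letI := Module.compHom B f; Module.Finite A B)
    (M : AlgModule S B) (hM : Module.Finite B M) :
    Module.Finite A (restrict R f M) := by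
  let : Module A B := Module.compHom B f
  let : Module A M := Module.compHom M f
  have : IsScalarTower A B M := ⟨fun a b m => mul_smul (f a) b m⟩
  have : Module.Finite A B := hf
  exact Module.Finite.trans (R := A) B M

theorem restrict_finite_of_surjective (hf : Function.Surjective f) (M : AlgModule S B)
    (hM : Module.Finite B M) : Module.Finite A (restrict R f M) := by
  refine restrict_finite f ?_ M hM
  let := Module.compHom B f
  exact Module.Finite.of_surjective
    (⟨⟨f, map_add f⟩, fun a b => map_mul f a b⟩ : A →ₗ[A] B) hf

end restrict

end AlgModule

/-- A subgroup that contains the class of a nonzero submodule of every nonzero module with a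
property that passes to quotients contains the classes of all modules with this property. -/
theorem G0.mem_of_exists_submodule [IsNoetherianRing A] (S : AddSubgroup (G0 R A))
    (Q : AlgModule R A → Prop) (hQ : ∀ (M : AlgModule R A) (N : Submodule A M), Q M → Q (M.quot N))
    (h : ∀ M : AlgModule R A, Module.Finite A M → Q M → Nontrivial M → ∃ (N : Submodule A M),
      N ≠ ⊥ ∧ ∀ hN : Module.Finite A (M.sub N), Groth.cls (M.sub N) hN ∈ S)
    (M : AlgModule R A) (hM : Module.Finite A M) (hQM : Q M) : Groth.cls M hM ∈ S := by
  have hfin : ∀ N : Submodule A M, Module.Finite A (M.sub N) := fun N =>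
    Module.Finite.of_fg (IsNoetherian.noetherian N)
  have h0 : Module.Finite A (AlgModule.zero R A) := inferInstanceAs (Module.Finite A PUnit.{v + 1})
  -- Dévissage: by the Noetherian property some submodule is maximal among those whose class lies in
  -- `S`. If it were proper, the submodule that `h` supplies in the quotient would pull back to a
  -- larger one.
  obtain ⟨N, hN, hmax⟩ := (wellFounded_gt (α := Submodule A M)).has_min
    {N | Groth.cls (M.sub N) (hfin N) ∈ S} ⟨⊥, by
      have : Subsingleton (M.sub ⊥) := inferInstanceAs (Subsingleton (⊥ : Submodule A M))
      rw [Set.mem_ofPred_eq, Groth.cls_of_subsingleton]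
      exact S.zero_mem⟩
  have htop : N = ⊤ := by
    by_contra hne
    have : Nontrivial (M.quot N) := Submodule.Quotient.nontrivial_iff.2 hne
    have hqf : Module.Finite A (M.quot N) := inferInstanceAs (Module.Finite A (M ⧸ N))
    obtain ⟨N', hN', hS⟩ := h (M.quot N) hqf (hQ M N hQM) inferInstance
    have hN'f : Module.Finite A ((M.quot N).sub N') :=
      Module.Finite.of_fg (IsNoetherian.noetherian N')
    let N'' : Submodule A M := Submodule.comap N.mkQ N'
    have hle : N ≤ N'' := fun x hx => by
      change N.mkQ x ∈ N'
      rw [Submodule.mkQ_apply, (Submodule.Quotient.mk_eq_zero N).2 hx]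
      exact N'.zero_mem
    refine hmax N'' ?_ (lt_of_le_of_ne hle ?_)
    · have := Groth.cls_add (P := fun M : AlgModule R A => Module.Finite A M) (hfin N) (hfin N'')
        hN'f (Submodule.inclusion hle) (N.mkQ.restrict (p := N'') (q := N') fun x hx => hx) ?_
      · rw [Set.mem_ofPred_eq, this]
        exact S.add_mem hN (hS hN'f)
      · refine ⟨Submodule.inclusion_injective hle, ?_, ?_⟩
        · rintro ⟨x, hx⟩
          refine ⟨fun h => ⟨⟨x, (Submodule.Quotient.mk_eq_zero N).1 (congrArg Subtype.val h)⟩, rfl⟩,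
            ?_⟩
          rintro ⟨y, hy⟩
          have hy' : y.1 = x := congrArg Subtype.val hy
          exact Subtype.ext ((Submodule.Quotient.mk_eq_zero N).2 (hy' ▸ y.2))
        · rintro ⟨y, hy⟩
          obtain ⟨x, rfl⟩ := N.mkQ_surjective y
          exact ⟨⟨x, hy⟩, rfl⟩
    · intro heq
      refine hN' (eq_bot_iff.2 fun y hy => ?_)
      obtain ⟨x, rfl⟩ := N.mkQ_surjective y
      have : x ∈ N := by rw [heq]; exact hy
      exact (Submodule.Quotient.mk_eq_zero N).2 this
  subst htop
  have := Groth.cls_congr (P := fun M : AlgModule R A => Module.Finite A M) h0 (hfin ⊤) hM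
    (Submodule.topEquiv)
  rw [← this]
  exact hN

end GrothBasics

/-! ### Lattice resolutions and the injectivity of `G₀ᴿ(A) → G₀(A)`. -/

section Resolution

variable {R : Type u} [CommRing R] {A : Type v} [Ring A] [Algebra R A]

/-- The direct sum of two modules. -/
def AlgModule.prod (M N : AlgModule R A) : AlgModule R A where
  carrier := M × N

/-- Lattices: finitely generated modules that are free over the base ring. -/
abbrev IsLat (M : AlgModule R A) : Prop := Module.Finite A M ∧ Module.Free R M

theorem isLat_zero : IsLat (AlgModule.zero R A) :=
  ⟨inferInstanceAs (Module.Finite A PUnit.{v + 1}), inferInstanceAs (Module.Free R PUnit.{v + 1})⟩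

theorem IsLat.cls_congr {M N : AlgModule R A} (hM : IsLat M) (hN : IsLat N) (e : M ≃ₗ[A] N) :
    (Groth.cls M hM : G0Lat R A) = Groth.cls N hN :=
  Groth.cls_congr isLat_zero hM hN e

theorem IsLat.prod {M N : AlgModule R A} (hM : IsLat M) (hN : IsLat N) : IsLat (M.prod N) :=
  have := hM.1
  have := hM.2
  have := hN.1
  have := hN.2
  ⟨inferInstanceAs (Module.Finite A (M × N)), inferInstanceAs (Module.Free R (M × N))⟩

theorem exists_isLat_surjective [Module.Free R A] (M : AlgModule R A) (hM : Module.Finite A M) :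
    ∃ (F : AlgModule R A) (_ : IsLat F) (g : F →ₗ[A] M), Function.Surjective g := by
  obtain ⟨n, f, hf⟩ := Module.Finite.exists_fin' A M
  exact ⟨{ carrier := Fin n → A }, ⟨inferInstanceAs (Module.Finite A (Fin n → A)),
    inferInstanceAs (Module.Free R (Fin n → A))⟩, f, hf⟩

variable [IsDomain R] [IsPrincipalIdealRing R] [Module.Finite R A]

theorem IsLat.of_injective {M N : AlgModule R A} (hM : IsLat M) (f : N →ₗ[A] M)
    (hf : Function.Injective f) : IsLat N := by
  have := hM.1
  have := hM.2
  have : Module.Finite R M := Module.Finite.trans (R := R) A M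
  have : IsNoetherianRing A := IsNoetherianRing.of_finite R A
  exact ⟨Module.Finite.of_injective f hf, .of_equiv
    (LinearEquiv.ofInjective (f.restrictScalars R) hf).symm⟩

theorem IsLat.sub {M : AlgModule R A} (hM : IsLat M) (N : Submodule A M) : IsLat (M.sub N) :=
  hM.of_injective (N := M.sub N) N.subtype Subtype.val_injective

/-- The Euler characteristic `[F] - [ker g]` of a surjection `g : F → Q` from a lattice. -/
def IsLat.euler {F Q : AlgModule R A} (hF : IsLat F) (g : F →ₗ[A] Q) : G0Lat R A :=
  Groth.cls F hF - Groth.cls (F.sub (LinearMap.ker g)) (hF.sub _)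

theorem IsLat.euler_eq_of_exact {F₁ F Q : AlgModule R A} (h₁ : IsLat F₁) (hF : IsLat F)
    (f : F₁ →ₗ[A] F) (g : F →ₗ[A] Q) (hfg : IsShortExact f g) :
    hF.euler g = Groth.cls F hF - Groth.cls F₁ h₁ := by
  rw [IsLat.euler]
  congr 1
  exact IsLat.cls_congr _ _ ((LinearEquiv.ofEq _ _ hfg.2.1.linearMap_ker_eq).trans
    (LinearEquiv.ofInjective f hfg.1).symm)

/-- Schanuel's argument: the fibre product of `F` and `F'` over `Q`, realised as the kernel of `D`,
is an extension of `F` by `ker g'` and also of `F'` by `ker g`. -/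
theorem IsLat.euler_eq {F F' Q : AlgModule R A} (hF : IsLat F) (hF' : IsLat F')
    (g : F →ₗ[A] Q) (g' : F' →ₗ[A] Q) (hg : Function.Surjective g)
    (hg' : Function.Surjective g') : hF.euler g = hF'.euler g' := by
  let D : (F.prod F') →ₗ[A] Q := g ∘ₗ LinearMap.fst A F F' - g' ∘ₗ LinearMap.snd A F F'
  have hD (x : F) (y : F') : D (x, y) = g x - g' y := rfl
  have hP := (hF.prod hF').sub (LinearMap.ker D)
  have e1 := Groth.cls_add (P := IsLat) (hF'.sub (LinearMap.ker g')) hP hF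
    ((LinearMap.inr A F F' ∘ₗ (LinearMap.ker g').subtype).codRestrict (LinearMap.ker D)
      fun y => by
        change D (0, y.1) = 0
        rw [hD, map_zero, show g' y.1 = 0 from y.2, sub_zero])
    (LinearMap.fst A F F' ∘ₗ (LinearMap.ker D).subtype) ⟨?_, ?_, ?_⟩
  · have e2 := Groth.cls_add (P := IsLat) (hF.sub (LinearMap.ker g)) hP hF'
      ((LinearMap.inl A F F' ∘ₗ (LinearMap.ker g).subtype).codRestrict (LinearMap.ker D)
        fun y => by
          change D (y.1, 0) = 0
          rw [hD, map_zero, show g y.1 = 0 from y.2, sub_zero])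
      (LinearMap.snd A F F' ∘ₗ (LinearMap.ker D).subtype) ⟨?_, ?_, ?_⟩
    · rw [IsLat.euler, IsLat.euler, sub_eq_sub_iff_add_eq_add, add_comm, ← e1, e2, add_comm]
    · intro a b hab
      exact Subtype.ext (congrArg (fun z => (Prod.fst (Subtype.val z) : F)) hab)
    · rintro ⟨⟨x, y⟩, hxy⟩
      have hxy' : g x - g' y = 0 := hxy
      constructor
      · intro h
        have h' : y = 0 := h
        subst h'
        rw [map_zero, sub_zero] at hxy'
        exact ⟨⟨x, hxy'⟩, rfl⟩
      · rintro ⟨z, hz⟩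
        exact (congrArg (fun z => (Prod.snd (Subtype.val z) : F')) hz).symm
    · intro y
      obtain ⟨x, hx⟩ := hg (g' y)
      exact ⟨⟨(x, y), by change g x - g' y = 0; rw [hx, sub_self]⟩, rfl⟩
  · intro a b hab
    exact Subtype.ext (congrArg (fun z => (Prod.snd (Subtype.val z) : F')) hab)
  · rintro ⟨⟨x, y⟩, hxy⟩
    have hxy' : g x - g' y = 0 := hxy
    constructor
    · intro h
      have h' : x = 0 := h
      subst h'
      rw [map_zero, zero_sub, neg_eq_zero] at hxy'
      exact ⟨⟨y, hxy'⟩, rfl⟩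
    · rintro ⟨z, hz⟩
      exact (congrArg (fun z => (Prod.fst (Subtype.val z) : F)) hz).symm
  · intro x
    obtain ⟨y, hy⟩ := hg' (g x)
    exact ⟨⟨(x, y), by change g x - g' y = 0; rw [hy, sub_self]⟩, rfl⟩

variable [Module.Free R A]

variable (R A) in
/-- The inverse of the natural map `G₀ᴿ(A) → G₀(A)`, given by lattice resolutions. -/
def resolution : G0 R A →+ G0Lat R A :=
  Groth.lift (fun M hM => (exists_isLat_surjective M hM).choose_spec.choose.euler
    (exists_isLat_surjective M hM).choose_spec.choose_spec.choose) (by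
      intro M₁ M₂ M₃ h₁ h₂ h₃ f g hfg
      obtain ⟨F, hF, q, hq⟩ := exists_isLat_surjective M₂ h₂
      have hgq : Function.Surjective (g ∘ₗ q) := hfg.2.2.comp hq
      -- One cover `F` of the middle term serves all three. `N` covers `M₁` with kernel `ker q`, and
      -- `F` covers `M₃` with kernel `N`, so the Euler characteristics are `[N] - [ker q]`, `[F] -
      -- [ker q]` and `[F] - [N]`.
      let N := LinearMap.ker (g ∘ₗ q)
      let eM : LinearMap.ker g ≃ₗ[A] M₁ := (LinearEquiv.ofEq _ _ hfg.2.1.linearMap_ker_eq).trans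
        (LinearEquiv.ofInjective f hfg.1).symm
      let q₁ : F.sub N →ₗ[A] M₁ := eM.toLinearMap ∘ₗ q.restrict (p := N) (q := LinearMap.ker g)
        fun x hx => hx
      have hq₁ : Function.Surjective q₁ := by
        refine eM.surjective.comp ?_
        rintro ⟨y, hy⟩
        obtain ⟨x, rfl⟩ := hq y
        exact ⟨⟨x, hy⟩, rfl⟩
      rw [IsLat.euler_eq _ hF _ q (exists_isLat_surjective M₂ h₂).choose_spec.choose_spec.choose_spec
        hq, IsLat.euler_eq _ (hF.sub N) _ q₁
        (exists_isLat_surjective M₁ h₁).choose_spec.choose_spec.choose_spec hq₁,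
        IsLat.euler_eq _ hF _ (g ∘ₗ q)
        (exists_isLat_surjective M₃ h₃).choose_spec.choose_spec.choose_spec hgq]
      have hle : LinearMap.ker q ≤ N := fun x hx => by
        change g (q x) = 0
        rw [show q x = 0 from hx, map_zero]
      rw [IsLat.euler_eq_of_exact (hF.sub (LinearMap.ker q)) (hF.sub N) (Submodule.inclusion hle) q₁
        ⟨Submodule.inclusion_injective hle, ?_, hq₁⟩, IsLat.euler, IsLat.euler]
      · abel
      · rintro ⟨x, hx⟩
        have : q₁ ⟨x, hx⟩ = 0 ↔ q x = 0 := by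
          change eM ⟨q x, hx⟩ = 0 ↔ q x = 0
          rw [map_eq_zero_iff _ eM.injective]
          exact ⟨fun h => congrArg Subtype.val h, fun h => Subtype.ext h⟩
        rw [this]
        exact ⟨fun h => ⟨⟨x, h⟩, rfl⟩, fun ⟨y, hy⟩ => by
          have hyx : y.1 = x := congrArg Subtype.val hy
          rw [← hyx]
          exact y.2⟩)

/-- A lattice is resolved by its own identity map, whose kernel is zero. Only this half of the
inverse relation is needed, for injectivity. -/
theorem resolution_latToG0 (x : G0Lat R A) : resolution R A (latToG0 R A x) = x := by
  refine DFunLike.congr_fun (f := (resolution R A).comp (latToG0 R A)) (g := AddMonoidHom.id _)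
    (Groth.hom_ext fun M hM => ?_) x
  rw [AddMonoidHom.comp_apply, latToG0, Groth.map_cls, AddMonoidHom.id_apply, resolution,
    Groth.lift_cls, IsLat.euler_eq _ hM _ (LinearMap.id : M →ₗ[A] M)
    (exists_isLat_surjective M hM.1).choose_spec.choose_spec.choose_spec Function.surjective_id,
    IsLat.euler, sub_eq_self]
  have : Subsingleton (M.sub (LinearMap.ker (LinearMap.id : M →ₗ[A] M))) := by
    rw [LinearMap.ker_id]
    exact inferInstanceAs (Subsingleton (⊥ : Submodule A M))
  exact Groth.cls_of_subsingleton _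

theorem latToG0_injective : Function.Injective (latToG0 R A) :=
  Function.LeftInverse.injective resolution_latToG0

end Resolution

/-! ### Reduction modulo the maximal ideal, and torsion classes. -/

section Reduction

variable {R : Type u} [CommRing R] [IsDomain R] [IsDiscreteValuationRing R]
  {A : Type (max u v)} [Ring A] [Algebra R A]

local notation "k" => IsLocalRing.ResidueField R

/-- The map `A → k ⊗[R] A`, `a ↦ 1 ⊗ a`. -/
def toReduction (R : Type u) [CommRing R] [IsLocalRing R] (A : Type w) [Ring A] [Algebra R A] :
    A →+* IsLocalRing.ResidueField R ⊗[R] A :=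
  (Algebra.TensorProduct.includeRight :
    A →ₐ[R] IsLocalRing.ResidueField R ⊗[R] A).toRingHom

/-- Surjectivity of `R → k` lets every scalar be moved to the right factor. This replaces induction
on tensors in most later computations. -/
theorem exists_one_tmul {M : Type*} [AddCommGroup M] [Module R M] (x : k ⊗[R] M) :
    ∃ m : M, x = 1 ⊗ₜ m := by
  induction x using TensorProduct.induction_on with
  | zero => exact ⟨0, (TensorProduct.tmul_zero _ _).symm⟩
  | tmul c m =>
    obtain ⟨r, rfl⟩ := IsLocalRing.residue_surjective c
    refine ⟨r • m, ?_⟩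
    rw [← TensorProduct.smul_tmul]
    congr 1
    rw [Algebra.smul_def, mul_one]
    rfl
  | add x y hx hy =>
    obtain ⟨m, rfl⟩ := hx
    obtain ⟨n, rfl⟩ := hy
    exact ⟨m + n, (TensorProduct.tmul_add _ _ _).symm⟩

theorem one_tmul_eq_zero_iff {π : R} (hπ : Irreducible π) {M : Type*} [AddCommGroup M] [Module R M]
    (m : M) : (1 : k) ⊗ₜ[R] m = 0 ↔ ∃ n : M, π • n = m := by
  let e : k ⊗[R] M ≃ₗ[R] _ :=
    TensorProduct.quotTensorEquivQuotSMul M (IsLocalRing.maximalIdeal R)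
  have he : e ((1 : k) ⊗ₜ[R] m) = Submodule.Quotient.mk m := by
    have := TensorProduct.quotTensorEquivQuotSMul_mk_tmul (IsLocalRing.maximalIdeal R) (1 : R) m
    rw [one_smul] at this
    exact this
  rw [← e.map_eq_zero_iff, he, Submodule.Quotient.mk_eq_zero, hπ.maximalIdeal_eq,
    Submodule.ideal_span_singleton_smul]
  constructor
  · rintro ⟨n, -, hn⟩
    exact ⟨n, hn⟩
  · rintro ⟨n, hn⟩
    exact ⟨n, trivial, hn⟩

/-- The map `M → k ⊗[R] M`, `m ↦ 1 ⊗ m`, as a map of `A`-modules. -/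
def reductionMap (M : AlgModule R A) :
    M →ₗ[A] AlgModule.restrict R (toReduction R A) (baseChangeModule.{u, v} k M) where
  toFun m := (1 ⊗ₜ[R] m : k ⊗[R] M)
  map_add' m n := TensorProduct.tmul_add (1 : k) m n
  map_smul' a m := by
    have := baseChangeModule_smul k M 1 a 1 m
    rw [one_mul] at this
    exact this.symm

theorem reductionMap_surjective (M : AlgModule R A) :
    Function.Surjective (reductionMap.{u, v} M) := fun x =>
  let ⟨m, hm⟩ := exists_one_tmul (R := R) (M := M) x
  ⟨m, hm.symm⟩

theorem reductionMap_eq_zero_iff {π : R} (hπ : Irreducible π) (M : AlgModule R A) (m : M) :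
    reductionMap.{u, v} M m = 0 ↔ ∃ n : M, π • n = m :=
  one_tmul_eq_zero_iff hπ m

theorem toReduction_surjective : Function.Surjective (toReduction R A) := fun x =>
  let ⟨m, hm⟩ := exists_one_tmul (R := R) (M := A) x
  ⟨m, hm.symm⟩

variable (R A) in
/-- Inflation `G₀(k ⊗[R] A) → G₀(A)`. -/
def inflation : G0 k (k ⊗[R] A) →+ G0 R A :=
  Groth.map (AlgModule.restrict R (toReduction R A))
    (fun M hM => AlgModule.restrict_finite_of_surjective _ toReduction_surjective M hM)
    fun _ _ _ _ _ _ f g h => ⟨AlgModule.restrictMap _ f, AlgModule.restrictMap _ g, h⟩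

/-- Multiplication by a scalar as an `A`-linear map. -/
def AlgModule.lsmul (M : AlgModule R A) (r : R) : M →ₗ[A] M where
  toFun m := r • m
  map_add' := smul_add r
  map_smul' a m := by
    rw [← algebraMap_smul A r, ← algebraMap_smul A r, smul_smul, smul_smul, RingHom.id_apply,
      Algebra.commutes]

/-- Multiplication by a uniformizer on a lattice `M` is injective with cokernel `k ⊗ M`, so the
class of the reduction is `[M] - [M]`. -/
theorem inflation_baseChange (x : G0Lat R A) :
    inflation.{u, v} R A (baseChange.{u, v} R k A x) = 0 := by
  obtain ⟨π, hπ⟩ := IsDiscreteValuationRing.exists_irreducible R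
  refine DFunLike.congr_fun (f := (inflation.{u, v} R A).comp (baseChange.{u, v} R k A)) (g := 0)
    (Groth.hom_ext fun M hM => ?_) x
  rw [AddMonoidHom.comp_apply, baseChange, Groth.map_cls, inflation, Groth.map_cls]
  have := hM.2
  have := Groth.cls_add (P := fun M : AlgModule R A => Module.Finite A M) hM.1 hM.1
    (AlgModule.restrict_finite_of_surjective _ toReduction_surjective _
      (baseChangeModule_finite.{u, v} k M hM.1)) (M.lsmul π) (reductionMap.{u, v} M)
    ⟨smul_right_injective M hπ.ne_zero, fun m => reductionMap_eq_zero_iff hπ M m,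
      reductionMap_surjective M⟩
  exact left_eq_add.1 this

/-- By dévissage only modules killed by the uniformizer matter. These are inflated from `k ⊗ A`,
where `hδ` expresses their classes through reductions of lattices, and such reductions vanish in
`G₀(A)`. -/
theorem torsToG0_eq_zero [Module.Finite R A]
    (hδ : Function.Surjective (baseChange.{u, v} R k A)) : torsToG0 R A = 0 := by
  obtain ⟨π, hπ⟩ := IsDiscreteValuationRing.exists_irreducible R
  have h0 : Module.Finite A (AlgModule.zero R A) :=
    inferInstanceAs (Module.Finite A PUnit.{max u v + 1})
  refine Groth.hom_ext fun M hM => ?_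
  rw [torsToG0, Groth.map_cls]
  have : IsNoetherianRing A := IsNoetherianRing.of_finite R A
  refine G0.mem_of_exists_submodule (⊥ : AddSubgroup (G0 R A))
    (fun M => Module.IsTorsion R M) ?_ ?_ M hM.1 hM.2
  · intro M N hM y
    obtain ⟨x, rfl⟩ := N.mkQ_surjective y
    obtain ⟨a, ha⟩ := hM (x := x)
    refine ⟨a, ?_⟩
    have : N.mkQ (a • x) = 0 := by rw [ha, map_zero]
    exact this
  · intro M _ hM hnt
    refine ⟨LinearMap.ker (M.lsmul π), fun hbot => ?_, fun hN => ?_⟩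
    -- A nonzero scalar is a unit times a power of `π`, so if `π` acted injectively there would be
    -- no nonzero torsion.
    · have hinj : Function.Injective (M.lsmul π) := LinearMap.ker_eq_bot.1 hbot
      obtain ⟨x, hx⟩ := exists_ne (0 : M)
      obtain ⟨⟨a, ha⟩, hax⟩ := hM (x := x)
      have hax : a • x = 0 := hax
      obtain ⟨n, u, rfl⟩ := IsDiscreteValuationRing.eq_unit_mul_pow_irreducible
        (nonZeroDivisors.ne_zero ha) hπ
      rw [mul_smul] at hax
      have hax := (u.isUnit.smul_eq_zero).1 hax
      have hp : ∀ n : ℕ, π ^ n • x ≠ 0 := by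
        intro n
        induction n with
        | zero => rwa [pow_zero, one_smul]
        | succ n ih =>
          intro h
          rw [pow_succ', mul_smul] at h
          exact ih (hinj ((h : M.lsmul π _ = 0).trans (map_zero _).symm))
      exact hp n hax
    · set N := M.sub (LinearMap.ker (M.lsmul π)) with hNdef
      -- As `π` kills `N`, the map from `N` to its own reduction is an isomorphism.
      have hinj : Function.Injective (reductionMap.{u, v} N) := by
        rw [injective_iff_map_eq_zero]
        intro m hm
        obtain ⟨n, rfl⟩ := (reductionMap_eq_zero_iff hπ N m).1 hm
        exact Subtype.ext n.2
      have hX := baseChangeModule_finite.{u, v} k N hN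
      have e := Groth.cls_congr (P := fun M : AlgModule R A => Module.Finite A M) h0 hN
        (AlgModule.restrict_finite_of_surjective _ toReduction_surjective _ hX)
        (LinearEquiv.ofBijective _ ⟨hinj, reductionMap_surjective N⟩)
      obtain ⟨y, hy⟩ := hδ (Groth.cls _ hX)
      have h := inflation_baseChange.{u, v} y
      rw [hy, inflation, Groth.map_cls] at h
      rw [AddSubgroup.mem_bot, e, h]

end Reduction

/-! ### Full submodules and independence of their classes. -/

section FullSubmodules

variable {R : Type u} [CommRing R] {A : Type v} [Ring A] [Algebra R A]

/-- A submodule with torsion quotient. -/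
def IsFull {W : AlgModule R A} (N : Submodule A W) : Prop := ∀ v : W, ∃ r : R, r ≠ 0 ∧ r • v ∈ N

theorem smul_base_mem {W : AlgModule R A} (N : Submodule A W) (r : R) {v : W} (hv : v ∈ N) :
    r • v ∈ N := by
  rw [← algebraMap_smul A r]
  exact N.smul_mem _ hv

theorem finite_sub {W : AlgModule R A} {N : Submodule A W} (hN : N.FG) :
    Module.Finite A (W.sub N) := Module.Finite.of_fg hN

theorem fg_comap_of_injective [IsNoetherianRing A] {W₁ W₂ : AlgModule R A} (f : W₁ →ₗ[A] W₂)
    (hf : Function.Injective f) {N : Submodule A W₂} (hN : N.FG) : (N.comap f).FG := by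
  have : Module.Finite A N := Module.Finite.of_fg hN
  have : Module.Finite A (N.comap f) := Module.Finite.of_injective
    (f.restrict (p := N.comap f) (q := N) fun x hx => hx)
    fun x y hxy => Subtype.ext (hf (congrArg Subtype.val hxy))
  exact Module.Finite.iff_fg.1 this

theorem cls_sub_add [IsNoetherianRing A] {W₁ W₂ W₃ : AlgModule R A} (f : W₁ →ₗ[A] W₂)
    (g : W₂ →ₗ[A] W₃) (h : IsShortExact f g) {N : Submodule A W₂} (hN : N.FG)
    (h₁ : (N.comap f).FG) :
    (Groth.cls (W₂.sub N) (finite_sub hN) : G0 R A) =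
      Groth.cls (W₁.sub (N.comap f)) (finite_sub h₁) +
        Groth.cls (W₃.sub (N.map g)) (finite_sub (hN.map g)) := by
  refine Groth.cls_add (P := fun M : AlgModule R A => Module.Finite A M) _ _ _
    (f.restrict (p := N.comap f) (q := N) fun x hx => hx)
    (g.restrict (p := N) (q := N.map g) fun x hx => Submodule.mem_map_of_mem hx) ⟨?_, ?_, ?_⟩
  · intro x y hxy
    exact Subtype.ext (h.1 (congrArg Subtype.val hxy))
  · rintro ⟨x, hx⟩
    constructor
    · intro hgx
      obtain ⟨y, rfl⟩ := (h.2.1 x).1 (congrArg Subtype.val hgx)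
      exact ⟨⟨y, hx⟩, rfl⟩
    · rintro ⟨y, hy⟩
      have hyx : f y.1 = x := congrArg Subtype.val hy
      exact Subtype.ext ((h.2.1 x).2 ⟨y.1, hyx⟩)
  · rintro ⟨_, x, hx, rfl⟩
    exact ⟨⟨x, hx⟩, rfl⟩

variable [IsDomain R]

/-- The quotient `N' / N` is torsion, so its class vanishes by `ht`. -/
theorem cls_sub_eq_of_le (ht : torsToG0 R A = 0) {W : AlgModule R A} {N N' : Submodule A W}
    (hN : N.FG) (hN' : N'.FG) (hle : N ≤ N') (hf : IsFull N) :
    (Groth.cls (W.sub N) (finite_sub hN) : G0 R A) = Groth.cls (W.sub N') (finite_sub hN') := by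
  let Q : AlgModule R A := (W.sub N').quot (N.comap N'.subtype)
  have hQ : Module.Finite A Q := by
    have : Module.Finite A N' := Module.Finite.of_fg hN'
    exact inferInstanceAs (Module.Finite A (N' ⧸ N.comap N'.subtype))
  have hQt : Module.IsTorsion R Q := by
    intro y
    obtain ⟨x, rfl⟩ := Submodule.mkQ_surjective _ y
    obtain ⟨r, hr, hrx⟩ := hf x.1
    refine ⟨⟨r, mem_nonZeroDivisors_of_ne_zero hr⟩, ?_⟩
    exact (Submodule.Quotient.mk_eq_zero (N.comap N'.subtype)).2 hrx
  have := Groth.cls_add (P := fun M : AlgModule R A => Module.Finite A M) (finite_sub hN)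
    (finite_sub hN') hQ (Submodule.inclusion hle)
    (Submodule.mkQ (M := W.sub N') (N.comap N'.subtype))
    ⟨Submodule.inclusion_injective hle, ?_, Submodule.mkQ_surjective _⟩
  · have h0 : (Groth.cls Q hQ : G0 R A) = 0 := by
      have e := DFunLike.congr_fun ht (Groth.cls Q ⟨hQ, hQt⟩)
      rw [torsToG0, Groth.map_cls] at e
      exact e
    rw [this, h0, add_zero]
  · intro x
    refine (Submodule.Quotient.mk_eq_zero (N.comap N'.subtype)).trans ⟨fun h => ⟨⟨x.1, h⟩, rfl⟩, ?_⟩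
    rintro ⟨y, rfl⟩
    exact y.2

/-- Both submodules are compared with their sum. -/
theorem cls_sub_eq (ht : torsToG0 R A = 0) {W : AlgModule R A} {N N' : Submodule A W}
    (hN : N.FG) (hN' : N'.FG) (hf : IsFull N) (hf' : IsFull N') :
    (Groth.cls (W.sub N) (finite_sub hN) : G0 R A) = Groth.cls (W.sub N') (finite_sub hN') :=
  (cls_sub_eq_of_le ht hN (hN.sup hN') le_sup_left hf).trans
    (cls_sub_eq_of_le ht hN' (hN.sup hN') le_sup_right hf').symm

end FullSubmodules

/-! ### Full `Λ`-lattices in `K[G]`-modules. -/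

section Swan

variable {R : Type u} [CommRing R] [IsDomain R] {K : Type u} [Field K] [Algebra R K]
  [IsFractionRing R K] {G : Type v} [Group G] {Λ : Subalgebra R (MonoidAlgebra K G)}

/-- A `K[G]`-module as a module over the order `Λ`. -/
abbrev toOrder (Λ : Subalgebra R (MonoidAlgebra K G)) (V : AlgModule K (MonoidAlgebra K G)) :
    AlgModule R Λ := AlgModule.restrict R Λ.val.toRingHom V

theorem IsOrder.exists_smul_mem (hΛ : IsOrder Λ) (x : MonoidAlgebra K G) :
    ∃ r : R, r ≠ 0 ∧ r • x ∈ Λ := by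
  have hx : x ∈ Submodule.span K (Λ : Set (MonoidAlgebra K G)) := hΛ.span_eq_top ▸ trivial
  induction hx using Submodule.span_induction with
  | mem x h => exact ⟨1, one_ne_zero, by rwa [one_smul]⟩
  | zero => exact ⟨1, one_ne_zero, by rw [smul_zero]; exact Λ.zero_mem⟩
  | add x y _ _ hx hy =>
    obtain ⟨r, hr, hrx⟩ := hx
    obtain ⟨s, hs, hsy⟩ := hy
    refine ⟨r * s, mul_ne_zero hr hs, ?_⟩
    rw [smul_add]
    refine Λ.add_mem ?_ ?_
    · rw [mul_comm, mul_smul]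
      exact Λ.smul_mem hrx _
    · rw [mul_smul]
      exact Λ.smul_mem hsy _
  | smul c x _ hx =>
    obtain ⟨r, hr, hrx⟩ := hx
    obtain ⟨a, b, hb, rfl⟩ := IsFractionRing.div_surjective (A := R) c
    refine ⟨b * r, mul_ne_zero (nonZeroDivisors.ne_zero hb) hr, ?_⟩
    have hb0 : algebraMap R K b ≠ 0 := IsFractionRing.to_map_ne_zero_of_mem_nonZeroDivisors hb
    have : (b * r) • (algebraMap R K a / algebraMap R K b) • x = a • r • x := by
      rw [← algebraMap_smul K (b * r), ← algebraMap_smul K a, ← algebraMap_smul K r, smul_smul,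
        smul_smul, map_mul]
      congr 1
      field_simp
    rw [this]
    exact Λ.smul_mem hrx a

/-- The `Λ`-span of a finite set of `K[G]`-generators is full, because every element of `K[G]` has a
nonzero `R`-multiple in `Λ`. -/
theorem IsOrder.exists_isFull (hΛ : IsOrder Λ) (V : AlgModule K (MonoidAlgebra K G))
    (hV : Module.Finite (MonoidAlgebra K G) V) :
    ∃ N : Submodule Λ (toOrder Λ V), N.FG ∧ IsFull N := by
  classical
  obtain ⟨s, hs⟩ := hV
  let ι : V ≃+ toOrder Λ V := AlgModule.toRestrict _ R V
  refine ⟨Submodule.span Λ (s.image ι : Set (toOrder Λ V)), ⟨_, rfl⟩, ι.surjective.forall.2 fun v => ?_⟩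
  set N := Submodule.span Λ (s.image ι : Set (toOrder Λ V))
  have hv : v ∈ Submodule.span (MonoidAlgebra K G) (s : Set V) := hs ▸ Submodule.mem_top
  induction hv using Submodule.span_induction with
  | mem x h =>
    refine ⟨1, one_ne_zero, ?_⟩
    rw [one_smul]
    exact Submodule.subset_span (Finset.mem_coe.2 (Finset.mem_image_of_mem ι h))
  | zero =>
    refine ⟨1, one_ne_zero, ?_⟩
    rw [map_zero, smul_zero]
    exact N.zero_mem
  | add x y _ _ hx hy =>
    obtain ⟨r, hr, hrx⟩ := hx
    obtain ⟨t, ht, hty⟩ := hy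
    refine ⟨r * t, mul_ne_zero hr ht, ?_⟩
    rw [map_add, smul_add]
    refine N.add_mem ?_ ?_
    · rw [mul_comm, mul_smul]
      exact smul_base_mem N t hrx
    · rw [mul_smul]
      exact smul_base_mem N r hty
  | smul a x _ hx =>
    obtain ⟨r, hr, hrx⟩ := hx
    obtain ⟨t, ht, hta⟩ := hΛ.exists_smul_mem a
    refine ⟨t * r, mul_ne_zero ht hr, ?_⟩
    have h := N.smul_mem ⟨t • a, hta⟩ hrx
    have e : (⟨t • a, hta⟩ : Λ) • (r • ι x) = (t * r) • ι (a • x) := by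
      refine congrArg ι (?_ : (t • a) • (algebraMap R (MonoidAlgebra K G) r) • x =
        algebraMap R (MonoidAlgebra K G) (t * r) • a • x)
      rw [smul_smul, smul_smul, map_mul, Algebra.smul_def, mul_assoc, mul_assoc,
        Algebra.commutes r a]
    rw [← e]
    exact h

variable [IsNoetherianRing Λ]

/-- The map `G₀(K[G]) → G₀(Λ)`, `[V] ↦ [N]`, where `N` is any full `Λ`-lattice in `V`. -/
def IsOrder.fullLattice (hΛ : IsOrder Λ) (ht : torsToG0 R Λ = 0) :
    G0 K (MonoidAlgebra K G) →+ G0 R Λ :=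
  Groth.lift (fun V hV => Groth.cls ((toOrder Λ V).sub (hΛ.exists_isFull V hV).choose)
      (finite_sub (hΛ.exists_isFull V hV).choose_spec.1)) (by
    intro V₁ V₂ V₃ h₁ h₂ h₃ f g hfg
    obtain ⟨hfg₂, hfull⟩ := (hΛ.exists_isFull V₂ h₂).choose_spec
    set N := (hΛ.exists_isFull V₂ h₂).choose
    -- The preimage of `N` in `V₁` and its image in `V₃` are again full and form an exact sequence
    -- with `N`. They need not be the chosen lattices, but `cls_sub_eq` gives them the same classes.
    have hfg₁ := fg_comap_of_injective (AlgModule.restrictMap (R := R) Λ.val.toRingHom f) hfg.1 hfg₂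
    rw [cls_sub_add (AlgModule.restrictMap Λ.val.toRingHom f)
      (AlgModule.restrictMap Λ.val.toRingHom g) hfg hfg₂ hfg₁]
    congr 1
    · refine cls_sub_eq ht hfg₁ (hΛ.exists_isFull V₁ h₁).choose_spec.1 (fun v => ?_)
        (hΛ.exists_isFull V₁ h₁).choose_spec.2
      obtain ⟨r, hr, hrv⟩ := hfull (f v)
      refine ⟨r, hr, ?_⟩
      rw [Submodule.mem_comap]
      have : AlgModule.restrictMap (R := R) Λ.val.toRingHom f (r • v) = r • AlgModule.toRestrict _ R V₂ (f v) :=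
        f.map_smul _ _
      rw [this]
      exact hrv
    · refine cls_sub_eq ht (hfg₂.map _) (hΛ.exists_isFull V₃ h₃).choose_spec.1 (fun v => ?_)
        (hΛ.exists_isFull V₃ h₃).choose_spec.2
      obtain ⟨w, rfl⟩ := hfg.2.2 v
      obtain ⟨r, hr, hrw⟩ := hfull w
      exact ⟨r, hr, r • AlgModule.toRestrict _ R V₂ w, hrw, g.map_smul _ _⟩)

theorem IsOrder.fullLattice_cls (hΛ : IsOrder Λ) (ht : torsToG0 R Λ = 0)
    (V : AlgModule K (MonoidAlgebra K G)) (hV : Module.Finite (MonoidAlgebra K G) V)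
    {N : Submodule Λ (toOrder Λ V)} (hN : N.FG) (hf : IsFull N) :
    hΛ.fullLattice ht (Groth.cls V hV) = Groth.cls ((toOrder Λ V).sub N) (finite_sub hN) := by
  rw [IsOrder.fullLattice, Groth.lift_cls]
  exact cls_sub_eq ht (hΛ.exists_isFull V hV).choose_spec.1 hN (hΛ.exists_isFull V hV).choose_spec.2 hf

end Swan

/-! ### Extension of scalars from `Λ` to `K[G]`, and bijectivity of `φ_Λ`. -/

section Swan

variable {R : Type u} [CommRing R] {K : Type u} [Field K] [Algebra R K]
  {G : Type v} [Group G] {Λ : Subalgebra R (MonoidAlgebra K G)}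

theorem toOrder_smul (V : AlgModule K (MonoidAlgebra K G)) (r : R) (v : V) :
    r • AlgModule.toRestrict Λ.val.toRingHom R V v =
      AlgModule.toRestrict _ R V (algebraMap R K r • v) := by
  rw [AlgModule.base_smul_toRestrict]
  refine congrArg (AlgModule.toRestrict _ R _) ?_
  change algebraMap R (MonoidAlgebra K G) r • v = _
  rw [IsScalarTower.algebraMap_apply R K (MonoidAlgebra K G), algebraMap_smul]

theorem IsOrder.finite (hΛ : IsOrder Λ) : Module.Finite R Λ := Module.Finite.iff_fg.2 hΛ.fg

/-- The map `K ⊗[R] N → V`, `c ⊗ n ↦ c • n`, for a submodule `N` of `V`. -/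
def scaleMap {V : AlgModule K (MonoidAlgebra K G)} (N : Submodule Λ (toOrder Λ V)) :
    K ⊗[R] ((toOrder Λ V).sub N) →+ V :=
  TensorProduct.liftAddHom ((smulAddHom K V).compl₂
    ((AlgModule.toRestrict Λ.val.toRingHom R V).symm.toAddMonoidHom.comp
      (N.subtype.toAddMonoidHom))) (by
    intro r c n
    obtain ⟨v, hv⟩ := (AlgModule.toRestrict Λ.val.toRingHom R V).surjective n.1
    change (r • c) • (AlgModule.toRestrict Λ.val.toRingHom R V).symm n.1 =
      c • (AlgModule.toRestrict Λ.val.toRingHom R V).symm (r • n.1)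
    rw [← hv, toOrder_smul, AddEquiv.symm_apply_apply, AddEquiv.symm_apply_apply, smul_smul,
      Algebra.smul_def, mul_comm])

theorem scaleMap_tmul {V : AlgModule K (MonoidAlgebra K G)} (N : Submodule Λ (toOrder Λ V)) (c : K)
    (n : N) : scaleMap N (c ⊗ₜ[R] (n : (toOrder Λ V).sub N)) =
      c • (AlgModule.toRestrict Λ.val.toRingHom R V).symm n.1 := rfl

variable [IsDomain R] [IsFractionRing R K]

theorem G0.res_cls {S : Type u} [CommRing S] {A B : Type v} [Ring A] [Algebra S A] [Ring B]
    [Algebra S B] (e : A ≃ₐ[S] B) (M : AlgModule S B) (hM : Module.Finite B M)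
    (h : Module.Finite A (AlgModule.restrict S (e : A →+* B) M)) :
    G0.res e (Groth.cls M hM) =
      Groth.cls (AlgModule.restrict S (e : A →+* B) M) h := by
  rw [G0.res, Groth.map_cls]
  exact Groth.cls_congr (P := fun M : AlgModule S A => Module.Finite A M)
    (inferInstanceAs (Module.Finite A PUnit.{v + 1})) _ _
    { toFun := fun x => x, invFun := fun x => x, map_add' := fun _ _ => rfl,
      map_smul' := fun _ _ => rfl, left_inv := fun _ => rfl, right_inv := fun _ => rfl }

/-- The identification of `S ⊗[R] M` with the underlying group of `baseChangeModule S M`. -/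
def toBaseChange {R : Type u} [CommRing R] (S : Type u) [CommRing S] [Algebra R S]
    {A : Type (max u v)} [Ring A] [Algebra R A] (M : AlgModule R A) :
    S ⊗[R] M ≃+ baseChangeModule.{u, v} S M := AddEquiv.refl _

/-- The `K[G]`-module `K ⊗[R] M`. -/
abbrev IsOrder.extend (hΛ : IsOrder Λ) (M : AlgModule R Λ) : AlgModule K (MonoidAlgebra K G) :=
  AlgModule.restrict K (hΛ.tensorEquiv.symm : MonoidAlgebra K G →+* K ⊗[R] Λ)
    (baseChangeModule.{u, v} K M)

theorem IsOrder.extend_finite (hΛ : IsOrder Λ) (M : AlgModule R Λ) (hM : Module.Finite Λ M) :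
    Module.Finite (MonoidAlgebra K G) (hΛ.extend M) :=
  AlgModule.restrict_finite_of_surjective _ hΛ.tensorEquiv.symm.surjective _
    (baseChangeModule_finite.{u, v} K M hM)

theorem IsOrder.phi_cls (hΛ : IsOrder Λ) (M : AlgModule R Λ) (hM : IsLat M) :
    hΛ.phi (Groth.cls M hM) = Groth.cls (hΛ.extend M) (hΛ.extend_finite M hM.1) := by
  rw [IsOrder.phi, AddMonoidHom.comp_apply, baseChange, Groth.map_cls]
  exact G0.res_cls _ _ _ _

theorem IsOrder.tensorEquiv_symm_coe (hΛ : IsOrder Λ) (a : Λ) :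
    hΛ.tensorEquiv.symm (a : MonoidAlgebra K G) = 1 ⊗ₜ a := by
  rw [AlgEquiv.symm_apply_eq]
  exact ((tensorToGroupAlgebra_tmul Λ 1 a).trans (one_smul _ _)).symm

/-- The identification of `K ⊗[R] M` with the underlying group of the `K[G]`-module. -/
def IsOrder.toExtend (hΛ : IsOrder Λ) (M : AlgModule R Λ) : K ⊗[R] M ≃+ hΛ.extend M :=
  (toBaseChange K M).trans (AlgModule.toRestrict _ K _)

theorem IsOrder.smul_toExtend (hΛ : IsOrder Λ) (M : AlgModule R Λ) (a : MonoidAlgebra K G)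
    (z : K ⊗[R] M) : a • hΛ.toExtend M z =
      hΛ.toExtend M (baseChangeAction K M (hΛ.tensorEquiv.symm a) z) := rfl

theorem IsOrder.base_smul_toExtend (hΛ : IsOrder Λ) (M : AlgModule R Λ) (r : R) (z : K ⊗[R] M) :
    r • AlgModule.toRestrict Λ.val.toRingHom R _ (hΛ.toExtend M z) =
      AlgModule.toRestrict _ R _ (hΛ.toExtend M (r • z)) := by
  rw [AlgModule.base_smul_toRestrict]
  refine congrArg (AlgModule.toRestrict _ R _) ((hΛ.smul_toExtend M _ z).trans ?_)
  congr 1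
  change baseChangeAction K M (hΛ.tensorEquiv.symm (algebraMap R (MonoidAlgebra K G) r)) z = r • z
  rw [IsScalarTower.algebraMap_apply R K (MonoidAlgebra K G), AlgEquiv.commutes, AlgHom.commutes,
    Module.algebraMap_end_apply, algebraMap_smul]

/-- The map `M → K ⊗[R] M`, `m ↦ 1 ⊗ m`, as a map of `Λ`-modules. -/
def IsOrder.extendMap (hΛ : IsOrder Λ) (M : AlgModule R Λ) :
    M →ₗ[Λ] toOrder Λ (hΛ.extend M) where
  toFun m := AlgModule.toRestrict _ R _ (hΛ.toExtend M (1 ⊗ₜ[R] m))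
  map_add' m n := by rw [TensorProduct.tmul_add, map_add, map_add]
  map_smul' a m := by
    refine congrArg (AlgModule.toRestrict _ R _) ?_
    refine Eq.trans ?_ (hΛ.smul_toExtend M a (1 ⊗ₜ[R] m)).symm
    rw [hΛ.tensorEquiv_symm_coe, baseChangeAction_tmul, one_mul]

theorem IsOrder.extendMap_injective (hΛ : IsOrder Λ) (M : AlgModule R Λ) [Module.Free R M] :
    Function.Injective (hΛ.extendMap M) := by
  rw [injective_iff_map_eq_zero]
  intro m hm
  obtain ⟨c, hc⟩ := (IsLocalizedModule.eq_zero_iff R⁰ (TensorProduct.mk R K M 1)).1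
    (show TensorProduct.mk R K M 1 m = 0 from hm)
  exact (smul_eq_zero_iff_right (nonZeroDivisors.ne_zero c.2)).1 hc

theorem IsOrder.isFull_range_extendMap (hΛ : IsOrder Λ) (M : AlgModule R Λ) :
    IsFull (LinearMap.range (hΛ.extendMap M)) := by
  refine (AlgModule.toRestrict _ R _).surjective.forall.2
    ((hΛ.toExtend M).surjective.forall.2 fun v => ?_)
  obtain ⟨⟨y, s⟩, hy⟩ := IsLocalizedModule.surj R⁰ (TensorProduct.mk R K M 1) v
  refine ⟨s, nonZeroDivisors.ne_zero s.2, y, ?_⟩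
  rw [hΛ.base_smul_toExtend]
  exact congrArg (AlgModule.toRestrict _ R _) (congrArg (hΛ.toExtend M) hy.symm)

theorem IsOrder.scaleMap_smul (hΛ : IsOrder Λ) {V : AlgModule K (MonoidAlgebra K G)}
    (N : Submodule Λ (toOrder Λ V)) (a : K ⊗[R] Λ) (z : K ⊗[R] ((toOrder Λ V).sub N)) :
    scaleMap N (baseChangeAction K ((toOrder Λ V).sub N) a z) =
      hΛ.tensorEquiv a • scaleMap N z := by
  induction a using TensorProduct.induction_on with
  | zero => rw [map_zero, map_zero, zero_smul, LinearMap.zero_apply, map_zero]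
  | add a b ha hb => rw [map_add, map_add, add_smul, LinearMap.add_apply, map_add, ha, hb]
  | tmul c x =>
    induction z using TensorProduct.induction_on with
    | zero => rw [map_zero, map_zero, smul_zero]
    | add a b ha hb => rw [map_add, map_add, map_add, smul_add, ha, hb]
    | tmul d n =>
      rw [baseChangeAction_tmul]
      refine (scaleMap_tmul N _ _).trans ?_
      refine Eq.trans ?_ (congrArg (hΛ.tensorEquiv (c ⊗ₜ x) • ·) (scaleMap_tmul N d n)).symm
      have e : hΛ.tensorEquiv (c ⊗ₜ[R] x) = c • (x : MonoidAlgebra K G) :=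
        tensorToGroupAlgebra_tmul Λ c x
      rw [e]
      set v := (AlgModule.toRestrict Λ.val.toRingHom R V).symm n.1
      change (c * d) • (x : MonoidAlgebra K G) • v = (c • (x : MonoidAlgebra K G)) • d • v
      rw [smul_assoc, mul_smul, ← algebraMap_smul (MonoidAlgebra K G) d,
        ← algebraMap_smul (MonoidAlgebra K G) d, smul_smul (x : MonoidAlgebra K G), smul_smul,
        Algebra.commutes]

variable [IsPrincipalIdealRing R]

theorem IsOrder.free (hΛ : IsOrder Λ) : Module.Free R Λ := by
  have := hΛ.finite
  have : Module.IsTorsionFree R K := inferInstance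
  have : Module.IsTorsionFree R (MonoidAlgebra K G) := .trans_faithfulSMul R K _
  infer_instance

/-- A lattice `M` embeds as a full lattice in `K ⊗ M`. Hence the map `fullLattice` after `φ_Λ` is
the natural map to `G₀(Λ)`, which is injective. -/
theorem IsOrder.phi_injective (hΛ : IsOrder Λ) (ht : torsToG0 R Λ = 0) :
    Function.Injective hΛ.phi := by
  have := hΛ.finite
  have := hΛ.free
  have : IsNoetherianRing Λ := IsNoetherianRing.of_finite R Λ
  have h : (hΛ.fullLattice ht).comp hΛ.phi = latToG0 R Λ := by
    refine Groth.hom_ext fun M hM => ?_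
    have := hM.1
    have := hM.2
    have hfg : (LinearMap.range (hΛ.extendMap M)).FG := Module.Finite.iff_fg.1 inferInstance
    rw [AddMonoidHom.comp_apply, hΛ.phi_cls M hM, latToG0, Groth.map_cls,
      hΛ.fullLattice_cls ht _ _ hfg (hΛ.isFull_range_extendMap M)]
    exact (Groth.cls_congr (P := fun M : AlgModule R Λ => Module.Finite Λ M) isLat_zero.1 hM.1 _
      (LinearEquiv.ofInjective _ (hΛ.extendMap_injective M))).symm
  refine Function.Injective.of_comp (f := hΛ.fullLattice ht) ?_
  rw [← AddMonoidHom.coe_comp, h]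
  exact latToG0_injective

/-- A full lattice `N` in `V` satisfies `K ⊗ N ≃ V` through `scaleMap`; this half does not depend on
torsion classes. -/
theorem IsOrder.phi_surjective (hΛ : IsOrder Λ) : Function.Surjective hΛ.phi := by
  rw [← AddMonoidHom.range_eq_top, eq_top_iff]
  rintro x -
  refine Groth.induction _ (fun V hV => ?_) x
  obtain ⟨N, hN, hf⟩ := hΛ.exists_isFull V hV
  have := hΛ.finite
  let ι := AlgModule.toRestrict Λ.val.toRingHom R V
  have hL : IsLat ((toOrder Λ V).sub N) := by
    have h1 := finite_sub hN
    have : Module.Finite R ((toOrder Λ V).sub N) := Module.Finite.trans (R := R) Λ _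
    have : Module.IsTorsionFree R ((toOrder Λ V).sub N) := by
      refine .of_smul_eq_zero fun r n h => ?_
      obtain ⟨v, hv⟩ := ι.surjective n.1
      have h' : r • n.1 = 0 := congrArg Subtype.val h
      rw [← hv, toOrder_smul, map_eq_zero_iff _ ι.injective, smul_eq_zero,
        map_eq_zero_iff _ (IsFractionRing.injective R K)] at h'
      refine h'.imp id fun h => Subtype.ext ?_
      rw [← hv, h, map_zero]
      rfl
    exact ⟨h1, inferInstance⟩
  refine ⟨Groth.cls _ hL, ?_⟩
  rw [hΛ.phi_cls _ hL]
  -- Clearing denominators reduces injectivity of `scaleMap` to the tensors `1 ⊗ n`, on which it is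
  -- the inclusion of `N`.
  have hsurj (z : K ⊗[R] ((toOrder Λ V).sub N)) : ∃ (s : R) (n : N), s ≠ 0 ∧
      algebraMap R K s • z = (1 : K) ⊗ₜ[R] (n : (toOrder Λ V).sub N) := by
    obtain ⟨⟨y, s⟩, hy⟩ := IsLocalizedModule.surj R⁰
      (TensorProduct.mk R K ((toOrder Λ V).sub N) 1) z
    refine ⟨s, y, nonZeroDivisors.ne_zero s.2, ?_⟩
    rw [algebraMap_smul]
    exact hy
  have hK (z : K ⊗[R] ((toOrder Λ V).sub N)) (c : K) : scaleMap N (c • z) = c • scaleMap N z := by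
    have h := hΛ.scaleMap_smul N (algebraMap K _ c) z
    rwa [AlgHom.commutes, AlgEquiv.commutes, algebraMap_smul, Module.algebraMap_end_apply] at h
  refine Groth.cls_congr (P := fun M : AlgModule K (MonoidAlgebra K G) =>
    Module.Finite (MonoidAlgebra K G) M) (inferInstanceAs (Module.Finite _ PUnit.{max u v + 1})) _ _
    (LinearEquiv.ofBijective
    { toFun := fun z => scaleMap N ((hΛ.toExtend _).symm z)
      map_add' := fun x y => by rw [map_add, map_add]
      map_smul' := fun a z => by
        obtain ⟨z, rfl⟩ := (hΛ.toExtend _).surjective z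
        rw [hΛ.smul_toExtend, AddEquiv.symm_apply_apply, AddEquiv.symm_apply_apply,
          hΛ.scaleMap_smul, AlgEquiv.apply_symm_apply, RingHom.id_apply] } ⟨?_, ?_⟩)
  · rw [injective_iff_map_eq_zero]
    refine (hΛ.toExtend _).surjective.forall.2 fun z hz => ?_
    have hz : scaleMap N ((hΛ.toExtend _).symm (hΛ.toExtend _ z)) = 0 := hz
    rw [AddEquiv.symm_apply_apply] at hz
    obtain ⟨s, n, hs, hsn⟩ := hsurj z
    have h := hK z (algebraMap R K s)
    rw [hz, smul_zero, hsn] at h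
    have h := (scaleMap_tmul N 1 n).symm.trans h
    rw [one_smul, map_eq_zero_iff _ ι.symm.injective] at h
    have h : n = 0 := Subtype.ext h
    rw [h] at hsn
    have hsn : algebraMap R K s • z = (0 : K ⊗[R] ((toOrder Λ V).sub N)) :=
      hsn.trans (TensorProduct.tmul_zero _ _)
    have hs' : algebraMap R K s ≠ 0 := by
      rwa [Ne, map_eq_zero_iff _ (IsFractionRing.injective R K)]
    rw [← inv_smul_smul₀ hs' z, hsn, smul_zero, map_zero]
  · intro v
    obtain ⟨r, hr, hrv⟩ := hf (ι v)
    let n : (toOrder Λ V).sub N := ⟨r • ι v, hrv⟩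
    have key : scaleMap N ((algebraMap R K r)⁻¹ ⊗ₜ[R] n) = v := by
      refine (scaleMap_tmul N _ _).trans ?_
      change (algebraMap R K r)⁻¹ • ι.symm (r • ι v) = v
      rw [toOrder_smul, AddEquiv.symm_apply_apply, inv_smul_smul₀]
      rwa [Ne, map_eq_zero_iff _ (IsFractionRing.injective R K)]
    refine ⟨hΛ.toExtend _ ((algebraMap R K r)⁻¹ ⊗ₜ[R] n), Eq.trans ?_ key⟩
    exact congrArg (scaleMap N) ((hΛ.toExtend ((toOrder Λ V).sub N)).symm_apply_apply
      ((algebraMap R K r)⁻¹ ⊗ₜ[R] n))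

end Swan

/-! ### Generation of `G₀` by modules inflated along projections. -/

section Eigen

variable {k : Type u} [CommRing k] {B D : Type w} [Ring B] [Algebra k B] [Ring D] [Algebra k D]

/-- If every nonzero `D`-module contains a nonzero element on which `D` acts through one of the
retractions `p j : D → B`, then the classes of the modules inflated along the `p j` generate. -/
theorem G0.mem_of_exists_eigenvector [IsNoetherianRing D] {J : Type*} (iB : B →ₐ[k] D)
    (p : J → D →ₐ[k] B) (hp : ∀ j, Function.Surjective (p j))
    (h : ∀ M : AlgModule k D, Nontrivial M → ∃ j, ∃ m : M, m ≠ 0 ∧ ∀ d : D, d • m = iB (p j d) • m)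
    (S : AddSubgroup (G0 k D))
    (hS : ∀ j (N : AlgModule k B) (hN : Module.Finite B N),
      Groth.cls (AlgModule.restrict k (p j : D →+* B) N)
        (AlgModule.restrict_finite_of_surjective _ (hp j) N hN) ∈ S) (x : G0 k D) : x ∈ S := by
  refine Groth.induction S (fun M hM => ?_) x
  refine G0.mem_of_exists_submodule S (fun _ => True) (fun _ _ _ => trivial) ?_ M hM trivial
  clear hM M x
  intro M hM _ hnt
  obtain ⟨j, m, hm, hmd⟩ := h M hnt
  -- All vectors on which `D` acts through `p j`, not only the given one. They form a `D`-submodule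
  -- because `iB` and `p j` are multiplicative.
  let N : Submodule D M :=
    { carrier := {m | ∀ d : D, d • m = iB (p j d) • m}
      zero_mem' := fun d => by rw [smul_zero, smul_zero]
      add_mem' := fun {x y} hx hy d => by rw [smul_add, smul_add, hx d, hy d]
      smul_mem' := fun c x hx d => by
        rw [smul_smul, hx (d * c), hx c, smul_smul, map_mul, map_mul] }
  have hN (m : N) (d : D) : d • m = iB (p j d) • m := Subtype.ext (m.2 d)
  refine ⟨N, fun hbot => hm ?_, fun hNf => ?_⟩
  · have : m ∈ N := hmd
    rwa [hbot, Submodule.mem_bot] at this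
  -- On `N` the action of `d` equals that of `p j d`, so generators over `D` also generate over `B`.
  have hXf : Module.Finite B (AlgModule.restrict k (iB : B →+* D) (M.sub N)) := by
    classical
    obtain ⟨s, hs⟩ := hNf
    let ι := AlgModule.toRestrict (iB : B →+* D) k (M.sub N)
    refine ⟨s.image ι, eq_top_iff.2 ?_⟩
    rw [← SetLike.coe_subset_coe]
    refine fun x _ => ?_
    obtain ⟨x, rfl⟩ := ι.surjective x
    have hx : x ∈ Submodule.span D (s : Set (M.sub N)) := hs ▸ Submodule.mem_top
    induction hx using Submodule.span_induction with
    | mem x h => exact Submodule.subset_span (Finset.mem_coe.2 (Finset.mem_image_of_mem ι h))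
    | zero => rw [map_zero]; exact Submodule.zero_mem _
    | add x y _ _ hx hy => rw [map_add]; exact Submodule.add_mem _ (hx trivial) (hy trivial)
    | smul d x _ hx =>
      have : ι (d • x) = p j d • ι x := congrArg ι (hN x d)
      rw [this]
      exact Submodule.smul_mem _ (p j d) (hx trivial)
  have e := Groth.cls_congr (P := fun M : AlgModule k D => Module.Finite D M)
    (inferInstanceAs (Module.Finite D PUnit.{w + 1})) hNf
    (AlgModule.restrict_finite_of_surjective _ (hp j) _ hXf)
    { toFun := fun x => x, invFun := fun x => x, map_add' := fun _ _ => rfl,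
      map_smul' := fun d m => hN m d, left_inv := fun _ => rfl, right_inv := fun _ => rfl }
  rw [e]
  exact hS j _ hXf

end Eigen

/-- If the characters `f j` of `A` have no common kernel, then every nonzero module over the
residue field contains a common eigenvector. -/
theorem exists_eigenvector {R : Type*} [CommRing R] {A : Type*} [Ring A] [Algebra R A] {J : Type*}
    [Finite J] (f : J → A →ₐ[R] R) (hf : ∀ a, (∀ j, f j a = 0) → a = 0)
    {M : Type*} [AddCommGroup M] [Module A M] {m : M} (hm : m ≠ 0) :
    ∃ j, ∃ x : A, x • m ≠ 0 ∧ ∀ a, f j a = 0 → a • x • m = 0 := by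
  classical
  have := Fintype.ofFinite J
  by_contra! hcon
  -- Without an eigenvector, `x` can be multiplied by an element of `ker (f j)` for one `j` after
  -- another while `x • m` stays nonzero. The final product lies in every kernel and is therefore
  -- zero.
  have key : ∀ s : Finset J, ∃ x : A, x • m ≠ 0 ∧ ∀ j ∈ s, f j x = 0 := by
    intro s
    induction s using Finset.induction_on with
    | empty => exact ⟨1, by rwa [one_smul], fun j hj => absurd hj (Finset.notMem_empty j)⟩
    | insert i s _ ih =>
      obtain ⟨x, hx, hs⟩ := ih
      obtain ⟨a, ha, hax⟩ := hcon i x hx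
      refine ⟨a * x, by rwa [mul_smul], fun j hj => ?_⟩
      rw [map_mul]
      rcases Finset.mem_insert.1 hj with rfl | hj
      · rw [ha, zero_mul]
      · rw [hs j hj, mul_zero]
  obtain ⟨x, hx, hx'⟩ := key Finset.univ
  rw [hf x fun j => hx' j (Finset.mem_univ j), zero_smul] at hx
  exact hx rfl

/-! ### Inflation commutes with reduction. -/

section Square

variable {R : Type u} [CommRing R] {A B : Type (max u v)} [Ring A] [Algebra R A] [Ring B]
  [Algebra R B]

/-- Restriction of scalars does not change the underlying module over the base ring. -/
def restrictLinearEquiv (f : A →ₐ[R] B) (M : AlgModule R B) :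
    M ≃ₗ[R] AlgModule.restrict R (f : A →+* B) M :=
  { AlgModule.toRestrict (f : A →+* B) R M with
    map_smul' := fun r m => by
      change r • m = f (algebraMap R A r) • m
      rw [AlgHom.commutes, algebraMap_smul] }

theorem isLat_restrict {f : A →ₐ[R] B} (hf : Function.Surjective f) {M : AlgModule R B}
    (hM : IsLat M) : IsLat (AlgModule.restrict R (f : A →+* B) M) :=
  have := hM.2
  ⟨AlgModule.restrict_finite_of_surjective _ hf M hM.1, .of_equiv (restrictLinearEquiv f M)⟩

variable [IsDomain R] [IsDiscreteValuationRing R]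

local notation "k" => IsLocalRing.ResidueField R

/-- The reduction of an algebra homomorphism. -/
abbrev reduceHom (f : A →ₐ[R] B) : k ⊗[R] A →ₐ[k] k ⊗[R] B :=
  Algebra.TensorProduct.map (AlgHom.id _ _) f

theorem reduceHom_surjective {f : A →ₐ[R] B} (hf : Function.Surjective f) :
    Function.Surjective (reduceHom f) := fun x => by
  obtain ⟨b, rfl⟩ := exists_one_tmul (R := R) (M := B) x
  obtain ⟨a, rfl⟩ := hf b
  exact ⟨1 ⊗ₜ a, rfl⟩

/-- Reduction commutes with restriction of scalars. -/
def reductionRestrict (f : A →ₐ[R] B) (M : AlgModule R B) :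
    AlgModule.restrict k (reduceHom f : k ⊗[R] A →+* k ⊗[R] B) (baseChangeModule.{u, v} k M) ≃ₗ[k ⊗[R] A]
      baseChangeModule.{u, v} k (AlgModule.restrict R (f : A →+* B) M) where
  toFun x := LinearEquiv.lTensor k (restrictLinearEquiv f M) x
  invFun x := (LinearEquiv.lTensor k (restrictLinearEquiv f M)).symm x
  left_inv x := LinearEquiv.symm_apply_apply _ x
  right_inv x := LinearEquiv.apply_symm_apply _ x
  map_add' x y := map_add (LinearEquiv.lTensor k (restrictLinearEquiv f M)) x y
  map_smul' a x := by
    obtain ⟨a, rfl⟩ := exists_one_tmul (R := R) (M := A) a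
    obtain ⟨m, rfl⟩ := exists_one_tmul (R := R) (M := M) x
    change LinearEquiv.lTensor k (restrictLinearEquiv f M)
      (baseChangeAction k M ((1 : k) ⊗ₜ f a) (1 ⊗ₜ m)) =
      baseChangeAction k (AlgModule.restrict R (f : A →+* B) M) (1 ⊗ₜ a)
        (LinearEquiv.lTensor k (restrictLinearEquiv f M) (1 ⊗ₜ m))
    rw [baseChangeAction_tmul, LinearEquiv.lTensor_tmul, LinearEquiv.lTensor_tmul]
    rfl

/-- Restricting along the surjection `f` takes `B`-lattices to `A`-lattices and commutes with
reduction. A lattice class that lifts `[N]` over `B` therefore inflates to one that lifts the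
inflation of `[N]`. -/
theorem cls_restrict_mem_range [Module.Finite R B]
    (hB : Function.Surjective (baseChange.{u, v} R k B)) {f : A →ₐ[R] B}
    (hf : Function.Surjective f) (N : AlgModule k (k ⊗[R] B))
    (hN : Module.Finite (k ⊗[R] B) N) :
    (Groth.cls (AlgModule.restrict k (reduceHom f : k ⊗[R] A →+* k ⊗[R] B) N)
      (AlgModule.restrict_finite_of_surjective _ (reduceHom_surjective hf) N hN) :
        G0 k (k ⊗[R] A)) ∈ (baseChange.{u, v} R k A).range := by
  let F : G0 k (k ⊗[R] B) →+ G0 k (k ⊗[R] A) :=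
    Groth.map (AlgModule.restrict k (reduceHom f : k ⊗[R] A →+* k ⊗[R] B))
      (fun M hM => AlgModule.restrict_finite_of_surjective _ (reduceHom_surjective hf) M hM)
      fun _ _ _ _ _ _ f g h => ⟨AlgModule.restrictMap _ f, AlgModule.restrictMap _ g, h⟩
  let F' : G0Lat R B →+ G0Lat R A :=
    Groth.map (AlgModule.restrict R (f : A →+* B)) (fun M hM => isLat_restrict hf hM)
      fun _ _ _ _ _ _ f g h => ⟨AlgModule.restrictMap _ f, AlgModule.restrictMap _ g, h⟩
  have hFF' : F.comp (baseChange.{u, v} R k B) = (baseChange.{u, v} R k A).comp F' := by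
    refine Groth.hom_ext fun M hM => ?_
    rw [AddMonoidHom.comp_apply, AddMonoidHom.comp_apply, baseChange, Groth.map_cls, Groth.map_cls,
      baseChange, Groth.map_cls]
    refine (Groth.map_cls _ _ _ _ _).trans ?_
    exact Groth.cls_congr (P := fun M : AlgModule k (k ⊗[R] A) => Module.Finite (k ⊗[R] A) M)
      (inferInstanceAs (Module.Finite _ PUnit.{max u v + 1})) _ _ (reductionRestrict f M)
  obtain ⟨y, hy⟩ := hB (Groth.cls N hN)
  refine ⟨F' y, ?_⟩
  rw [← AddMonoidHom.comp_apply, ← hFF', AddMonoidHom.comp_apply, hy]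
  exact Groth.map_cls _ _ _ _ _

end Square

/-! ### The external tensor product of modules over a field. -/

section TensorModule

variable {k : Type u} [Field k] {A B D : Type w} [Ring A] [Algebra k A] [Ring B] [Algebra k B]
  [Ring D] [Algebra k D] (Φ : A ⊗[k] B ≃ₐ[k] D)

/-- The action of `A ⊗[k] B` on `M ⊗[k] N`. -/
def tensorAction (M : AlgModule k A) (N : AlgModule k B) :
    A ⊗[k] B →ₐ[k] Module.End k (M ⊗[k] N) :=
  Module.endTensorEndAlgHom.comp
    (Algebra.TensorProduct.map (Algebra.lsmul k k M) (Algebra.lsmul k k N))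

theorem tensorAction_tmul (M : AlgModule k A) (N : AlgModule k B) (a : A) (b : B) (m : M) (n : N) :
    tensorAction M N (a ⊗ₜ b) (m ⊗ₜ n) = (a • m) ⊗ₜ (b • n) := rfl

/-- `M ⊗[k] N` as a module over `D ≃ A ⊗[k] B`. -/
def tensorModule (M : AlgModule k A) (N : AlgModule k B) : AlgModule k D :=
  letI : Module D (M ⊗[k] N) :=
    Module.compHom _ ((tensorAction M N).comp Φ.symm.toAlgHom).toRingHom
  { carrier := M ⊗[k] N
    tower := ⟨fun s x y => by
      change ((tensorAction M N).comp Φ.symm.toAlgHom) (s • x) y =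
        s • ((tensorAction M N).comp Φ.symm.toAlgHom) x y
      rw [map_smul]; rfl⟩ }

/-- The identification of `M ⊗[k] N` with the underlying vector space of `tensorModule`. -/
def toTensorModule (M : AlgModule k A) (N : AlgModule k B) :
    M ⊗[k] N ≃ₗ[k] tensorModule Φ M N := LinearEquiv.refl k _

theorem smul_toTensorModule (M : AlgModule k A) (N : AlgModule k B) (z : A ⊗[k] B)
    (x : M ⊗[k] N) :
    Φ z • toTensorModule Φ M N x = toTensorModule Φ M N (tensorAction M N z x) := by
  change tensorAction M N (Φ.symm (Φ z)) x = tensorAction M N z x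
  rw [AlgEquiv.symm_apply_apply]

/-- `f ⊗ g` as a map of `D`-modules. -/
def tensorModuleMap {M M' : AlgModule k A} {N N' : AlgModule k B} (f : M →ₗ[A] M')
    (g : N →ₗ[B] N') : tensorModule Φ M N →ₗ[D] tensorModule Φ M' N' where
  toFun x := toTensorModule Φ M' N' (TensorProduct.map (f.restrictScalars k) (g.restrictScalars k)
    ((toTensorModule Φ M N).symm x))
  map_add' x y := by rw [map_add, map_add, map_add]
  map_smul' d x := by
    obtain ⟨z, rfl⟩ := Φ.surjective d
    obtain ⟨x, rfl⟩ := (toTensorModule Φ M N).surjective x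
    rw [smul_toTensorModule, LinearEquiv.symm_apply_apply, LinearEquiv.symm_apply_apply,
      RingHom.id_apply, smul_toTensorModule]
    congr 1
    induction z using TensorProduct.induction_on with
    | zero => simp only [map_zero, LinearMap.zero_apply]
    | add z z' hz hz' => simp only [map_add, LinearMap.add_apply, hz, hz']
    | tmul a b =>
      induction x using TensorProduct.induction_on with
      | zero => simp only [map_zero]
      | add x x' hx hx' => simp only [map_add, hx, hx']
      | tmul m n =>
        rw [tensorAction_tmul, TensorProduct.map_tmul, TensorProduct.map_tmul, tensorAction_tmul]
        exact congrArg₂ _ (f.map_smul a m) (g.map_smul b n)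

theorem tensorModuleMap_exact_left {M₁ M₂ M₃ : AlgModule k A} (f : M₁ →ₗ[A] M₂) (g : M₂ →ₗ[A] M₃)
    (h : IsShortExact f g) (N : AlgModule k B) :
    IsShortExact (tensorModuleMap Φ f (LinearMap.id : N →ₗ[B] N))
      (tensorModuleMap Φ g (LinearMap.id : N →ₗ[B] N)) :=
  ⟨Module.Flat.rTensor_preserves_injective_linearMap (M := N) (f.restrictScalars k) h.1,
    rTensor_exact N (f := f.restrictScalars k) (g := g.restrictScalars k) h.2.1 h.2.2,
    LinearMap.rTensor_surjective N (g := g.restrictScalars k) h.2.2⟩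

theorem tensorModuleMap_exact_right {N₁ N₂ N₃ : AlgModule k B} (f : N₁ →ₗ[B] N₂) (g : N₂ →ₗ[B] N₃)
    (h : IsShortExact f g) (M : AlgModule k A) :
    IsShortExact (tensorModuleMap Φ (LinearMap.id : M →ₗ[A] M) f)
      (tensorModuleMap Φ (LinearMap.id : M →ₗ[A] M) g) :=
  ⟨Module.Flat.lTensor_preserves_injective_linearMap (M := M) (f.restrictScalars k) h.1,
    lTensor_exact M (f := f.restrictScalars k) (g := g.restrictScalars k) h.2.1 h.2.2,
    LinearMap.lTensor_surjective M (g := g.restrictScalars k) h.2.2⟩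

variable [Module.Finite k A] [Module.Finite k B]

theorem tensorModule_finite (M : AlgModule k A) (N : AlgModule k B) (hM : Module.Finite A M)
    (hN : Module.Finite B N) : Module.Finite D (tensorModule Φ M N) := by
  have : Module.Finite k M := Module.Finite.trans (R := k) A M
  have : Module.Finite k N := Module.Finite.trans (R := k) B N
  have : Module.Finite k (tensorModule Φ M N) := inferInstanceAs (Module.Finite k (M ⊗[k] N))
  exact Module.Finite.of_restrictScalars_finite k D _

/-- The map `G₀(A) ⊗ G₀(B) → G₀(D)`, `[M] ⊗ [N] ↦ [M ⊗[k] N]`. -/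
def tensorG0 : G0 k A ⊗[ℤ] G0 k B →+ G0 k D :=
  TensorProduct.liftAddHom
    (Groth.lift (fun M hM => Groth.lift
        (fun N hN => Groth.cls (tensorModule Φ M N) (tensorModule_finite Φ M N hM hN))
        fun _ _ _ _ _ _ f g h => Groth.cls_add (P := fun M : AlgModule k D => Module.Finite D M)
          _ _ _ _ _ (tensorModuleMap_exact_right Φ f g h M))
      fun M₁ M₂ M₃ h₁ h₂ h₃ f g h => Groth.hom_ext fun N hN => by
        rw [AddMonoidHom.add_apply, Groth.lift_cls, Groth.lift_cls, Groth.lift_cls]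
        exact Groth.cls_add (P := fun M : AlgModule k D => Module.Finite D M)
          _ _ _ _ _ (tensorModuleMap_exact_left Φ f g h N))
    fun r x y => by rw [map_zsmul, map_zsmul, AddMonoidHom.coe_smul, Pi.smul_apply]

theorem tensorG0_cls (M : AlgModule k A) (N : AlgModule k B) (hM : Module.Finite A M)
    (hN : Module.Finite B N) : tensorG0 Φ (Groth.cls M hM ⊗ₜ Groth.cls N hN) =
      Groth.cls (tensorModule Φ M N) (tensorModule_finite Φ M N hM hN) := by
  rw [tensorG0, TensorProduct.liftAddHom_tmul, Groth.lift_cls, Groth.lift_cls]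

end TensorModule

/-! ### One-dimensional modules given by characters. -/

section CharModule

variable {k : Type u} [Field k] {A : Type (max u v)} [Ring A] [Algebra k A]

/-- The one-dimensional module given by a character. -/
def charModule (χ : A →ₐ[k] k) : AlgModule k A :=
  letI : Module A (ULift.{v} k) := Module.compHom _ χ.toRingHom
  { carrier := ULift.{v} k
    tower := ⟨fun r a x => by
      change χ (r • a) • x = r • χ a • x
      rw [map_smul, smul_assoc]⟩ }

theorem charModule_finite (χ : A →ₐ[k] k) : Module.Finite A (charModule.{u, v} χ) :=
  have : Module.Finite k (charModule.{u, v} χ) := inferInstanceAs (Module.Finite k (ULift.{v} k))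
  Module.Finite.of_restrictScalars_finite k A _

/-- The space spanned by an eigenvector. -/
theorem exists_charModule_equiv {χ : A →ₐ[k] k} {M : AlgModule k A} {m : M} (hm : m ≠ 0)
    (h : ∀ a : A, a • m = χ a • m) :
    ∃ N : Submodule A M, N ≠ ⊥ ∧ Nonempty (charModule.{u, v} χ ≃ₗ[A] M.sub N) := by
  let F : charModule.{u, v} χ →ₗ[A] M :=
    { toFun := fun x => (@ULift.down.{v} k x) • m
      map_add' := fun x y => add_smul (@ULift.down.{v} k x) (@ULift.down.{v} k y) m
      map_smul' := fun a x => by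
        change (χ a • @ULift.down.{v} k x) • m = a • (@ULift.down.{v} k x) • m
        rw [← algebraMap_smul A (@ULift.down.{v} k x) m, smul_smul, ← Algebra.commutes, mul_smul, h a,
          algebraMap_smul, smul_assoc, smul_comm] }
  have hF : Function.Injective F := by
    rw [injective_iff_map_eq_zero]
    intro x hx
    have hx : (@ULift.down.{v} k x) • m = 0 := hx
    exact ULift.down_injective ((smul_eq_zero.1 hx).resolve_right hm)
  refine ⟨LinearMap.range F, fun hbot => hm ?_, ⟨LinearEquiv.ofInjective F hF⟩⟩
  have : F (ULift.up 1 : ULift.{v} k) ∈ LinearMap.range F := ⟨_, rfl⟩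
  rw [hbot, Submodule.mem_bot] at this
  exact (one_smul k m).symm.trans this

end CharModule

/-! ### The tensor formula for `G₀` when the first factor has enough characters. -/

section TensorEquiv

variable {k : Type u} [Field k] {A B D : Type (max u v)} [Ring A] [Algebra k A] [Ring B] [Algebra k B]
  [Ring D] [Algebra k D] (Φ : A ⊗[k] B ≃ₐ[k] D) {J : Type*} (χ : J → A →ₐ[k] k)

/-- The projection `D → B` given by a character of `A`. -/
def charProj (χ : A →ₐ[k] k) : D →ₐ[k] B :=
  ((Algebra.TensorProduct.lid k B).toAlgHom.comp
    (Algebra.TensorProduct.map χ (AlgHom.id k B))).comp Φ.symm.toAlgHom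

theorem charProj_apply (χ : A →ₐ[k] k) (a : A) (b : B) :
    charProj Φ χ (Φ (a ⊗ₜ b)) = χ a • b := by
  change (Algebra.TensorProduct.lid k B) (Algebra.TensorProduct.map χ (AlgHom.id k B)
    (Φ.symm (Φ (a ⊗ₜ b)))) = _
  rw [AlgEquiv.symm_apply_apply, Algebra.TensorProduct.map_tmul, Algebra.TensorProduct.lid_tmul,
    AlgHom.id_apply]

theorem charProj_surjective (χ : A →ₐ[k] k) : Function.Surjective (charProj Φ χ) := fun b =>
  ⟨Φ (1 ⊗ₜ b), by rw [charProj_apply, map_one, one_smul]⟩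

/-- The inclusion `B → D`. -/
abbrev inclRight : B →ₐ[k] D := Φ.toAlgHom.comp Algebra.TensorProduct.includeRight

/-- The inclusion `A → D`. -/
abbrev inclLeft : A →ₐ[k] D := Φ.toAlgHom.comp Algebra.TensorProduct.includeLeft

theorem inclLeft_apply (a : A) : inclLeft Φ a = Φ (a ⊗ₜ 1) := rfl

theorem inclRight_apply (b : B) : inclRight Φ b = Φ (1 ⊗ₜ b) := rfl

/-- The inflation of `N` along `charProj` is the tensor product with a one-dimensional module. -/
def charModuleTensor (χ : A →ₐ[k] k) (N : AlgModule k B) :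
    tensorModule Φ (charModule.{u, v} χ) N ≃ₗ[D] AlgModule.restrict k (charProj Φ χ : D →+* B) N :=
  let e : charModule.{u, v} χ ⊗[k] N ≃ₗ[k] N :=
    (TensorProduct.congr (ULift.moduleEquiv : ULift.{v} k ≃ₗ[k] k) (LinearEquiv.refl k N)).trans
      (TensorProduct.lid k N)
  { ((toTensorModule Φ (charModule.{u, v} χ) N).symm.trans e).toAddEquiv.trans
      (AlgModule.toRestrict (charProj Φ χ : D →+* B) k N) with
    map_smul' := fun d x => by
      change e ((toTensorModule Φ (charModule.{u, v} χ) N).symm (d • x)) =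
        charProj Φ χ d • e ((toTensorModule Φ (charModule.{u, v} χ) N).symm x)
      obtain ⟨z, rfl⟩ := Φ.surjective d
      obtain ⟨x, rfl⟩ := (toTensorModule Φ (charModule.{u, v} χ) N).surjective x
      rw [smul_toTensorModule, LinearEquiv.symm_apply_apply, LinearEquiv.symm_apply_apply]
      induction z using TensorProduct.induction_on with
      | zero => simp only [map_zero, LinearMap.zero_apply, zero_smul]
      | add z z' hz hz' => simp only [map_add, LinearMap.add_apply, hz, hz', add_smul]
      | tmul a b =>
        induction x using TensorProduct.induction_on with
        | zero => simp only [map_zero, smul_zero]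
        | add x x' hx hx' => simp only [map_add, smul_add, hx, hx']
        | tmul m n =>
          rw [tensorAction_tmul, charProj_apply]
          change (χ a • @ULift.down.{v} k m) • b • n = (χ a • b) • (@ULift.down.{v} k m) • n
          rw [smul_assoc, smul_assoc, smul_comm b] }

variable {χ}

/-- An eigenvector for the action of `A` works: on it `a ⊗ b` acts as `b` times the scalar `χ j a`,
since the two factors commute in `D`. -/
theorem exists_eigenvector_charProj
    (hA : ∀ (M : AlgModule k A), Nontrivial M → ∃ j, ∃ m : M, m ≠ 0 ∧ ∀ a : A, a • m = χ j a • m)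
    (M : AlgModule k D) (hM : Nontrivial M) :
    ∃ j, ∃ m : M, m ≠ 0 ∧ ∀ d : D, d • m = inclRight Φ (charProj Φ (χ j) d) • m := by
  obtain ⟨j, m, hm, h⟩ := hA (AlgModule.restrict k (inclLeft Φ : A →+* D) M) hM
  obtain ⟨m, rfl⟩ := (AlgModule.toRestrict (inclLeft Φ : A →+* D) k M).surjective m
  have h' (a : A) : inclLeft Φ a • m = χ j a • m := by
    have := h a
    rw [AlgModule.smul_toRestrict, AlgModule.base_smul_toRestrict,
      EmbeddingLike.apply_eq_iff_eq] at this
    refine this.trans ?_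
    change inclLeft Φ (algebraMap k A (χ j a)) • m = _
    rw [AlgHom.commutes, algebraMap_smul]
  refine ⟨j, m, fun h0 => hm (by rw [h0, map_zero]), fun d => ?_⟩
  obtain ⟨z, rfl⟩ := Φ.surjective d
  induction z using TensorProduct.induction_on with
  | zero => simp only [map_zero, zero_smul]
  | add z z' hz hz' => simp only [map_add, add_smul, hz, hz']
  | tmul a b =>
    have e : Φ (a ⊗ₜ b) = inclRight Φ b * inclLeft Φ a := by
      rw [inclLeft_apply, inclRight_apply, ← map_mul, Algebra.TensorProduct.tmul_mul_tmul, one_mul,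
        mul_one]
    rw [charProj_apply, e, mul_smul, h', map_smul, smul_assoc, smul_comm]

/-- By dévissage the characters generate `G₀(A)`, so the first factor of every tensor can be
expanded in their classes. No independence is claimed; the coefficients `y j` are recovered later
with idempotents. -/
theorem exists_eq_sum_charModule [Fintype J] [Module.Finite k A]
    (hA : ∀ (M : AlgModule k A), Nontrivial M → ∃ j, ∃ m : M, m ≠ 0 ∧ ∀ a : A, a • m = χ j a • m)
    (x : G0 k A ⊗[ℤ] G0 k B) :
    ∃ y : J → G0 k B, x = ∑ j, Groth.cls (charModule.{u, v} (χ j)) (charModule_finite.{u, v} _) ⊗ₜ y j := by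
  classical
  have : IsNoetherianRing A := IsNoetherianRing.of_finite k A
  let S : AddSubgroup (G0 k A) := AddSubgroup.closure
    (Set.range fun j => Groth.cls (charModule.{u, v} (χ j)) (charModule_finite.{u, v} _))
  have hS (u : G0 k A) : u ∈ S := by
    refine Groth.induction S (fun M hM => ?_) u
    refine G0.mem_of_exists_submodule S (fun _ => True) (fun _ _ _ => trivial)
      (fun M _ _ hnt => ?_) M hM trivial
    obtain ⟨j, m, hm, h⟩ := hA M hnt
    obtain ⟨N, hN, ⟨e⟩⟩ := exists_charModule_equiv.{u, v} hm h
    refine ⟨N, hN, fun hNf => ?_⟩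
    rw [← Groth.cls_congr (P := fun M : AlgModule k A => Module.Finite A M)
      (inferInstanceAs (Module.Finite A PUnit.{max u v + 1})) (charModule_finite.{u, v} _) hNf e]
    exact AddSubgroup.subset_closure ⟨j, rfl⟩
  induction x using TensorProduct.induction_on with
  | zero => exact ⟨0, by simp⟩
  | add x y hx hy =>
    obtain ⟨a, rfl⟩ := hx
    obtain ⟨b, rfl⟩ := hy
    exact ⟨a + b, by simp only [Pi.add_apply, TensorProduct.tmul_add, Finset.sum_add_distrib]⟩
  | tmul u v =>
    induction hS u using AddSubgroup.closure_induction with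
    | mem u hu =>
      obtain ⟨j, rfl⟩ := hu
      refine ⟨Pi.single j v, ?_⟩
      rw [Finset.sum_eq_single j, Pi.single_eq_same]
      · intro i _ hij
        rw [Pi.single_eq_of_ne hij, TensorProduct.tmul_zero]
      · exact fun h => absurd (Finset.mem_univ j) h
    | zero => exact ⟨0, by simp⟩
    | add x y _ _ hx hy =>
      obtain ⟨a, ha⟩ := hx
      obtain ⟨b, hb⟩ := hy
      exact ⟨a + b, by simp only [Pi.add_apply, TensorProduct.tmul_add, Finset.sum_add_distrib,
        TensorProduct.add_tmul, ha, hb]⟩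
    | neg x _ hx =>
      obtain ⟨a, ha⟩ := hx
      exact ⟨-a, by simp only [Pi.neg_apply, TensorProduct.tmul_neg, Finset.sum_neg_distrib,
        TensorProduct.neg_tmul, ha]⟩

/-- The fixed space of an element of `A`, as a `B`-submodule. -/
def fixedSubmodule (ε : A) (M : AlgModule k D) :
    Submodule B (AlgModule.restrict k (inclRight Φ : B →+* D) M) where
  carrier := {m | inclLeft Φ ε • ((AlgModule.toRestrict (inclRight Φ : B →+* D) k M).symm m) =
    (AlgModule.toRestrict (inclRight Φ : B →+* D) k M).symm m}
  zero_mem' := by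
    change _ = _
    rw [map_zero, smul_zero]
  add_mem' {x y} hx hy := by
    change _ = _ at hx hy ⊢
    rw [map_add, smul_add, hx, hy]
  smul_mem' b x hx := by
    obtain ⟨x, rfl⟩ := (AlgModule.toRestrict (inclRight Φ : B →+* D) k M).surjective x
    change _ = _ at hx ⊢
    rw [AddEquiv.symm_apply_apply] at hx
    rw [AlgModule.smul_toRestrict, AddEquiv.symm_apply_apply]
    change inclLeft Φ ε • inclRight Φ b • x = inclRight Φ b • x
    have e : inclLeft Φ ε * inclRight Φ b = inclRight Φ b * inclLeft Φ ε := by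
      rw [inclLeft_apply, inclRight_apply, ← map_mul, ← map_mul,
        Algebra.TensorProduct.tmul_mul_tmul, Algebra.TensorProduct.tmul_mul_tmul, one_mul,
        mul_one, one_mul, mul_one]
    rw [smul_smul, e, mul_smul, hx]

theorem mem_fixedSubmodule {ε : A} {M : AlgModule k D} (m : M) :
    AlgModule.toRestrict (inclRight Φ : B →+* D) k M m ∈ fixedSubmodule Φ ε M ↔
      inclLeft Φ ε • m = m := Iff.rfl

theorem map_mem_fixedSubmodule {ε : A} {M M' : AlgModule k D} (f : M →ₗ[D] M')
    {m : AlgModule.restrict k (inclRight Φ : B →+* D) M} (hm : m ∈ fixedSubmodule Φ ε M) :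
    AlgModule.restrictMap (inclRight Φ : B →+* D) f m ∈ fixedSubmodule Φ ε M' := by
  obtain ⟨m, rfl⟩ := (AlgModule.toRestrict (inclRight Φ : B →+* D) k M).surjective m
  rw [mem_fixedSubmodule] at hm
  change inclLeft Φ ε • f m = f m
  rw [← map_smul, hm]

theorem inclLeft_smul_restrict (χ : A →ₐ[k] k) (ε : A) (N : AlgModule k B) (n : N) :
    inclLeft Φ ε • AlgModule.toRestrict (charProj Φ χ : D →+* B) k N n =
      AlgModule.toRestrict (charProj Φ χ : D →+* B) k N (χ ε • n) := by
  rw [AlgModule.smul_toRestrict, inclLeft_apply]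
  refine congrArg _ ((congrArg (· • n) (charProj_apply Φ χ ε 1)).trans ?_)
  rw [smul_assoc, one_smul]

variable [Module.Finite k A] [Module.Finite k B]

/-- The generating modules inflated along `charProj` are tensor products with a one-dimensional
`A`-module. -/
theorem tensorG0_surjective
    (hA : ∀ (M : AlgModule k A), Nontrivial M → ∃ j, ∃ m : M, m ≠ 0 ∧ ∀ a : A, a • m = χ j a • m) :
    Function.Surjective (tensorG0 Φ) := by
  have : Module.Finite k D := Module.Finite.equiv Φ.toLinearEquiv
  have : IsNoetherianRing D := IsNoetherianRing.of_finite k D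
  refine G0.mem_of_exists_eigenvector (inclRight Φ) (fun j => charProj Φ (χ j))
    (fun j => charProj_surjective Φ (χ j)) (exists_eigenvector_charProj Φ hA) (tensorG0 Φ).range
    fun j N hN => ⟨Groth.cls (charModule.{u, v} (χ j)) (charModule_finite.{u, v} _) ⊗ₜ Groth.cls N hN, ?_⟩
  rw [tensorG0_cls]
  exact Groth.cls_congr (P := fun M : AlgModule k D => Module.Finite D M)
    (inferInstanceAs (Module.Finite D PUnit.{max u v + 1})) _ _ (charModuleTensor.{u, v} Φ (χ j) N)

theorem fixedSubmodule_finite (ε : A) (M : AlgModule k D) (hM : Module.Finite D M) :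
    Module.Finite B ((AlgModule.restrict k (inclRight Φ : B →+* D) M).sub
      (fixedSubmodule Φ ε M)) := by
  have : Module.Finite k D := Module.Finite.equiv Φ.toLinearEquiv
  have : Module.Finite k M := Module.Finite.trans (R := k) D M
  have : Module.Finite k (AlgModule.restrict k (inclRight Φ : B →+* D) M) :=
    Module.Finite.equiv (restrictLinearEquiv.{u, v} (inclRight Φ) M)
  have : Module.Finite k ((AlgModule.restrict k (inclRight Φ : B →+* D) M).sub
      (fixedSubmodule Φ ε M)) :=
    Module.Finite.of_injective ((fixedSubmodule Φ ε M).subtype.restrictScalars k)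
      Subtype.val_injective
  exact Module.Finite.of_restrictScalars_finite k B _

/-- The map `G₀(D) → G₀(B)` given by the image of an idempotent of `A`. -/
def fixedG0 {ε : A} (hε : IsIdempotentElem ε) : G0 k D →+ G0 k B :=
  Groth.map (fun M => (AlgModule.restrict k (inclRight Φ : B →+* D) M).sub
      (fixedSubmodule Φ ε M)) (fixedSubmodule_finite Φ ε) fun M₁ M₂ M₃ _ _ _ f g h => by
    refine ⟨(AlgModule.restrictMap _ f).restrict (p := fixedSubmodule Φ ε M₁)
      (q := fixedSubmodule Φ ε M₂) fun m hm => map_mem_fixedSubmodule Φ f hm,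
      (AlgModule.restrictMap _ g).restrict (p := fixedSubmodule Φ ε M₂)
      (q := fixedSubmodule Φ ε M₃) fun m hm => map_mem_fixedSubmodule Φ g hm, ?_, ?_, ?_⟩
    · intro x y hxy
      exact Subtype.ext (h.1 (congrArg Subtype.val hxy))
    · rintro ⟨x, hx⟩
      constructor
      · intro hgx
        obtain ⟨y, rfl⟩ := (h.2.1 x).1 (congrArg Subtype.val hgx)
        refine ⟨⟨y, ?_⟩, rfl⟩
        have hx' : inclLeft Φ ε • f y = f y := hx
        rw [← map_smul] at hx'
        exact h.1 hx'
      · rintro ⟨y, hy⟩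
        have hyx : f y.1 = x := congrArg Subtype.val hy
        exact Subtype.ext ((h.2.1 x).2 ⟨y.1, hyx⟩)
    · rintro ⟨x, hx⟩
      obtain ⟨y, rfl⟩ := h.2.2 x
      have hx' : inclLeft Φ ε • g y = g y := hx
      -- An arbitrary preimage `y` is replaced by `ε • y`, which is fixed by `ε` because `ε` is
      -- idempotent.
      refine ⟨⟨AlgModule.toRestrict (inclRight Φ : B →+* D) k M₂ (inclLeft Φ ε • y), ?_⟩, ?_⟩
      · rw [mem_fixedSubmodule, smul_smul, ← map_mul, hε.eq]
      · exact Subtype.ext ((map_smul g _ y).trans hx')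

theorem fixedG0_cls {ε : A} (hε : IsIdempotentElem ε) (M : AlgModule k D)
    (hM : Module.Finite D M) : fixedG0 Φ hε (Groth.cls M hM) =
      Groth.cls ((AlgModule.restrict k (inclRight Φ : B →+* D) M).sub (fixedSubmodule Φ ε M))
        (fixedSubmodule_finite Φ ε M hM) :=
  Groth.map_cls _ _ _ _ _

/-- On the inflation of `N` along `χ` the element `ε` acts as the scalar `χ ε`, so when this scalar
is `1` the fixed space is all of `N`. -/
theorem fixedG0_tensorG0_of_eq_one {ε : A} (hε : IsIdempotentElem ε) {χ : A →ₐ[k] k}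
    (h : χ ε = 1) (y : G0 k B) :
    fixedG0 Φ hε (tensorG0 Φ (Groth.cls (charModule.{u, v} χ) (charModule_finite.{u, v} _) ⊗ₜ y)) =
      y := by
  have h0 : Module.Finite B (AlgModule.zero k B) := inferInstanceAs (Module.Finite B PUnit.{max u v + 1})
  have h0' : Module.Finite D (AlgModule.zero k D) := inferInstanceAs (Module.Finite D PUnit.{max u v + 1})
  refine DFunLike.congr_fun (f := ((fixedG0 Φ hε).comp (tensorG0 Φ)).comp
    (TensorProduct.mk ℤ (G0 k A) (G0 k B)
      (Groth.cls (charModule.{u, v} χ) (charModule_finite.{u, v} _))).toAddMonoidHom)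
    (g := AddMonoidHom.id _) (Groth.hom_ext fun N hN => ?_) y
  change fixedG0 Φ hε (tensorG0 Φ (Groth.cls (charModule.{u, v} χ)
    (charModule_finite.{u, v} _) ⊗ₜ Groth.cls N hN)) = Groth.cls N hN
  rw [tensorG0_cls, Groth.cls_congr (P := fun M : AlgModule k D => Module.Finite D M) h0' _
    (AlgModule.restrict_finite_of_surjective _ (charProj_surjective Φ χ) N hN)
    (charModuleTensor.{u, v} Φ χ N), fixedG0_cls]
  let F : N →ₗ[B] AlgModule.restrict k (inclRight Φ : B →+* D)
      (AlgModule.restrict k (charProj Φ χ : D →+* B) N) :=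
    { toFun := fun n => n
      map_add' := fun _ _ => rfl
      map_smul' := fun b n => by
        change b • n = charProj Φ χ (Φ (1 ⊗ₜ b)) • n
        rw [charProj_apply, map_one, one_smul] }
  refine (Groth.cls_congr (P := fun M : AlgModule k B => Module.Finite B M) h0 hN _
    (LinearEquiv.ofBijective (F.codRestrict (fixedSubmodule Φ ε _) fun n => ?_) ⟨?_, ?_⟩)).symm
  · refine (inclLeft_smul_restrict Φ χ ε N n).trans ?_
    rw [h, one_smul]
    rfl
  · intro x y hxy
    exact congrArg Subtype.val hxy
  · rintro ⟨x, hx⟩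
    exact ⟨x, rfl⟩

theorem fixedG0_tensorG0_of_eq_zero {ε : A} (hε : IsIdempotentElem ε) {χ : A →ₐ[k] k}
    (h : χ ε = 0) (y : G0 k B) :
    fixedG0 Φ hε (tensorG0 Φ (Groth.cls (charModule.{u, v} χ) (charModule_finite.{u, v} _) ⊗ₜ y)) =
      0 := by
  have h0' : Module.Finite D (AlgModule.zero k D) := inferInstanceAs (Module.Finite D PUnit.{max u v + 1})
  refine DFunLike.congr_fun (f := ((fixedG0 Φ hε).comp (tensorG0 Φ)).comp
    (TensorProduct.mk ℤ (G0 k A) (G0 k B)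
      (Groth.cls (charModule.{u, v} χ) (charModule_finite.{u, v} _))).toAddMonoidHom)
    (g := 0) (Groth.hom_ext fun N hN => ?_) y
  change fixedG0 Φ hε (tensorG0 Φ (Groth.cls (charModule.{u, v} χ)
    (charModule_finite.{u, v} _) ⊗ₜ Groth.cls N hN)) = 0
  rw [tensorG0_cls, Groth.cls_congr (P := fun M : AlgModule k D => Module.Finite D M) h0' _
    (AlgModule.restrict_finite_of_surjective _ (charProj_surjective Φ χ) N hN)
    (charModuleTensor.{u, v} Φ χ N), fixedG0_cls]
  have (x : fixedSubmodule Φ ε (AlgModule.restrict k (charProj Φ χ : D →+* B) N)) : x = 0 := by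
    obtain ⟨x, hx⟩ := x
    obtain ⟨n, rfl⟩ : ∃ n : N, AlgModule.toRestrict (inclRight Φ : B →+* D) k _
        (AlgModule.toRestrict (charProj Φ χ : D →+* B) k N n) = x := ⟨x, rfl⟩
    have hx' := (inclLeft_smul_restrict Φ χ ε N n).symm.trans hx
    rw [h, zero_smul, map_zero] at hx'
    exact Subtype.ext hx'.symm
  have : Subsingleton ((AlgModule.restrict k (inclRight Φ : B →+* D)
      (AlgModule.restrict k (charProj Φ χ : D →+* B) N)).sub (fixedSubmodule Φ ε _)) :=
    ⟨fun x y => (this x).trans (this y).symm⟩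
  exact @Groth.cls_of_subsingleton _ _ _ _ _ _ _ _ this

/-- For injectivity, an element is written as `∑ [χ j] ⊗ y j`; the functor of `ε j`-fixed vectors
sends its image in `G₀(D)` to `y j`. -/
theorem tensorG0_bijective [Fintype J] [DecidableEq J]
    (hA : ∀ (M : AlgModule k A), Nontrivial M → ∃ j, ∃ m : M, m ≠ 0 ∧ ∀ a : A, a • m = χ j a • m)
    (ε : J → A) (hε : ∀ j, IsIdempotentElem (ε j)) (h : ∀ i j, χ i (ε j) = if i = j then 1 else 0) :
    Function.Bijective (tensorG0 Φ) := by
  refine ⟨?_, tensorG0_surjective.{u, v} Φ hA⟩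
  rw [injective_iff_map_eq_zero]
  intro x hx
  obtain ⟨y, rfl⟩ := exists_eq_sum_charModule.{u, v} hA x
  have hy (j : J) : y j = 0 := by
    have e := congrArg (fixedG0 Φ (hε j)) hx
    rw [map_zero, map_sum, map_sum, Finset.sum_eq_single j] at e
    · rwa [fixedG0_tensorG0_of_eq_one.{u, v}] at e
      rw [h, if_pos rfl]
    · intro i _ hij
      rw [fixedG0_tensorG0_of_eq_zero.{u, v}]
      rw [h, if_neg hij]
    · exact fun hj => absurd (Finset.mem_univ j) hj
  simp [hy]

end TensorEquiv

/-- The coordinate idempotents of `J → k` lie in the image of `A`, by interpolation between distinct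
characters, and they lift to `A` because the kernel is nil. -/
theorem exists_idempotents {k : Type*} [Field k] {A : Type*} [Ring A] [Algebra k A] {J : Type*}
    [Finite J] [DecidableEq J] (χ : J → A →ₐ[k] k) (hχ : Function.Injective χ)
    (hnil : ∀ x, (∀ j, χ j x = 0) → IsNilpotent x) :
    ∃ ε : J → A, (∀ j, IsIdempotentElem (ε j)) ∧ ∀ i j, χ i (ε j) = if i = j then 1 else 0 := by
  have := Fintype.ofFinite J
  have sep (j : J) (s : Finset J) (hj : j ∉ s) : ∃ y, χ j y = 1 ∧ ∀ i ∈ s, χ i y = 0 := by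
    induction s using Finset.induction_on with
    | empty => exact ⟨1, map_one _, fun i hi => absurd hi (Finset.notMem_empty i)⟩
    | insert i s _ ih =>
      rw [Finset.mem_insert, not_or] at hj
      obtain ⟨y, hy, hys⟩ := ih hj.2
      obtain ⟨z, hz⟩ : ∃ z, χ j z ≠ χ i z := by
        by_contra! hcon
        exact hj.1 (hχ (AlgHom.ext hcon))
      have hz' := sub_ne_zero.2 hz
      -- A Lagrange factor: it is `1` under `χ j` and `0` under `χ i`.
      refine ⟨(χ j z - χ i z)⁻¹ • (z - algebraMap k A (χ i z)) * y, ?_, fun l hl => ?_⟩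
      · rw [map_mul, hy, mul_one, map_smul, map_sub, AlgHom.commutes, Algebra.algebraMap_self_apply,
          smul_eq_mul, inv_mul_cancel₀ hz']
      · rcases Finset.mem_insert.1 hl with rfl | hl
        · rw [map_mul, map_smul, map_sub, AlgHom.commutes, Algebra.algebraMap_self_apply, sub_self,
            smul_zero, zero_mul]
        · rw [map_mul, hys l hl, mul_zero]
  let F : A →+* (J → k) := RingHom.pi fun j => (χ j).toRingHom
  have hF (j : J) : ∃ ε : A, IsIdempotentElem ε ∧ F ε = Pi.single j 1 := by
    refine exists_isIdempotentElem_eq_of_ker_isNilpotent F (fun x hx => hnil x fun j =>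
      congrFun hx j) _ ?_ ?_
    · obtain ⟨y, hy, hys⟩ := sep j (Finset.univ.erase j) (Finset.notMem_erase j _)
      refine ⟨y, funext fun i => ?_⟩
      by_cases hij : i = j
      · rw [hij, Pi.single_eq_same]
        exact hy
      · rw [Pi.single_eq_of_ne hij]
        exact hys i (Finset.mem_erase.2 ⟨hij, Finset.mem_univ i⟩)
    · rw [IsIdempotentElem, ← Pi.single_mul, mul_one]
  choose ε hε hFε using hF
  refine ⟨ε, hε, fun i j => ?_⟩
  have := congrFun (hFε j) i
  rw [Pi.single_apply] at this
  exact this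

/-! ### Integral products with enough characters, and their reductions. -/

/-- An algebra `D` that is the product of commuting subalgebras `A` and `B`, where `A` has enough
characters `f j`, together with the projections `p j : D → B` given by these characters. -/
structure SplitProduct (R : Type*) [CommRing R] (A B D J : Type*) [Ring A] [Algebra R A]
    [Ring B] [Algebra R B] [Ring D] [Algebra R D] where
  iA : A →ₐ[R] D
  iB : B →ₐ[R] D
  char : J → A →ₐ[R] R
  proj : J → D →ₐ[R] B
  commute : ∀ a b, Commute (iA a) (iB b)
  span : ∀ d, d ∈ Submodule.span R {x | ∃ a b, x = iA a * iB b}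
  proj_right : ∀ j b, proj j (iB b) = b
  proj_left : ∀ j a, proj j (iA a) = algebraMap R B (char j a)
  eq_zero : ∀ a, (∀ j, char j a = 0) → a = 0

namespace SplitProduct

variable {R : Type u} [CommRing R] [IsDomain R] [IsDiscreteValuationRing R]

local notation "k" => IsLocalRing.ResidueField R

variable {A B D : Type (max u v)} {J : Type*} [Ring A] [Algebra R A]
  [Ring B] [Algebra R B] [Ring D] [Algebra R D] (P : SplitProduct R A B D J)

/-- The reduction of a character. -/
def redChar (f : A →ₐ[R] R) : k ⊗[R] A →ₐ[k] k :=
  Algebra.TensorProduct.lift (AlgHom.id k k) ((Algebra.ofId R k).comp f) fun _ _ => Commute.all _ _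

theorem redChar_tmul (f : A →ₐ[R] R) (a : A) :
    redChar f (1 ⊗ₜ a) = IsLocalRing.residue R (f a) := by
  rw [redChar, Algebra.TensorProduct.lift_tmul, map_one, one_mul]
  rfl

theorem one_tmul_algebraMap (r : R) :
    (1 : k) ⊗ₜ[R] algebraMap R A r = algebraMap k (k ⊗[R] A) (IsLocalRing.residue R r) := by
  rw [Algebra.TensorProduct.algebraMap_apply, Algebra.algebraMap_eq_smul_one r,
    ← TensorProduct.smul_tmul, Algebra.smul_def, mul_one]
  rfl

theorem exists_eigenvector [Finite J] (P : SplitProduct R A B D J)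
    (M : AlgModule k (k ⊗[R] A)) (hM : Nontrivial M) :
    ∃ j, ∃ m : M, m ≠ 0 ∧ ∀ a, a • m = redChar (P.char j) a • m := by
  obtain ⟨m, hm⟩ := exists_ne (0 : M)
  let : Module A M := Module.compHom M (toReduction R A)
  obtain ⟨j, x, hx, h⟩ := HopfOrders.exists_eigenvector P.char P.eq_zero hm
  refine ⟨j, x • m, hx, fun a => ?_⟩
  obtain ⟨a, rfl⟩ := exists_one_tmul (R := R) (M := A) a
  have := h (a - algebraMap R A (P.char j a)) (by
    rw [map_sub, AlgHom.commutes, Algebra.algebraMap_self_apply, sub_self])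
  rw [sub_smul, sub_eq_zero] at this
  rw [redChar_tmul, ← algebraMap_smul (k ⊗[R] A) (IsLocalRing.residue R (P.char j a)),
    ← one_tmul_algebraMap]
  exact this

/-- An element `a` of `A` is a root of `∏ (X - χ j a)`, because this product vanishes under every
character. If all `χ j a` reduce to zero, the polynomial reduces to a power of `X`. -/
theorem isNilpotent_of_redChar_eq_zero [Finite J] (P : SplitProduct R A B D J)
    (x : k ⊗[R] A) (hx : ∀ j, redChar (P.char j) x = 0) :
    IsNilpotent x := by
  classical
  have := Fintype.ofFinite J
  obtain ⟨a, rfl⟩ := exists_one_tmul (R := R) (M := A) x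
  let q : Polynomial R := ∏ j, (Polynomial.X - Polynomial.C (P.char j a))
  have hq : Polynomial.aeval a q = 0 := by
    refine P.eq_zero _ fun j => ?_
    rw [← Polynomial.aeval_algHom_apply, map_prod]
    refine Finset.prod_eq_zero (Finset.mem_univ j) ?_
    rw [map_sub, Polynomial.aeval_X, Polynomial.aeval_C, Algebra.algebraMap_self_apply, sub_self]
  have hq' : Polynomial.aeval ((1 : k) ⊗ₜ[R] a) q = 0 := by
    have := congrArg (Algebra.TensorProduct.includeRight : A →ₐ[R] k ⊗[R] A) hq
    rw [← Polynomial.aeval_algHom_apply, map_zero] at this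
    exact this
  rw [← Polynomial.aeval_map_algebraMap k, Polynomial.map_prod] at hq'
  have e : ∏ j, Polynomial.map (algebraMap R k) (Polynomial.X - Polynomial.C (P.char j a)) =
      Polynomial.X ^ Fintype.card J := by
    rw [Fintype.card, ← Finset.prod_const]
    refine Finset.prod_congr rfl fun j _ => ?_
    have h := hx j
    rw [redChar_tmul] at h
    have h' : algebraMap R k (P.char j a) = 0 := h
    rw [Polynomial.map_sub, Polynomial.map_X, Polynomial.map_C, h', map_zero, sub_zero]
  rw [e, map_pow, Polynomial.aeval_X] at hq'
  exact ⟨_, hq'⟩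

/-- The map `(k ⊗ A) ⊗ (k ⊗ B) → k ⊗ D`. -/
def redMul : (k ⊗[R] A) ⊗[k] (k ⊗[R] B) →ₐ[k] k ⊗[R] D :=
  Algebra.TensorProduct.lift (reduceHom P.iA) (reduceHom P.iB) fun a b => by
    obtain ⟨a, rfl⟩ := exists_one_tmul (R := R) (M := A) a
    obtain ⟨b, rfl⟩ := exists_one_tmul (R := R) (M := B) b
    change (1 ⊗ₜ P.iA a) * (1 ⊗ₜ P.iB b) = (1 ⊗ₜ P.iB b) * (1 ⊗ₜ P.iA a)
    rw [Algebra.TensorProduct.tmul_mul_tmul, Algebra.TensorProduct.tmul_mul_tmul,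
      (P.commute a b).eq]

theorem redMul_tmul (a : k ⊗[R] A) (b : k ⊗[R] B) :
    P.redMul (a ⊗ₜ b) = reduceHom P.iA a * reduceHom P.iB b :=
  Algebra.TensorProduct.lift_tmul _ _ _ a b

theorem redMul_surjective : Function.Surjective P.redMul := by
  intro x
  obtain ⟨d, rfl⟩ := exists_one_tmul (R := R) (M := D) x
  have := P.span d
  induction this using Submodule.span_induction with
  | mem d h =>
    obtain ⟨a, b, rfl⟩ := h
    refine ⟨(1 ⊗ₜ a) ⊗ₜ (1 ⊗ₜ b), ?_⟩
    rw [redMul_tmul]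
    change (1 ⊗ₜ P.iA a) * (1 ⊗ₜ P.iB b) = _
    rw [Algebra.TensorProduct.tmul_mul_tmul, one_mul]
  | zero => exact ⟨0, by rw [map_zero, TensorProduct.tmul_zero]⟩
  | add x y _ _ hx hy =>
    obtain ⟨a, ha⟩ := hx
    obtain ⟨b, hb⟩ := hy
    exact ⟨a + b, by rw [map_add, ha, hb, TensorProduct.tmul_add]⟩
  | smul r x _ hx =>
    obtain ⟨a, ha⟩ := hx
    exact ⟨r • a, by rw [TensorProduct.tmul_smul, ← ha, ← algebraMap_smul k r a,
      map_smul, algebraMap_smul]⟩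

variable [Module.Finite R A] [Module.Free R A] [Module.Finite R B] [Module.Free R B]
  [Module.Finite R D] [Module.Free R D]
  (hrank : Module.finrank R D = Module.finrank R A * Module.finrank R B)

/-- The isomorphism `(k ⊗ A) ⊗ (k ⊗ B) ≃ k ⊗ D`. -/
def redEquiv : (k ⊗[R] A) ⊗[k] (k ⊗[R] B) ≃ₐ[k] k ⊗[R] D :=
  -- Equality of the ranks turns surjectivity, which comes from `P.span`, into injectivity.
  AlgEquiv.ofBijective P.redMul ⟨(LinearMap.injective_iff_surjective_of_finrank_eq_finrank
    (f := P.redMul.toLinearMap) (by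
      rw [Module.finrank_tensorProduct, Module.finrank_baseChange, Module.finrank_baseChange,
        Module.finrank_baseChange, hrank])).2 P.redMul_surjective, P.redMul_surjective⟩

theorem redEquiv_tmul (a : k ⊗[R] A) (b : k ⊗[R] B) :
    P.redEquiv hrank (a ⊗ₜ b) = reduceHom P.iA a * reduceHom P.iB b := P.redMul_tmul a b

theorem redEquiv_tmul_one (a : k ⊗[R] A) : P.redEquiv hrank (a ⊗ₜ 1) = reduceHom P.iA a := by
  rw [redEquiv_tmul, map_one (reduceHom P.iB), mul_one]

theorem redEquiv_one_tmul (b : k ⊗[R] B) : P.redEquiv hrank (1 ⊗ₜ b) = reduceHom P.iB b := by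
  rw [redEquiv_tmul, map_one (reduceHom P.iA), one_mul]

/-- The projection built from the reduced character is the reduction of an integral projection `D →
B`, along which lattices too can be inflated. -/
theorem charProj_redEquiv (j : J) :
    charProj (P.redEquiv hrank) (redChar (P.char j)) = reduceHom (P.proj j) := by
  refine AlgHom.ext fun d => ?_
  obtain ⟨z, rfl⟩ := (P.redEquiv hrank).surjective d
  induction z using TensorProduct.induction_on with
  | zero => simp only [map_zero]
  | add x y hx hy => simp only [map_add, hx, hy]
  | tmul a b =>
    rw [charProj_apply, redEquiv_tmul]
    obtain ⟨a, rfl⟩ := exists_one_tmul (R := R) (M := A) a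
    obtain ⟨b, rfl⟩ := exists_one_tmul (R := R) (M := B) b
    rw [map_mul, redChar_tmul]
    change _ = (1 ⊗ₜ P.proj j (P.iA a)) * (1 ⊗ₜ P.proj j (P.iB b))
    rw [P.proj_left, P.proj_right, one_tmul_algebraMap, Algebra.smul_def]

/-- Modules inflated from `k ⊗ B` generate `G₀(k ⊗ D)`, and their classes lift by the commuting
square of inflation and reduction. -/
theorem baseChange_surjective [Finite J] (P : SplitProduct R A B D J)
    (hrank : Module.finrank R D = Module.finrank R A * Module.finrank R B)
    (hB : Function.Surjective (baseChange.{u, v} R k B)) :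
    Function.Surjective (baseChange.{u, v} R k D) := by
  have hp (j : J) : Function.Surjective (P.proj j) := fun b => ⟨P.iB b, P.proj_right j b⟩
  have : IsNoetherianRing (k ⊗[R] D) := IsNoetherianRing.of_finite k _
  refine G0.mem_of_exists_eigenvector (inclRight (P.redEquiv hrank))
    (fun j => reduceHom (P.proj j)) (fun j => reduceHom_surjective (hp j)) (fun M hM => ?_)
    (baseChange.{u, v} R k D).range fun j N hN => cls_restrict_mem_range hB (hp j) N hN
  obtain ⟨j, m, hm, h⟩ := exists_eigenvector_charProj (P.redEquiv hrank) P.exists_eigenvector M hM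
  rw [charProj_redEquiv] at h
  exact ⟨j, m, hm, h⟩

theorem tensorG0_redEquiv_bijective [Finite J] : Function.Bijective (tensorG0 (P.redEquiv hrank)) := by
  classical
  -- Different characters may have the same reduction. Indexing by the set of reductions restores
  -- the injectivity required for separating idempotents.
  let χ : Set.range (fun j => redChar (P.char j)) → k ⊗[R] A →ₐ[k] k := Subtype.val
  have := Fintype.ofFinite (Set.range fun j => redChar (P.char j))
  obtain ⟨ε, hε, h⟩ := exists_idempotents χ Subtype.val_injective fun x hx =>
    P.isNilpotent_of_redChar_eq_zero x fun j => hx ⟨_, j, rfl⟩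
  refine tensorG0_bijective.{u, v} (χ := χ) _ (fun M hM => ?_) ε hε h
  obtain ⟨j, m, hm, h⟩ := P.exists_eigenvector M hM
  exact ⟨⟨_, j, rfl⟩, m, hm, h⟩

end SplitProduct

/-! ### Surjectivity of reduction from lifting of idempotents. -/

section IdempotentLifting

variable {R : Type u} [CommRing R] [IsDomain R] [IsDiscreteValuationRing R]

local notation "k" => IsLocalRing.ResidueField R

variable {B : Type (max u v)} [Ring B] [Algebra R B]

/-- The reduction of the left ideal `B * e`. -/
def reduceIdeal (e : B) :
    baseChangeModule.{u, v} k (AlgModule.sub (R := R) { carrier := B } (Ideal.span {e} : Ideal B))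
      →ₗ[k ⊗[R] B] k ⊗[R] B where
  toFun x := LinearMap.lTensor k ((Submodule.subtype (Ideal.span {e} : Ideal B)).restrictScalars R) x
  map_add' x y := map_add (LinearMap.lTensor k _) x y
  map_smul' a x := by
    obtain ⟨a, rfl⟩ := exists_one_tmul (R := R) (M := B) a
    obtain ⟨m, rfl⟩ := exists_one_tmul (R := R) (M := (Ideal.span {e} : Ideal B)) x
    change LinearMap.lTensor k _ ((1 * 1 : k) ⊗ₜ[R] (a • m)) =
      (1 ⊗ₜ a) * LinearMap.lTensor k _ (1 ⊗ₜ m)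
    rw [LinearMap.lTensor_tmul, LinearMap.lTensor_tmul, Algebra.TensorProduct.tmul_mul_tmul]
    rfl

/-- Right multiplication by `e` is an `R`-linear retraction of `B` onto `B * e`, and a split
injection stays injective after tensoring. -/
theorem reduceIdeal_injective {e : B} (he : IsIdempotentElem e) :
    Function.Injective (reduceIdeal.{u, v} (R := R) e) := by
  let r : B →ₗ[R] (Ideal.span {e} : Ideal B) :=
    { toFun := fun x => ⟨x * e, Ideal.mul_mem_left _ x (Ideal.subset_span rfl)⟩
      map_add' := fun x y => Subtype.ext (add_mul x y e)
      map_smul' := fun c x => Subtype.ext (smul_mul_assoc c x e) }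
  have hr : r ∘ₗ (Submodule.subtype (Ideal.span {e} : Ideal B)).restrictScalars R =
      LinearMap.id := by
    refine LinearMap.ext fun x => Subtype.ext ?_
    obtain ⟨x, hx⟩ := x
    obtain ⟨y, rfl⟩ := Ideal.mem_span_singleton'.1 hx
    change y * e * e = y * e
    rw [mul_assoc, he.eq]
  refine Function.LeftInverse.injective (g := LinearMap.lTensor k r) fun x => ?_
  change (LinearMap.lTensor k r ∘ₗ LinearMap.lTensor k _) x = x
  rw [← LinearMap.lTensor_comp, hr, LinearMap.lTensor_id, LinearMap.id_apply]

theorem range_reduceIdeal (e : B) :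
    LinearMap.range (reduceIdeal.{u, v} (R := R) e) = Ideal.span {(1 : k) ⊗ₜ[R] e} := by
  refine le_antisymm ?_ ?_
  · rintro _ ⟨x, rfl⟩
    obtain ⟨m, rfl⟩ := exists_one_tmul (R := R) (M := (Ideal.span {e} : Ideal B)) x
    obtain ⟨m, hm⟩ := m
    obtain ⟨y, rfl⟩ := Ideal.mem_span_singleton'.1 hm
    refine Ideal.mem_span_singleton'.2 ⟨1 ⊗ₜ y, ?_⟩
    rw [Algebra.TensorProduct.tmul_mul_tmul, one_mul]
    rfl
  · refine Ideal.span_le.2 (Set.singleton_subset_iff.2 ⟨(1 ⊗ₜ[R] (⟨e, Ideal.subset_span rfl⟩ :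
      (Ideal.span {e} : Ideal B)) : k ⊗[R] (Ideal.span {e} : Ideal B)), rfl⟩)

/-- If idempotents lift from a semisimple reduction, then the reduction map is surjective. -/
theorem baseChange_surjective_of_isSemisimpleRing [Module.Finite R B] [Module.Free R B]
    [IsSemisimpleRing (k ⊗[R] B)]
    (hlift : ∀ x : B, IsIdempotentElem ((1 : k) ⊗ₜ[R] x) →
      ∃ e : B, IsIdempotentElem e ∧ (1 : k) ⊗ₜ[R] e = 1 ⊗ₜ x) :
    Function.Surjective (baseChange.{u, v} R k B) := by
  have : IsNoetherianRing (k ⊗[R] B) := IsNoetherianRing.of_finite k _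
  refine fun x => Groth.induction (baseChange.{u, v} R k B).range (fun M hM => ?_) x
  refine G0.mem_of_exists_submodule _ (fun _ => True) (fun _ _ _ => trivial)
    (fun M _ _ hnt => ?_) M hM trivial
  obtain ⟨N, hN⟩ := IsSemisimpleModule.exists_simple_submodule (k ⊗[R] B) M
  refine ⟨N, ?_, fun hNf => ?_⟩
  · exact (isSimpleModule_iff_isAtom.1 hN).1
  -- A simple module is a left ideal generated by an idempotent. If `e` lifts this idempotent, the
  -- left ideal `B * e` is a lattice whose reduction is the given module.
  obtain ⟨I, ⟨eI⟩⟩ := IsSemisimpleRing.exists_linearEquiv_ideal_of_isSimpleModule (k ⊗[R] B) N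
  obtain ⟨ebar, he, rfl⟩ := IsSemisimpleRing.ideal_eq_span_idempotent I
  obtain ⟨x, rfl⟩ := exists_one_tmul (R := R) (M := B) ebar
  obtain ⟨e, he', hex⟩ := hlift x he
  have hreg : IsLat (R := R) (A := B) { carrier := B } :=
    ⟨inferInstanceAs (Module.Finite B B), inferInstanceAs (Module.Free R B)⟩
  refine ⟨Groth.cls _ (hreg.sub (Ideal.span {e} : Ideal B)), ?_⟩
  rw [baseChange, Groth.map_cls]
  refine (Groth.cls_congr (P := fun M : AlgModule k (k ⊗[R] B) => Module.Finite (k ⊗[R] B) M)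
    (inferInstanceAs (Module.Finite (k ⊗[R] B) PUnit.{max u v + 1})) hNf _ ?_).symm
  refine eI.trans ((LinearEquiv.ofEq _ _ ?_).trans
    (LinearEquiv.ofInjective _ (reduceIdeal_injective.{u, v} he')).symm)
  rw [range_reduceIdeal, hex]

end IdempotentLifting

/-! ### Idempotents in compact subsemigroups of `K[G]`. -/

section EllisNumakura

/-- Idempotents lift along a compact ideal. -/
theorem exists_isIdempotentElem_of_isCompact {K : Type*} [Field K] [TopologicalSpace K]
    [IsTopologicalRing K] [T2Space K] {G : Type*} [Group G] [Finite G] (S : Set (MonoidAlgebra K G))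
    (hS : S.Nonempty) (hmul : ∀ x ∈ S, ∀ y ∈ S, x * y ∈ S)
    (T : Set (G → K)) (hT : IsCompact T) (hST : ∀ x : MonoidAlgebra K G, x ∈ S ↔ ⇑x.coeff ∈ T) :
    ∃ e ∈ S, e * e = e := by
  let φ : MonoidAlgebra K G ≃ (G → K) :=
    { toFun := fun x => x.coeff
      invFun := fun f => ⟨Finsupp.equivFunOnFinite.symm f⟩
      left_inv := fun x => by
        exact MonoidAlgebra.ext (Finsupp.equivFunOnFinite.symm_apply_apply x.coeff)
      right_inv := fun f => rfl }
  let : TopologicalSpace (MonoidAlgebra K G) := TopologicalSpace.induced φ inferInstance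
  let Φ : MonoidAlgebra K G ≃ₜ (G → K) := φ.toHomeomorphOfIsInducing ⟨rfl⟩
  have : T2Space (MonoidAlgebra K G) := Φ.symm.t2Space
  -- The Ellis–Numakura lemma, for the topology carried over from `G → K`. It requires continuity of
  -- multiplication in the left variable only, which is checked coefficientwise.
  refine exists_idempotent_in_compact_subsemigroup (fun r => ?_) S hS ?_ fun x hx y hy =>
    hmul x hx y hy
  · refine Φ.isInducing.continuous_iff.2 (continuous_pi fun g => ?_)
    change Continuous fun x : MonoidAlgebra K G => (x * r).coeff g
    simp only [MonoidAlgebra.coeff_mul_apply_right]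
    refine continuous_finsetSum _ fun h _ => Continuous.mul ?_ continuous_const
    exact (continuous_apply (g * h⁻¹)).comp Φ.continuous
  · have : S = Φ ⁻¹' T := Set.ext hST
    rw [this, Φ.isCompact_preimage]
    exact hT

end EllisNumakura

/-! ### Integrality in Hopf orders. -/

section HopfOrder

variable {R : Type u} [CommRing R] [IsDomain R] [IsPrincipalIdealRing R] {K : Type u} [Field K]
  [Algebra R K] [IsFractionRing R K] {G : Type v} [Group G] {Λ : Subalgebra R (MonoidAlgebra K G)}

/-- An `R`-basis of `Λ` is a `K`-basis of `K[G]`, because `K ⊗ Λ ≃ K[G]`. Membership in `Λ` thereby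
becomes integrality of coordinates. -/
theorem IsOrder.exists_basis (hΛ : IsOrder Λ) : ∃ (n : ℕ) (b : Module.Basis (Fin n) R Λ)
    (c : Module.Basis (Fin n) K (MonoidAlgebra K G)), ∀ y : Λ, ∀ i,
      c.repr y i = algebraMap R K (b.repr y i) := by
  have := hΛ.finite
  have := hΛ.free
  let b := Module.finBasis R Λ
  refine ⟨_, b, (Algebra.TensorProduct.basis K b).map hΛ.tensorEquiv.toLinearEquiv, fun y i => ?_⟩
  rw [Module.Basis.map_repr]
  change (Algebra.TensorProduct.basis K b).repr (hΛ.tensorEquiv.symm y) i = _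
  rw [hΛ.tensorEquiv_symm_coe, Algebra.TensorProduct.basis_repr_tmul, one_smul]
  rfl

theorem mem_range_of_isIntegral {x : K} (h : IsIntegral R x) : x ∈ Set.range (algebraMap R K) :=
  IsIntegrallyClosed.isIntegral_iff.1 h

/-- A Hopf order contains the group. -/
theorem IsHopfOrder.of_mem (hΛ : IsHopfOrder Λ) (g : G) : MonoidAlgebra.of K G g ∈ Λ := by
  obtain ⟨n, b, c, hbc⟩ := hΛ.toIsOrder.exists_basis
  have hc0 (i : Fin n) : c i = (b i : MonoidAlgebra K G) := by
    refine c.repr.injective (Finsupp.ext fun j => ?_)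
    rw [hbc, c.repr_self, b.repr_self, Finsupp.single_apply, Finsupp.single_apply]
    split_ifs
    · rw [map_one]
    · rw [map_zero]
  set u := c.repr (MonoidAlgebra.of K G g) with hu
  have hg : MonoidAlgebra.of K G g = ∑ i, u i • (b i : MonoidAlgebra K G) := by
    conv_lhs => rw [← c.sum_repr (MonoidAlgebra.of K G g)]
    exact Finset.sum_congr rfl fun i _ => by rw [hc0]
  -- The `(i, j)`-coordinate on the tensor square. It is integral on `Δ(Λ)` and takes the value `u i
  -- * u j` on `Δ g`.
  let F (i j : Fin n) : MonoidAlgebra K G ⊗[K] MonoidAlgebra K G →ₗ[K] K :=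
    LinearMap.mul' K K ∘ₗ TensorProduct.map (c.coord i) (c.coord j)
  have hF (i j : Fin n) (y : Λ) : F i j (Coalgebra.comul (R := K) (y : MonoidAlgebra K G)) ∈
      Set.range (algebraMap R K) := by
    have h := hΛ.comul_mem y y.2
    refine Submodule.span_induction (p := fun t _ => F i j t ∈ Set.range (algebraMap R K))
      ?_ ?_ ?_ ?_ h
    · rintro _ ⟨s, hs, t, ht, rfl⟩
      refine ⟨b.repr ⟨s, hs⟩ i * b.repr ⟨t, ht⟩ j, ?_⟩
      rw [map_mul, ← hbc, ← hbc]
      rfl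
    · exact ⟨0, by rw [map_zero, map_zero]⟩
    · rintro x y _ _ ⟨r, hr⟩ ⟨s, hs⟩
      exact ⟨r + s, by rw [map_add, map_add, hr, hs]⟩
    · rintro a x _ ⟨r, hr⟩
      refine ⟨a * r, ?_⟩
      rw [map_mul, hr, ← algebraMap_smul K a x, map_smul, smul_eq_mul]
  have hFg (i j : Fin n) : F i j (Coalgebra.comul (R := K) (MonoidAlgebra.of K G g)) = u i * u j := by
    rw [MonoidAlgebra.of_apply, MonoidAlgebra.comul_single, CommSemiring.comul_apply]
    rfl
  -- Expanding `g` in the basis and applying `F i j` to `Δ g` shows `u i * u j ∈ N`. So `u i`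
  -- stabilises a nonzero finitely generated `R`-module and is integral over `R`.
  let N : Submodule R K := Submodule.span R (Set.range u)
  have hN : N ≠ ⊥ := by
    intro hbot
    have h0 (i : Fin n) : u i = 0 := by
      have : u i ∈ N := Submodule.subset_span ⟨i, rfl⟩
      rwa [hbot, Submodule.mem_bot] at this
    have : MonoidAlgebra.of K G g = 0 := by
      rw [hg]
      exact Finset.sum_eq_zero fun i _ => by rw [h0, zero_smul]
    rw [MonoidAlgebra.of_apply, MonoidAlgebra.single_eq_zero] at this
    exact one_ne_zero this
  have hint (i : Fin n) : u i ∈ Set.range (algebraMap R K) := by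
    refine mem_range_of_isIntegral (isIntegral_of_smul_mem_submodule N hN
      (Submodule.fg_span (Set.finite_range _)) _ fun x hx => ?_)
    induction hx using Submodule.span_induction with
    | mem x h =>
      obtain ⟨j, rfl⟩ := h
      rw [smul_eq_mul, ← hFg, hg, map_sum, map_sum]
      refine N.sum_mem fun l _ => ?_
      obtain ⟨r, hr⟩ := hF i j (b l)
      rw [map_smul, map_smul, ← hr, smul_eq_mul, mul_comm, ← Algebra.smul_def]
      exact N.smul_mem _ (Submodule.subset_span ⟨l, rfl⟩)
    | zero => rw [smul_zero]; exact N.zero_mem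
    | add x y _ _ hx hy => rw [smul_add]; exact N.add_mem hx hy
    | smul a x _ hx => rw [smul_comm]; exact N.smul_mem a hx
  rw [hg]
  refine Λ.sum_mem fun i _ => ?_
  obtain ⟨r, hr⟩ := hint i
  rw [← hr, algebraMap_smul]
  exact Λ.smul_mem (b i).2 r

/-- An order that contains the group is the group ring, if the order of the group is invertible. -/
theorem IsOrder.coeff_mem [Finite G] (hΛ : IsOrder Λ) (hG : ∀ g, MonoidAlgebra.of K G g ∈ Λ)
    (hcard : IsUnit (Nat.card G : R)) {x : MonoidAlgebra K G} (hx : x ∈ Λ) (g : G) :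
    x.coeff g ∈ Set.range (algebraMap R K) := by
  classical
  have := Fintype.ofFinite G
  have one (x : MonoidAlgebra K G) (hx : x ∈ Λ) : x.coeff 1 ∈ Set.range (algebraMap R K) := by
    obtain ⟨n, b, c, hbc⟩ := hΛ.exists_basis
    -- The trace of left multiplication is computed twice: in the basis `G`, where each diagonal
    -- entry is the coefficient at `1`, and then in a basis of `Λ`, where all entries lie in `R`.
    have e1 : LinearMap.trace K _ (LinearMap.mulLeft K x) = Nat.card G * x.coeff 1 := by
      rw [LinearMap.trace_eq_matrix_trace K (MonoidAlgebra.basis G K), Matrix.trace,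
        Nat.card_eq_fintype_card, ← nsmul_eq_mul, Fintype.card, ← Finset.sum_const]
      refine Finset.sum_congr rfl fun g _ => ?_
      rw [Matrix.diag_apply, LinearMap.toMatrix_apply, MonoidAlgebra.basis_apply,
        LinearMap.mulLeft_apply]
      change (x * MonoidAlgebra.single g 1).coeff g = _
      rw [MonoidAlgebra.coeff_mul_single_apply, mul_inv_cancel, mul_one]
    have e2 : LinearMap.trace K _ (LinearMap.mulLeft K x) ∈ Set.range (algebraMap R K) := by
      rw [LinearMap.trace_eq_matrix_trace K c, Matrix.trace]
      refine ⟨∑ i, b.repr (⟨x, hx⟩ * b i) i, ?_⟩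
      rw [map_sum]
      refine Finset.sum_congr rfl fun i _ => ?_
      have hc0 : c i = (b i : MonoidAlgebra K G) := by
        refine c.repr.injective (Finsupp.ext fun j => ?_)
        rw [hbc, c.repr_self, b.repr_self, Finsupp.single_apply, Finsupp.single_apply]
        split_ifs
        · rw [map_one]
        · rw [map_zero]
      rw [Matrix.diag_apply, LinearMap.toMatrix_apply, LinearMap.mulLeft_apply, ← hbc, hc0]
      rfl
    obtain ⟨r, hr⟩ := e2
    obtain ⟨v, hv⟩ := hcard
    refine ⟨↑v⁻¹ * r, ?_⟩
    rw [map_mul, hr, e1, ← map_natCast (algebraMap R K), ← hv, ← mul_assoc, ← map_mul,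
      Units.inv_mul, map_one, one_mul]
  -- Translation by `g⁻¹`, which lies in the order, moves the coefficient at `g` to `1`.
  have h := one (x * MonoidAlgebra.of K G g⁻¹) (Λ.mul_mem hx (hG _))
  rwa [MonoidAlgebra.of_apply, MonoidAlgebra.coeff_mul_single_apply, mul_one, inv_inv, one_mul] at h

end HopfOrder

/-! ### Projections of an internal direct product. -/

namespace IsInternalDirectProduct

variable {H : Type v} [Group H] {C L : Subgroup H} (h : IsInternalDirectProduct C L)

/-- The isomorphism `C × L ≃ H`. -/
def equiv : C × L ≃* H :=
  MulEquiv.ofBijective (MonoidHom.noncommCoprod C.subtype L.subtype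
    fun s t => h.2 s s.2 t t.2) h.1

theorem equiv_apply (x : C × L) : h.equiv x = x.1 * x.2 := rfl

/-- The projection `H → C`. -/
def fst : H →* C := (MonoidHom.fst C L).comp h.equiv.symm.toMonoidHom

/-- The projection `H → L`. -/
def snd : H →* L := (MonoidHom.snd C L).comp h.equiv.symm.toMonoidHom

theorem fst_mul_snd (x : H) : (h.fst x : H) * h.snd x = x := h.equiv.apply_symm_apply x

theorem equiv_symm_left (c : C) : h.equiv.symm c = (c, 1) :=
  h.equiv.symm_apply_eq.2 (by rw [equiv_apply, OneMemClass.coe_one, mul_one])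

theorem equiv_symm_right (g : L) : h.equiv.symm g = (1, g) :=
  h.equiv.symm_apply_eq.2 (by rw [equiv_apply, OneMemClass.coe_one, one_mul])

theorem fst_left (c : C) : h.fst c = c := congrArg Prod.fst (h.equiv_symm_left c)
theorem snd_left (c : C) : h.snd c = 1 := congrArg Prod.snd (h.equiv_symm_left c)
theorem fst_right (g : L) : h.fst g = 1 := congrArg Prod.fst (h.equiv_symm_right g)
theorem snd_right (g : L) : h.snd g = g := congrArg Prod.snd (h.equiv_symm_right g)

theorem mem_left {x : H} (hx : h.snd x = 1) : x ∈ C := by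
  rw [← h.fst_mul_snd x, hx, OneMemClass.coe_one, mul_one]
  exact (h.fst x).2

end IsInternalDirectProduct

section

variable {R : Type u} [CommRing R] {K : Type u} [Field K] [Algebra R K] {G : Type v} [Group G]

theorem isOrder_of_of_mem {Λ : Subalgebra R (MonoidAlgebra K G)} (hfg : Λ.toSubmodule.FG)
    (hG : ∀ g, MonoidAlgebra.of K G g ∈ Λ) : IsOrder Λ where
  fg := hfg
  span_eq_top := by
    refine eq_top_iff.2 fun x _ => ?_
    induction x using MonoidAlgebra.induction_on with
    | of g => exact Submodule.subset_span (hG g)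
    | add x y hx hy => exact Submodule.add_mem _ (hx trivial) (hy trivial)
    | smul c x hx => exact Submodule.smul_mem _ c (hx trivial)

theorem mapDomainAlgHom_of {G' : Type w} [Group G'] (f : G →* G') (g : G) :
    MonoidAlgebra.mapDomainAlgHom R K f (MonoidAlgebra.of K G g) = MonoidAlgebra.of K G' (f g) :=
  MonoidAlgebra.mapDomain_single

theorem of_mem_inter {Λ : Subalgebra R (MonoidAlgebra K G)} (hG : ∀ g, MonoidAlgebra.of K G g ∈ Λ)
    (T : Subgroup G) (t : T) : MonoidAlgebra.of K T t ∈ inter Λ T := by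
  change MonoidAlgebra.mapDomainAlgHom R K T.subtype (MonoidAlgebra.of K T t) ∈ Λ
  rw [mapDomainAlgHom_of]
  exact hG _

theorem interInclusion_injective (Λ : Subalgebra R (MonoidAlgebra K G)) (T : Subgroup G) :
    Function.Injective (interInclusion Λ T) := fun _ _ hab =>
  Subtype.ext (MonoidAlgebra.mapDomain_injective T.subtype_injective (congrArg Subtype.val hab))

/-- `Λ_T` is an order. -/
theorem IsOrder.inter [IsNoetherianRing R] {Λ : Subalgebra R (MonoidAlgebra K G)} (hΛ : IsOrder Λ)
    (hG : ∀ g, MonoidAlgebra.of K G g ∈ Λ) (T : Subgroup G) : IsOrder (inter Λ T) := by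
  refine isOrder_of_of_mem (Module.Finite.iff_fg.1 ?_) (of_mem_inter hG T)
  have : Module.Finite R Λ := Module.Finite.iff_fg.2 hΛ.fg
  exact Module.Finite.of_injective (interInclusion Λ T).toLinearMap (interInclusion_injective Λ T)

theorem IsOrder.finrank_eq [IsDomain R] [IsPrincipalIdealRing R] [IsFractionRing R K] [Finite G]
    {Λ : Subalgebra R (MonoidAlgebra K G)} (hΛ : IsOrder Λ) : Module.finrank R Λ = Nat.card G := by
  have := hΛ.finite
  have := hΛ.free
  have := Fintype.ofFinite G
  rw [← Module.finrank_baseChange (R := K), hΛ.tensorEquiv.toLinearEquiv.finrank_eq,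
    Module.finrank_eq_card_basis (MonoidAlgebra.basis G K), Nat.card_eq_fintype_card]

end

/-! ### The decomposition `Λ_H = Λ_C[L]`. -/

section Decomposition

variable {R : Type u} [CommRing R] {K : Type u} [Field K] [Algebra R K] {H : Type v} [Group H]
  {C L : Subgroup H} (h : IsInternalDirectProduct C L)

/-- The coefficient at `1` of the image in `K[L]`. -/
def sndCoeff (K : Type u) [Field K] : MonoidAlgebra K H →ₗ[K] K :=
  (MonoidAlgebra.basis L K).coord 1 ∘ₗ (MonoidAlgebra.mapDomainAlgHom K K h.snd).toLinearMap

theorem sndCoeff_apply (x : MonoidAlgebra K H) :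
    sndCoeff h K x = (MonoidAlgebra.mapDomainAlgHom R K h.snd x).coeff 1 := rfl

theorem sndCoeff_of [DecidableEq L] (x : H) :
    sndCoeff h K (MonoidAlgebra.of K H x) = if h.snd x = 1 then 1 else 0 := by
  rw [sndCoeff_apply (R := K), mapDomainAlgHom_of, MonoidAlgebra.of_apply]
  exact Finsupp.single_apply

/-- The projection of `K[H]` onto `K[C]`. -/
def projLeft (K : Type u) [Field K] : MonoidAlgebra K H →ₗ[K] MonoidAlgebra K H :=
  (TensorProduct.rid K _).toLinearMap ∘ₗ LinearMap.lTensor _ (sndCoeff h K) ∘ₗ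
    Coalgebra.comul

theorem projLeft_of [DecidableEq L] (x : H) : projLeft h K (MonoidAlgebra.of K H x) =
    if h.snd x = 1 then MonoidAlgebra.of K H x else 0 := by
  have e : Coalgebra.comul (R := K) (MonoidAlgebra.of K H x) =
      MonoidAlgebra.of K H x ⊗ₜ[K] MonoidAlgebra.of K H x := by
    rw [MonoidAlgebra.of_apply, MonoidAlgebra.comul_single, CommSemiring.comul_apply]
    rfl
  rw [projLeft, LinearMap.comp_apply, LinearMap.comp_apply, e, LinearMap.lTensor_tmul,
    LinearEquiv.coe_coe, TensorProduct.rid_tmul, sndCoeff_of, ite_smul, one_smul, zero_smul]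

theorem projLeft_mem_range (x : MonoidAlgebra K H) :
    ∃ a, MonoidAlgebra.mapDomainAlgHom R K C.subtype a = projLeft h K x := by
  classical
  suffices hx : projLeft h K x ∈
      LinearMap.range (MonoidAlgebra.mapDomainAlgHom K K C.subtype).toLinearMap from hx
  induction x using MonoidAlgebra.induction_on with
  | of x =>
    rw [projLeft_of]
    split_ifs with hx
    · exact ⟨MonoidAlgebra.of K C ⟨x, h.mem_left hx⟩, mapDomainAlgHom_of (R := K) C.subtype _⟩
    · exact Submodule.zero_mem _
  | add x y hx hy => rw [map_add]; exact Submodule.add_mem _ hx hy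
  | smul c x hx => rw [map_smul]; exact Submodule.smul_mem _ c hx

/-- The summand for `g` is the part of `x` supported on the coset `C g`: it is translated into `C`,
projected, and translated back. -/
theorem sum_projLeft [Fintype L] (x : MonoidAlgebra K H) :
    ∑ g : L, projLeft h K (x * MonoidAlgebra.of K H (g : H)⁻¹) * MonoidAlgebra.of K H g = x := by
  classical
  induction x using MonoidAlgebra.induction_on with
  | of x =>
    rw [Finset.sum_eq_single (h.snd x)]
    · rw [← map_mul, projLeft_of, if_pos, ← map_mul, inv_mul_cancel_right]
      rw [map_mul, map_inv, h.snd_right, mul_inv_cancel]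
    · intro g _ hg
      rw [← map_mul, projLeft_of, if_neg, zero_mul]
      rw [map_mul, map_inv, h.snd_right, mul_inv_eq_one]
      exact fun e => hg e.symm
    · exact fun hx => absurd (Finset.mem_univ _) hx
  | add x y hx hy =>
    conv_rhs => rw [← hx, ← hy]
    rw [← Finset.sum_add_distrib]
    exact Finset.sum_congr rfl fun g _ => by rw [add_mul, map_add, add_mul]
  | smul c x hx =>
    conv_rhs => rw [← hx]
    rw [Finset.smul_sum]
    exact Finset.sum_congr rfl fun g _ => by rw [smul_mul_assoc, map_smul, smul_mul_assoc]

variable [IsDomain R] [IsPrincipalIdealRing R] [IsFractionRing R K] [Finite H]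
  {Λ : Subalgebra R (MonoidAlgebra K H)}

/-- The projection contracts the second factor of `Δ` with `sndCoeff`, so it suffices that
`sndCoeff` is `R`-valued on `Λ`. This holds because the image `Λ'` of `Λ` in `K[L]` is an order
containing `L`, and `|L|` is a unit. -/
theorem IsHopfOrder.projLeft_mem (hΛ : IsHopfOrder Λ) (hL : IsUnit (Nat.card L : R))
    {x : MonoidAlgebra K H} (hx : x ∈ Λ) : projLeft h K x ∈ Λ := by
  let Λ' := Λ.map (MonoidAlgebra.mapDomainAlgHom R K h.snd)
  have hG (g : L) : MonoidAlgebra.of K L g ∈ Λ' :=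
    ⟨MonoidAlgebra.of K H g, hΛ.of_mem g, by
      refine (mapDomainAlgHom_of (R := R) h.snd _).trans ?_
      rw [h.snd_right]⟩
  have hfg : Λ'.toSubmodule.FG := by
    rw [show Λ'.toSubmodule = _ from Subalgebra.map_toSubmodule]
    exact hΛ.fg.map _
  have hτ (y : MonoidAlgebra K H) (hy : y ∈ Λ) : sndCoeff h K y ∈ Set.range (algebraMap R K) :=
    (isOrder_of_of_mem hfg hG).coeff_mem hG hL ⟨y, hy, rfl⟩ 1
  have hF := hΛ.comul_mem x hx
  change (TensorProduct.rid K _) (LinearMap.lTensor _ (sndCoeff h K) (Coalgebra.comul x)) ∈ Λ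
  generalize Coalgebra.comul (R := K) x = t at hF
  induction hF using Submodule.span_induction with
  | mem t ht =>
    obtain ⟨a, ha, b, hb, rfl⟩ := ht
    obtain ⟨r, hr⟩ := hτ b hb
    rw [LinearMap.lTensor_tmul, TensorProduct.rid_tmul, ← hr, algebraMap_smul]
    exact Λ.smul_mem ha r
  | zero => rw [map_zero, map_zero]; exact Λ.zero_mem
  | add s t _ _ hs ht => rw [map_add, map_add]; exact Λ.add_mem hs ht
  | smul r t _ ht =>
    rw [← algebraMap_smul K r t, map_smul, map_smul, algebraMap_smul]
    exact Λ.smul_mem ht r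

/-- `Λ_H = Λ_C[L]`. -/
theorem IsHopfOrder.toSubmodule_eq (h : IsInternalDirectProduct C L) (hΛ : IsHopfOrder Λ)
    (hL : IsUnit (Nat.card L : R)) :
    Subalgebra.toSubmodule Λ = interGroupRing Λ C L := by
  have := Fintype.ofFinite L
  refine le_antisymm (fun x hx => ?_) (Submodule.span_le.2 ?_)
  · rw [← sum_projLeft h x]
    refine Submodule.sum_mem _ fun g _ => Submodule.subset_span ?_
    obtain ⟨a, ha⟩ := projLeft_mem_range (R := R) h (x * MonoidAlgebra.of K H (g : H)⁻¹)
    refine ⟨a, ?_, g, g.2, by rw [ha]⟩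
    change MonoidAlgebra.mapDomainAlgHom R K C.subtype a ∈ Λ
    rw [ha]
    exact hΛ.projLeft_mem h hL (Λ.mul_mem hx (hΛ.of_mem _))
  · rintro _ ⟨a, ha, g, _, rfl⟩
    exact Λ.mul_mem ha (hΛ.of_mem g)

end Decomposition

/-! ### Orders containing the group when the group order is a unit. -/

section GroupRing

variable {R : Type u} [CommRing R] [IsDomain R] [IsDiscreteValuationRing R] {K : Type u} [Field K]
  [Algebra R K] [IsFractionRing R K] {G : Type v} [Group G] [Fintype G]
  {Λ : Subalgebra R (MonoidAlgebra K G)}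

local notation "k" => IsLocalRing.ResidueField R

theorem IsOrder.exists_eq_sum (hΛ : IsOrder Λ) (hG : ∀ g, MonoidAlgebra.of K G g ∈ Λ)
    (hcard : IsUnit (Nat.card G : R)) (x : Λ) :
    ∃ r : G → R, x = ∑ g, r g • (⟨MonoidAlgebra.of K G g, hG g⟩ : Λ) := by
  choose r hr using hΛ.coeff_mem hG hcard x.2
  refine ⟨r, Subtype.ext ?_⟩
  rw [AddSubmonoidClass.coe_finsetSum]
  conv_lhs => rw [← (MonoidAlgebra.basis G K).sum_repr (x : MonoidAlgebra K G)]
  refine Finset.sum_congr rfl fun g _ => ?_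
  change (x : MonoidAlgebra K G).coeff g • _ = r g • MonoidAlgebra.of K G g
  rw [← hr, algebraMap_smul, MonoidAlgebra.basis_apply]
  rfl

/-- Elements of `Λ` are `R`-combinations of group elements, so the reduction is a quotient of
`k[G]`. Maschke's theorem applies, as `|G|` is nonzero in `k`. -/
theorem IsOrder.isSemisimpleRing_reduction (hΛ : IsOrder Λ) (hG : ∀ g, MonoidAlgebra.of K G g ∈ Λ)
    (hcard : IsUnit (Nat.card G : R)) : IsSemisimpleRing (k ⊗[R] Λ) := by
  let F : G →* k ⊗[R] Λ :=
    { toFun := fun g => 1 ⊗ₜ ⟨MonoidAlgebra.of K G g, hG g⟩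
      map_one' := by
        rw [Algebra.TensorProduct.one_def]
        exact congrArg _ (Subtype.ext (map_one _))
      map_mul' := fun g g' => by
        rw [Algebra.TensorProduct.tmul_mul_tmul, one_mul]
        exact congrArg _ (Subtype.ext (map_mul _ _ _)) }
  have : NeZero (Nat.card G : k) := ⟨by
    rw [← map_natCast (IsLocalRing.residue R)]
    exact (hcard.map _).ne_zero⟩
  refine RingHom.isSemisimpleRing_of_surjective (R := MonoidAlgebra k G)
    (MonoidAlgebra.lift k (k ⊗[R] Λ) G F).toRingHom fun x => ?_
  obtain ⟨m, rfl⟩ := exists_one_tmul (R := R) (M := Λ) x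
  obtain ⟨r, rfl⟩ := hΛ.exists_eq_sum hG hcard m
  refine ⟨∑ g, MonoidAlgebra.single g (IsLocalRing.residue R (r g)), ?_⟩
  rw [map_sum, TensorProduct.tmul_sum]
  refine Finset.sum_congr rfl fun g _ => ?_
  refine (MonoidAlgebra.lift_single F g _).trans ?_
  rw [TensorProduct.tmul_smul]
  exact algebraMap_smul k (r g) _

theorem IsOrder.exists_idempotent_lift [TopologicalSpace K] [IsTopologicalRing K] [T2Space K]
    (hR : IsCompact (Set.range (algebraMap R K)))
    (hΛ : IsOrder Λ) (hG : ∀ g, MonoidAlgebra.of K G g ∈ Λ)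
    (hcard : IsUnit (Nat.card G : R)) (x : Λ) (hx : IsIdempotentElem ((1 : k) ⊗ₜ[R] x)) :
    ∃ e : Λ, IsIdempotentElem e ∧ (1 : k) ⊗ₜ[R] e = 1 ⊗ₜ x := by
  obtain ⟨π, hπ⟩ := IsDiscreteValuationRing.exists_irreducible R
  obtain ⟨w, hw⟩ : ∃ w : Λ, π • w = x * x - x := by
    rw [← one_tmul_eq_zero_iff hπ, TensorProduct.tmul_sub, sub_eq_zero]
    have := hx.eq
    rwa [Algebra.TensorProduct.tmul_mul_tmul, one_mul] at this
  -- The residue class of `x`. It is closed under multiplication because `x * x = x + π • w`, and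
  -- any idempotent in it is a lift.
  let S : Set (MonoidAlgebra K G) := {y | ∃ z : Λ, y = ((x + π • z : Λ) : MonoidAlgebra K G)}
  -- In coordinates the class is a product of translates of `πR`, hence compact. Membership in `Λ`
  -- can be tested coordinatewise since the elements of `Λ` are exactly those with coefficients in
  -- `R`.
  let T : Set (G → K) := Set.univ.pi fun g =>
    (fun c => (x : MonoidAlgebra K G).coeff g + algebraMap R K π * c) '' Set.range (algebraMap R K)
  have hT : IsCompact T := isCompact_univ_pi fun g => hR.image (by fun_prop)
  have hcoe (z : Λ) (g : G) : ((x + π • z : Λ) : MonoidAlgebra K G).coeff g =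
      (x : MonoidAlgebra K G).coeff g + algebraMap R K π * (z : MonoidAlgebra K G).coeff g := by
    rw [← Algebra.smul_def]
    rfl
  obtain ⟨_, ⟨z, rfl⟩, he⟩ := exists_isIdempotentElem_of_isCompact S ⟨_, 0, rfl⟩ (by
      rintro _ ⟨y, rfl⟩ _ ⟨z, rfl⟩
      refine ⟨w + x * z + y * x + π • (y * z), ?_⟩
      rw [← MulMemClass.coe_mul]
      congr 1
      rw [← sub_eq_zero]
      have : x * x = x + π • w := by rw [hw]; abel
      simp only [mul_add, add_mul, this, smul_add, mul_smul_comm, smul_mul_assoc]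
      abel) T hT (fun y => by
      constructor
      · rintro ⟨z, rfl⟩ g _
        exact ⟨_, hΛ.coeff_mem hG hcard z.2 g, (hcoe z g).symm⟩
      · intro hy
        have hy' (g : G) : ∃ r : R, (x : MonoidAlgebra K G).coeff g +
            algebraMap R K π * algebraMap R K r = y.coeff g := by
          obtain ⟨_, ⟨r, rfl⟩, hr⟩ := hy g trivial
          exact ⟨r, hr⟩
        choose r hr using hy'
        have hz : ∑ g, algebraMap R K (r g) • MonoidAlgebra.basis G K g ∈ Λ := by
          refine Λ.sum_mem fun g _ => ?_
          rw [algebraMap_smul, MonoidAlgebra.basis_apply]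
          exact Λ.smul_mem (hG g) (r g)
        refine ⟨⟨_, hz⟩, MonoidAlgebra.ext (Finsupp.ext fun g => ?_)⟩
        rw [hcoe, ← hr]
        exact congrArg (fun c => _ + _ * c) (congrFun
          ((MonoidAlgebra.basis G K).repr_sum_self fun g => algebraMap R K (r g)) g).symm)
  refine ⟨x + π • z, Subtype.ext he, ?_⟩
  rw [TensorProduct.tmul_add, (one_tmul_eq_zero_iff hπ (π • z)).2 ⟨z, rfl⟩, add_zero]

theorem IsOrder.baseChange_surjective_of_isCompact [TopologicalSpace K] [IsTopologicalRing K]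
    [T2Space K] (hR : IsCompact (Set.range (algebraMap R K)))
    (hΛ : IsOrder Λ) (hG : ∀ g, MonoidAlgebra.of K G g ∈ Λ)
    (hcard : IsUnit (Nat.card G : R)) : Function.Surjective (baseChange.{u, v} R k Λ) := by
  have := hΛ.finite
  have := hΛ.free
  have := hΛ.isSemisimpleRing_reduction hG hcard
  exact baseChange_surjective_of_isSemisimpleRing.{u, v}
    (hΛ.exists_idempotent_lift hR hG hcard)

end GroupRing

/-! ### Characters of the cyclic factor. -/

section Characters

variable {K : Type u} [Field K] {C : Type v} [Group C]

/-- The character of `K[C]` given by a character of `C`. -/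
def groupChar (χ : C →* Kˣ) : MonoidAlgebra K C →ₐ[K] K :=
  MonoidAlgebra.lift K K C ((Units.coeHom K).comp χ)

theorem groupChar_of (χ : C →* Kˣ) (c : C) : groupChar χ (MonoidAlgebra.of K C c) = χ c :=
  MonoidAlgebra.lift_of _ _

theorem IsLargeEnough.hasEnoughRootsOfUnity {H : Type w} [Group H] [Finite H]
    (hK : IsLargeEnough K H) (T : Subgroup H) :
    HasEnoughRootsOfUnity K (Monoid.exponent T) := by
  obtain ⟨ζ, hζ⟩ := hK
  obtain ⟨m, hm⟩ := Monoid.exponent_dvd_of_monoidHom T.subtype T.subtype_injective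
  have : NeZero (Monoid.exponent T) := ⟨Monoid.exponent_ne_zero_of_finite⟩
  exact
    { prim := ⟨ζ ^ m, hζ.pow (Nat.pos_of_ne_zero Monoid.exponent_ne_zero_of_finite)
        (by rw [hm, mul_comm])⟩
      cyc := inferInstance }

theorem finite_characters [Finite C] [IsCyclic C] [HasEnoughRootsOfUnity K (Monoid.exponent C)] :
    Finite (C →* Kˣ) := by
  let : CommGroup C := IsCyclic.commGroup
  obtain ⟨e⟩ := CommGroup.monoidHom_mulEquiv_of_hasEnoughRootsOfUnity C K
  exact Finite.of_equiv C e.symm.toEquiv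

/-- Fourier inversion: orthogonality of characters (`hsum`) recovers each coefficient of `a`, up to
the number of characters, from the values `groupChar χ a`. That number is nonzero in characteristic
zero. -/
theorem eq_zero_of_groupChar_eq_zero [CharZero K] [Finite C] [IsCyclic C]
    [HasEnoughRootsOfUnity K (Monoid.exponent C)] {a : MonoidAlgebra K C}
    (ha : ∀ χ : C →* Kˣ, groupChar χ a = 0) : a = 0 := by
  classical
  have := finite_characters (K := K) (C := C)
  have := Fintype.ofFinite (C →* Kˣ)
  have hsum (c : C) : ∑ χ : C →* Kˣ, (χ c : K) = if c = 1 then (Fintype.card (C →* Kˣ) : K) else 0 := by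
    split_ifs with hc
    · simp only [hc, map_one, Units.val_one, Finset.sum_const, Finset.card_univ, nsmul_eq_mul,
        mul_one]
    · let ev : (C →* Kˣ) →* K := (Units.coeHom K).comp (MonoidHom.eval c)
      refine sum_hom_units_eq_zero ev fun hev => ?_
      let : CommGroup C := IsCyclic.commGroup
      obtain ⟨χ, hχ⟩ := CommGroup.exists_apply_ne_one_of_hasEnoughRootsOfUnity C K hc
      exact hχ (Units.ext (DFunLike.congr_fun hev χ))
  have key (g : C) (a : MonoidAlgebra K C) : ∑ χ : C →* Kˣ, (χ g⁻¹ : K) * groupChar χ a =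
      Fintype.card (C →* Kˣ) * a.coeff g := by
    induction a using MonoidAlgebra.induction_on with
    | of c =>
      simp only [groupChar_of, ← Units.val_mul, ← map_mul]
      rw [hsum, MonoidAlgebra.of_apply]
      change _ = _ * (Finsupp.single c (1 : K)) g
      rw [Finsupp.single_apply, mul_ite, mul_one, mul_zero]
      exact if_congr (inv_mul_eq_one.trans eq_comm) rfl rfl
    | add x y hx hy =>
      simp only [map_add, mul_add, Finset.sum_add_distrib, hx, hy]
      exact (mul_add _ _ _).symm
    | smul r x hx =>
      simp only [map_smul, smul_eq_mul, mul_left_comm _ r, ← Finset.mul_sum, hx]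
      exact mul_left_comm _ _ _
  refine MonoidAlgebra.ext (Finsupp.ext fun g => ?_)
  have h := key g a
  simp only [ha, mul_zero, Finset.sum_const_zero] at h
  exact (mul_eq_zero.1 h.symm).resolve_left (Nat.cast_ne_zero.2 Fintype.card_ne_zero)

end Characters

/-! ### The projections `K[H] → K[L]` given by characters of `C`. -/

section

variable {R : Type u} [CommRing R] {K : Type u} [Field K] [Algebra R K] {H : Type v} [Group H]
  {C L : Subgroup H}

theorem commute_mapDomainAlgHom (h : IsInternalDirectProduct C L) (a : MonoidAlgebra K C)
    (b : MonoidAlgebra K L) : Commute (MonoidAlgebra.mapDomainAlgHom R K C.subtype a)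
      (MonoidAlgebra.mapDomainAlgHom R K L.subtype b) := by
  change Commute (MonoidAlgebra.mapDomainAlgHom K K C.subtype a)
    (MonoidAlgebra.mapDomainAlgHom K K L.subtype b)
  induction a using MonoidAlgebra.induction_on with
  | of c =>
    induction b using MonoidAlgebra.induction_on with
    | of g =>
      rw [mapDomainAlgHom_of, mapDomainAlgHom_of]
      exact Commute.map (f := MonoidAlgebra.of K H) (show Commute (c : H) g from h.2 c c.2 g g.2)
    | add x y hx hy => rw [map_add]; exact hx.add_right hy
    | smul r x hx => rw [map_smul]; exact hx.smul_right r
  | add x y hx hy => rw [map_add]; exact hx.add_left hy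
  | smul r x hx => rw [map_smul]; exact hx.smul_left r

/-- The projection `K[H] → K[L]` given by a character of `C`. -/
def groupProj (h : IsInternalDirectProduct C L) (χ : C →* Kˣ) :
    MonoidAlgebra K H →ₐ[K] MonoidAlgebra K L :=
  MonoidAlgebra.lift K _ H
    { toFun := fun x => (χ (h.fst x) : K) • MonoidAlgebra.of K L (h.snd x)
      map_one' := by simp only [map_one, Units.val_one, one_smul]
      map_mul' := fun x y => by
        rw [map_mul, map_mul, map_mul, map_mul, Units.val_mul, smul_mul_smul_comm] }

theorem groupProj_of (h : IsInternalDirectProduct C L) (χ : C →* Kˣ) (x : H) :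
    groupProj h χ (MonoidAlgebra.of K H x) = (χ (h.fst x) : K) • MonoidAlgebra.of K L (h.snd x) :=
  MonoidAlgebra.lift_of _ _

theorem groupProj_left (h : IsInternalDirectProduct C L) (χ : C →* Kˣ) (a : MonoidAlgebra K C) :
    groupProj h χ (MonoidAlgebra.mapDomainAlgHom R K C.subtype a) =
      algebraMap K _ (groupChar χ a) := by
  change groupProj h χ (MonoidAlgebra.mapDomainAlgHom K K C.subtype a) = _
  induction a using MonoidAlgebra.induction_on with
  | of c =>
    rw [mapDomainAlgHom_of, groupProj_of, groupChar_of, Subgroup.coe_subtype, h.fst_left, h.snd_left,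
      map_one, Algebra.algebraMap_eq_smul_one]
  | add x y hx hy => simp only [map_add, hx, hy]
  | smul r x hx => rw [map_smul, map_smul, hx, map_smul, smul_eq_mul, map_mul, Algebra.smul_def]

theorem groupProj_right (h : IsInternalDirectProduct C L) (χ : C →* Kˣ) (b : MonoidAlgebra K L) :
    groupProj h χ (MonoidAlgebra.mapDomainAlgHom R K L.subtype b) = b := by
  change groupProj h χ (MonoidAlgebra.mapDomainAlgHom K K L.subtype b) = _
  induction b using MonoidAlgebra.induction_on with
  | of c =>
    rw [mapDomainAlgHom_of, groupProj_of, Subgroup.coe_subtype, h.fst_right, h.snd_right,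
      map_one, Units.val_one, one_smul]
  | add x y hx hy => simp only [map_add, hx, hy]
  | smul r x hx => rw [map_smul, map_smul, hx]

end

/-! ### Integral characters, and `Λ` as a product of `Λ_C` and `Λ_L`. -/

section Split

variable {R : Type u} [CommRing R] [IsDomain R] [IsPrincipalIdealRing R] {K : Type u} [Field K]
  [Algebra R K] [IsFractionRing R K]

/-- A homomorphism to the field of fractions from an algebra that is integral over `R`. -/
def liftBase {A : Type*} [Ring A] [Algebra R A] [Module.Finite R A] (f : A →ₐ[R] K) : A →ₐ[R] R :=
  (Algebra.botEquivOfInjective (IsFractionRing.injective R K)).toAlgHom.comp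
    (f.codRestrict ⊥ fun a =>
      Algebra.mem_bot.2 (mem_range_of_isIntegral ((IsIntegral.of_finite R a).map f)))

theorem algebraMap_liftBase {A : Type*} [Ring A] [Algebra R A] [Module.Finite R A]
    (f : A →ₐ[R] K) (a : A) : algebraMap R K (liftBase f a) = f a :=
  congrArg Subtype.val ((Algebra.botEquivOfInjective (IsFractionRing.injective R K)).symm_apply_apply
    (f.codRestrict ⊥ (fun a =>
      Algebra.mem_bot.2 (mem_range_of_isIntegral ((IsIntegral.of_finite R a).map f))) a))

variable {H : Type v} [Group H] {Λ : Subalgebra R (MonoidAlgebra K H)} {C L : Subgroup H}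

theorem IsHopfOrder.finite_inter (hΛ : IsHopfOrder Λ) (T : Subgroup H) :
    Module.Finite R (inter Λ T) := (hΛ.toIsOrder.inter hΛ.of_mem T).finite

/-- The character of `Λ_C` given by a character of `C`. -/
def IsHopfOrder.interChar (hΛ : IsHopfOrder Λ) (χ : C →* Kˣ) : inter Λ C →ₐ[R] R :=
  haveI := hΛ.finite_inter C
  liftBase (((groupChar χ).restrictScalars R).comp (inter Λ C).val)

theorem IsHopfOrder.algebraMap_interChar (hΛ : IsHopfOrder Λ) (χ : C →* Kˣ) (a : inter Λ C) :
    algebraMap R K (hΛ.interChar χ a) = groupChar χ a :=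
  haveI := hΛ.finite_inter C
  algebraMap_liftBase _ a

variable [Finite H]

/-- By `Λ = Λ_C[L]` only the products `a * g` matter. Their image is `χ(a) g`, where `χ(a)` lies in
`R` because `a` is integral. -/
theorem IsHopfOrder.groupProj_mem (hΛ : IsHopfOrder Λ) (h : IsInternalDirectProduct C L)
    (hL : IsUnit (Nat.card L : R)) (χ : C →* Kˣ) {x : MonoidAlgebra K H} (hx : x ∈ Λ) :
    groupProj h χ x ∈ inter Λ L := by
  have hx' : x ∈ interGroupRing Λ C L := hΛ.toSubmodule_eq h hL ▸ hx
  refine Submodule.span_induction (p := fun x _ => groupProj h χ x ∈ inter Λ L) ?_ ?_ ?_ ?_ hx'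
  · rintro _ ⟨a, ha, g, hg, rfl⟩
    rw [map_mul, groupProj_left, groupProj_of, h.fst_right ⟨g, hg⟩, h.snd_right ⟨g, hg⟩, map_one,
      Units.val_one, one_smul, ← Algebra.smul_def]
    have e := hΛ.algebraMap_interChar χ ⟨a, ha⟩
    rw [← e, algebraMap_smul]
    exact (inter Λ L).smul_mem (of_mem_inter hΛ.of_mem L _) _
  · rw [map_zero]; exact Subalgebra.zero_mem _
  · intro x y _ _ hx hy
    rw [map_add]; exact Subalgebra.add_mem _ hx hy
  · intro r x _ hx
    rw [← algebraMap_smul K r x, map_smul, algebraMap_smul]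
    exact Subalgebra.smul_mem _ hx r

/-- `Λ` is the product of `Λ_C` and `Λ_L`. -/
def IsHopfOrder.splitProduct [CharZero K] (hΛ : IsHopfOrder Λ) (hK : IsLargeEnough K H)
    (h : IsInternalDirectProduct C L) (hC : IsCyclic C) (hL : IsUnit (Nat.card L : R)) :
    SplitProduct R (inter Λ C) (inter Λ L) Λ (C →* Kˣ) where
  iA := interInclusion Λ C
  iB := interInclusion Λ L
  char := hΛ.interChar
  proj χ := (((groupProj h χ).restrictScalars R).comp Λ.val).codRestrict (inter Λ L)
    fun x => hΛ.groupProj_mem h hL χ x.2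
  commute a b := Subtype.ext (commute_mapDomainAlgHom (R := R) h (a : MonoidAlgebra K C) b)
  span d := by
    have hd : (d : MonoidAlgebra K H) ∈ interGroupRing Λ C L := hΛ.toSubmodule_eq h hL ▸ d.2
    suffices hle : interGroupRing Λ C L ≤ (Submodule.span R {x : Λ | ∃ a b,
        x = interInclusion Λ C a * interInclusion Λ L b}).map Λ.val.toLinearMap by
      obtain ⟨y, hy, hyd⟩ := hle hd
      rwa [Subtype.ext hyd] at hy
    refine Submodule.span_le.2 ?_
    rintro _ ⟨a, ha, g, hg, rfl⟩
    refine ⟨_, Submodule.subset_span ⟨⟨a, ha⟩, ⟨_, of_mem_inter hΛ.of_mem L ⟨g, hg⟩⟩, rfl⟩, ?_⟩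
    exact congrArg (_ * ·) (mapDomainAlgHom_of (R := R) (K := K) L.subtype ⟨g, hg⟩)
  proj_right χ b := Subtype.ext (groupProj_right (R := R) h χ (b : MonoidAlgebra K L))
  proj_left χ a := Subtype.ext ((groupProj_left (R := R) h χ (a : MonoidAlgebra K C)).trans (by
    rw [← hΛ.algebraMap_interChar, ← IsScalarTower.algebraMap_apply]
    rfl))
  eq_zero a ha := by
    have := hK.hasEnoughRootsOfUnity C
    refine Subtype.ext (eq_zero_of_groupChar_eq_zero fun χ => ?_)
    rw [← hΛ.algebraMap_interChar, ha, map_zero]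

theorem IsHopfOrder.finrank_eq_mul (hΛ : IsHopfOrder Λ) (h : IsInternalDirectProduct C L) :
    Module.finrank R Λ = Module.finrank R (inter Λ C) * Module.finrank R (inter Λ L) := by
  rw [hΛ.toIsOrder.finrank_eq, (hΛ.toIsOrder.inter hΛ.of_mem C).finrank_eq,
    (hΛ.toIsOrder.inter hΛ.of_mem L).finrank_eq, ← Nat.card_prod]
  exact (Nat.card_congr h.equiv.toEquiv).symm

end Split

/-! ### The valuation ring of a finite extension of `ℚ_p`. -/

theorem isDiscreteValuationRing_of_properSpace {K : Type u} [NontriviallyNormedField K]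
    [IsUltrametricDist K] [ProperSpace K] (V : ValuationSubring K) (hV : ∀ x, x ∈ V ↔ ‖x‖ ≤ 1) :
    IsDiscreteValuationRing V := by
  let : Valued K NNReal := NormedField.toValued
  have hc : IsCompact {x : K | ‖x‖ ≤ 1} := by
    simpa [Metric.closedBall, dist_zero_right] using isCompact_closedBall (0 : K) 1
  have hs : (Valued.integer K : Set K) = {x : K | ‖x‖ ≤ 1} :=
    Set.ext fun x => Valued.integer.mem_iff
  have : CompactSpace (Valued.integer K) := isCompact_iff_compactSpace.1 (hs ▸ hc)
  have : (Valued.v : Valuation K NNReal).IsNontrivial := by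
    obtain ⟨x, hx0, hx1⟩ := NormedField.exists_norm_lt_one K
    refine ⟨x, ?_, ?_⟩
    · rw [Ne, map_eq_zero]
      exact norm_pos_iff.1 hx0
    · intro h
      exact hx1.ne (congrArg NNReal.toReal h)
  -- Compactness of the closed unit ball, together with nontriviality of the valuation, forces
  -- discreteness.
  have : IsDiscreteValuationRing (Valued.integer K) :=
    Valued.integer.isDiscreteValuationRing_of_compactSpace
  let e : Valued.integer K ≃+* V :=
    RingEquiv.subringCongr (s := Valued.integer K) (t := V.toSubring)
      (SetLike.ext fun x => Valued.integer.mem_iff.trans (hV x).symm)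
  exact IsDiscreteValuationRing.RingEquivClass.isDiscreteValuationRing e

section Padic

variable (p : ℕ) [Fact p.Prime] (K : Type u) [Field K] [Algebra ℚ_[p] K]
  [FiniteDimensional ℚ_[p] K]

theorem isDiscreteValuationRing_padicIntegers :
    IsDiscreteValuationRing (padicIntegers p K) := by
  let := spectralNorm.nontriviallyNormedField ℚ_[p] K
  let := spectralNorm.normedSpace ℚ_[p] K
  have : ProperSpace K := FiniteDimensional.proper ℚ_[p] K
  have : IsUltrametricDist K := IsUltrametricDist.isUltrametricDist_of_isNonarchimedean_norm
    isNonarchimedean_spectralNorm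
  exact isDiscreteValuationRing_of_properSpace _ fun x => Iff.rfl

/-- The topology of the spectral norm is used only for lifting idempotents. It is supplied
existentially because `K` is given as a bare field. -/
theorem exists_isCompact_padicIntegers : ∃ (_ : TopologicalSpace K), IsTopologicalRing K ∧
    T2Space K ∧ IsCompact (Set.range (algebraMap (padicIntegers p K) K)) := by
  let := spectralNorm.nontriviallyNormedField ℚ_[p] K
  let := spectralNorm.normedSpace ℚ_[p] K
  have : ProperSpace K := FiniteDimensional.proper ℚ_[p] K
  refine ⟨inferInstance, inferInstance, inferInstance, ?_⟩
  have h : Set.range (algebraMap (padicIntegers p K) K) = {x : K | ‖x‖ ≤ 1} := by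
    ext x
    exact ⟨fun ⟨y, hy⟩ => hy ▸ y.2, fun hx => ⟨⟨x, hx⟩, rfl⟩⟩
  rw [h]
  simpa [Metric.closedBall, dist_zero_right] using isCompact_closedBall (0 : K) 1

variable {p}

theorem isUnit_natCast_padicIntegers {n : ℕ} (hn : n.Coprime p) :
    IsUnit (n : padicIntegers p K) := by
  have h1 : ‖(n : ℚ_[p])‖ = 1 := by
    rw [Padic.norm_natCast_eq_one_iff]
    exact hn.symm
  have h0 : (n : ℚ_[p]) ≠ 0 := norm_ne_zero_iff.1 (by rw [h1]; exact one_ne_zero)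
  have hinv : algebraMap ℚ_[p] K (n : ℚ_[p])⁻¹ ∈ padicIntegers p K := by
    change spectralNorm ℚ_[p] K _ ≤ 1
    rw [spectralNorm_extends, norm_inv, h1, inv_one]
  refine IsUnit.of_mul_eq_one ⟨_, hinv⟩ (Subtype.ext ?_)
  change (((n : padicIntegers p K) : K)) * algebraMap ℚ_[p] K (n : ℚ_[p])⁻¹ = 1
  have : ((n : padicIntegers p K) : K) = algebraMap ℚ_[p] K n := by rw [map_natCast]; rfl
  rw [this, ← map_mul, mul_inv_cancel₀ h0, map_one]

end Padic

/-! ### Formal consequences for `d_Λ` and `ψ_Λ`. -/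

section Maps

variable {R : Type u} [CommRing R] [IsDomain R] [IsDiscreteValuationRing R] {K : Type u} [Field K]
  [Algebra R K] [IsFractionRing R K] {H : Type v} [Group H] {Λ : Subalgebra R (MonoidAlgebra K H)}

local notation "k" => IsLocalRing.ResidueField R

theorem IsOrder.existsUnique_decompositionMap (hΛ : IsOrder Λ) (hφ : Function.Bijective hΛ.phi) :
    ∃! d, hΛ.IsDecompositionMap d := by
  let e := AddEquiv.ofBijective hΛ.phi hφ
  refine ⟨(delta Λ).comp e.symm.toAddMonoidHom, ?_, fun d hd => ?_⟩
  · exact AddMonoidHom.ext fun x => congrArg (delta Λ) (e.symm_apply_apply x)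
  · refine AddMonoidHom.ext fun y => ?_
    obtain ⟨x, rfl⟩ := hφ.2 y
    exact (DFunLike.congr_fun hd x).trans (congrArg (delta Λ) (e.symm_apply_apply x).symm)

theorem IsOrder.decompositionMap_surjective (hΛ : IsOrder Λ)
    (hδ : Function.Surjective (baseChange.{u, v} R k Λ)) {d} (hd : hΛ.IsDecompositionMap d) :
    Function.Surjective d := fun y => by
  obtain ⟨x, rfl⟩ := hδ y
  exact ⟨hΛ.phi x, DFunLike.congr_fun hd x⟩

/-- The composite of `ψ` with the injective map `latToG0` is the zero map on torsion classes. -/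
theorem IsOrder.localizationMap_eq_zero (hΛ : IsOrder Λ) (ht : torsToG0 R Λ = 0) {ψ}
    (hψ : IsLocalizationMap Λ ψ) : ψ = 0 := by
  have := hΛ.finite
  have := hΛ.free
  refine AddMonoidHom.ext fun x => latToG0_injective ?_
  have h : (latToG0 R Λ).comp ψ = 0 := hψ.trans ht
  rw [AddMonoidHom.zero_apply, map_zero]
  exact DFunLike.congr_fun h x

theorem IsOrder.existsUnique_localizationMap (hΛ : IsOrder Λ) (ht : torsToG0 R Λ = 0) :
    ∃! ψ, IsLocalizationMap Λ ψ :=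
  ⟨0, (AddMonoidHom.comp_zero _).trans ht.symm, fun _ hψ => hΛ.localizationMap_eq_zero ht hψ⟩

theorem IsOrder.range_localizationMap (hΛ : IsOrder Λ) (ht : torsToG0 R Λ = 0) {ψ}
    (hψ : IsLocalizationMap Λ ψ) : ψ.range = ⊥ :=
  AddMonoidHom.range_eq_bot_iff.2 (hΛ.localizationMap_eq_zero ht hψ)

end Maps

/-! ### The explicit form of the tensor isomorphism. -/

section Tensor

variable {k : Type u} [Field k] {A B D : Type w} [Ring A] [Algebra k A] [Ring B] [Algebra k B]
  [Ring D] [Algebra k D]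

theorem exists_equiv_tensorModule (Φ : A ⊗[k] B ≃ₐ[k] D) [Module.Finite k A] [Module.Finite k B]
    (hΦ : Function.Bijective (tensorG0 Φ)) (fA : A →ₐ[k] D) (fB : B →ₐ[k] D)
    (hA : ∀ a, Φ (a ⊗ₜ 1) = fA a) (hB : ∀ b, Φ (1 ⊗ₜ b) = fB b) :
    ∃ e : G0 k A ⊗[ℤ] G0 k B ≃+ G0 k D,
      ∀ (M : AlgModule k A) (N : AlgModule k B) (hM : Module.Finite A M) (hN : Module.Finite B N),
        ∃ (X : AlgModule k D) (hX : Module.Finite D X) (θ : M ⊗[k] N ≃ₗ[k] X),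
          (∀ a m n, fA a • θ (m ⊗ₜ n) = θ ((a • m) ⊗ₜ n)) ∧
          (∀ b m n, fB b • θ (m ⊗ₜ n) = θ (m ⊗ₜ (b • n))) ∧
          e (Groth.cls M hM ⊗ₜ Groth.cls N hN) = Groth.cls X hX := by
  refine ⟨AddEquiv.ofBijective (tensorG0 Φ) hΦ, fun M N hM hN => ⟨tensorModule Φ M N,
    tensorModule_finite Φ M N hM hN, toTensorModule Φ M N,
    fun a m n => ?_, fun b m n => ?_, tensorG0_cls Φ M N hM hN⟩⟩
  · rw [← hA, smul_toTensorModule, tensorAction_tmul, one_smul]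
  · rw [← hB, smul_toTensorModule, tensorAction_tmul, one_smul]

end Tensor

/-! ### Surjectivity of `δ_Λ` and the tensor formula for Hopf orders. -/

section Split

variable {R : Type u} [CommRing R] [IsDomain R] [IsDiscreteValuationRing R] {K : Type u} [Field K]
  [CharZero K] [Algebra R K] [IsFractionRing R K] {H : Type v} [Group H] [Finite H]
  {Λ : Subalgebra R (MonoidAlgebra K H)} {C L : Subgroup H}

local notation "k" => IsLocalRing.ResidueField R

/-- The characters of `C` reduce the question to `Λ_L`, an order containing `L` with `|L|` a unit,
where idempotents lift by compactness of `R`. -/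
theorem IsHopfOrder.delta_surjective [TopologicalSpace K] [IsTopologicalRing K] [T2Space K]
    (hΛ : IsHopfOrder Λ) (hK : IsLargeEnough K H)
    (h : IsInternalDirectProduct C L) (hC : IsCyclic C) (hL : IsUnit (Nat.card L : R))
    (hR : IsCompact (Set.range (algebraMap R K))) :
    Function.Surjective (baseChange.{u, v} R k Λ) := by
  have oC := hΛ.toIsOrder.inter hΛ.of_mem C
  have oL := hΛ.toIsOrder.inter hΛ.of_mem L
  have := oC.finite
  have := oC.free
  have := oL.finite
  have := oL.free
  have := hΛ.toIsOrder.finite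
  have := hΛ.toIsOrder.free
  have := Fintype.ofFinite L
  have := hK.hasEnoughRootsOfUnity C
  have := finite_characters (K := K) (C := C)
  exact (hΛ.splitProduct hK h hC hL).baseChange_surjective (hΛ.finrank_eq_mul h)
    (oL.baseChange_surjective_of_isCompact hR (of_mem_inter hΛ.of_mem L) hL)

theorem IsHopfOrder.exists_tensor_equiv
    (hΛ : IsHopfOrder Λ) (hK : IsLargeEnough K H)
    (h : IsInternalDirectProduct C L) (hC : IsCyclic C) (hL : IsUnit (Nat.card L : R)) :
    ∃ e : G0 k (Reduction (inter Λ C)) ⊗[ℤ] G0 k (Reduction (inter Λ L)) ≃+ G0 k (Reduction Λ),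
      ∀ (M : AlgModule k (Reduction (inter Λ C))) (N : AlgModule k (Reduction (inter Λ L)))
        (hM : Module.Finite (Reduction (inter Λ C)) M)
        (hN : Module.Finite (Reduction (inter Λ L)) N),
        ∃ (X : AlgModule k (Reduction Λ)) (hX : Module.Finite (Reduction Λ) X)
          (θ : M ⊗[k] N ≃ₗ[k] X),
          (∀ a m n, reductionInclusion Λ C a • θ (m ⊗ₜ n) = θ ((a • m) ⊗ₜ n)) ∧
          (∀ b m n, reductionInclusion Λ L b • θ (m ⊗ₜ n) = θ (m ⊗ₜ (b • n))) ∧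
          e (Groth.cls M hM ⊗ₜ Groth.cls N hN) = Groth.cls X hX := by
  have oC := hΛ.toIsOrder.inter hΛ.of_mem C
  have oL := hΛ.toIsOrder.inter hΛ.of_mem L
  have := oC.finite
  have := oC.free
  have := oL.finite
  have := oL.free
  have := hΛ.toIsOrder.finite
  have := hΛ.toIsOrder.free
  have := hK.hasEnoughRootsOfUnity C
  have := finite_characters (K := K) (C := C)
  let P := hΛ.splitProduct hK h hC hL
  have hr := hΛ.finrank_eq_mul h
  exact exists_equiv_tensorModule (P.redEquiv hr) (SplitProduct.tensorG0_redEquiv_bijective.{u, v} P hr)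
    (reductionInclusion Λ C) (reductionInclusion Λ L)
    (SplitProduct.redEquiv_tmul_one.{u, v} P hr) (SplitProduct.redEquiv_one_tmul.{u, v} P hr)

end Split

end HopfOrders

end

/-! ### The theorem. -/

open HopfOrders in
theorem mainTheorem10 {p l : ℕ} [Fact p.Prime] [Fact l.Prime] (hlp : l ≠ p)
    {K : Type u} [Field K] [Algebra ℚ_[p] K] [FiniteDimensional ℚ_[p] K]
    {H : Type v} [Group H] [Finite H] (hH : IsElementary l H) (hK : IsLargeEnough K H)
    (C L : Subgroup H) (hCL : IsInternalDirectProduct C L)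
    (hC : IsCyclic C) (hCp : IsPGroup p C) (hL : (Nat.card L).Coprime p)
    (Λ : Subalgebra (padicIntegers p K) (MonoidAlgebra K H)) (hΛ : IsHopfOrder Λ) :
    Subalgebra.toSubmodule Λ = interGroupRing Λ C L ∧
    (∃ e : G0 (IsLocalRing.ResidueField (padicIntegers p K)) (Reduction (inter Λ C)) ⊗[ℤ]
          G0 (IsLocalRing.ResidueField (padicIntegers p K)) (Reduction (inter Λ L)) ≃+
        G0 (IsLocalRing.ResidueField (padicIntegers p K)) (Reduction Λ),
      ∀ (M : AlgModule (IsLocalRing.ResidueField (padicIntegers p K)) (Reduction (inter Λ C)))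
        (N : AlgModule (IsLocalRing.ResidueField (padicIntegers p K)) (Reduction (inter Λ L)))
        (hM : Module.Finite (Reduction (inter Λ C)) M)
        (hN : Module.Finite (Reduction (inter Λ L)) N),
        ∃ (X : AlgModule (IsLocalRing.ResidueField (padicIntegers p K)) (Reduction Λ))
          (hX : Module.Finite (Reduction Λ) X)
          (θ : M ⊗[IsLocalRing.ResidueField (padicIntegers p K)] N
            ≃ₗ[IsLocalRing.ResidueField (padicIntegers p K)] X),
          (∀ a m n, reductionInclusion Λ C a • θ (m ⊗ₜ n) = θ ((a • m) ⊗ₜ n)) ∧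
          (∀ b m n, reductionInclusion Λ L b • θ (m ⊗ₜ n) = θ (m ⊗ₜ (b • n))) ∧
          e (Groth.cls M hM ⊗ₜ Groth.cls N hN) = Groth.cls X hX) ∧
    (∃! d, hΛ.toIsOrder.IsDecompositionMap d) ∧
    (∀ d, hΛ.toIsOrder.IsDecompositionMap d → Function.Surjective d) ∧
    (∃! ψ, IsLocalizationMap Λ ψ) ∧
    (∀ ψ, IsLocalizationMap Λ ψ → ψ.range = ⊥) ∧
    hΛ.toIsOrder.HasSwanProperty := by
  have := isDiscreteValuationRing_padicIntegers p K
  have : CharZero K := charZero_of_injective_algebraMap (algebraMap ℚ_[p] K).injective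
  have hLu : IsUnit (Nat.card L : padicIntegers p K) := isUnit_natCast_padicIntegers K hL
  obtain ⟨_, _, _, hc⟩ := exists_isCompact_padicIntegers p K
  -- Surjectivity of `δ_Λ` comes first: it makes torsion classes vanish, which gives injectivity of
  -- `φ_Λ`, and with it the existence and uniqueness of `d_Λ`.
  have hδ := hΛ.delta_surjective hK hCL hC hLu hc
  have ht : torsToG0 (padicIntegers p K) Λ = 0 :=
    haveI := hΛ.toIsOrder.finite
    torsToG0_eq_zero hδ
  have hφ : Function.Bijective hΛ.toIsOrder.phi :=
    ⟨hΛ.toIsOrder.phi_injective ht, hΛ.toIsOrder.phi_surjective⟩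
  exact ⟨hΛ.toSubmodule_eq hCL hLu, hΛ.exists_tensor_equiv hK hCL hC hLu,
    hΛ.toIsOrder.existsUnique_decompositionMap hφ,
    fun d hd => hΛ.toIsOrder.decompositionMap_surjective hδ hd,
    hΛ.toIsOrder.existsUnique_localizationMap ht,
    fun ψ hψ => hΛ.toIsOrder.range_localizationMap ht hψ, hφ⟩
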